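/- All spaces and algebras are complex, and $\widehat\otimes$ is the projective tensor product of Banach spaces. For a unital commutative Banach algebra $A$ let $H_1(A,A)=\ker d_0/\operatorname{im} d_1$, where $d_0:A\widehat\otimes A\to A$ and $d_1:A\widehat\otimes A\widehat\otimes A\to A\widehat\otimes A$ are the bounded linear maps with $d_0(x\otimes a)=xa-ax$ and $d_1(x\otimes a\otimes b)=xa\otimes b-x\otimes ab+bx\otimes a$. It carries the quotient seminorm and the left and right $A$-actions induced by $c\cdot(x\otimes a)=cx\otimes a$ and $(x\otimes a)\cdot c=xc\otimes a$. "$H_1(A,A)$ is Banach" means that this seminorm is a complete norm. (1) Let $A_1,\dots,A_k$ be unital commutative Banach algebras, each of whose underlying Banach space is isomorphic (linearly homeomorphic) to $L^1(\mu_i)$ for some measure $\mu_i$, and let $\mathfrak A=A_1\widehat\otimes\cdots\widehat\otimes A_k$. Suppose that $H_1(A_i,A_i)$ is Banach for each $i$. Then $H_1(\mathfrak A,\mathfrak A)$ is Banach, and there is an isomorphism of Banach $\mathfrak A$-modules (a linear homeomorphism commuting with the actions of $\mathfrak A$) $$H_1(\mathfrak A,\mathfrak A)\;\cong\;\bigoplus_{i=1}^k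 A_1\widehat\otimes\cdots\widehat\otimes H_1(A_i,A_i)\widehat\otimes\cdots\widehat\otimes A_k ,$$ where $H_1(A_i,A_i)$ stands in the $i$-th place and $\mathfrak A$ acts componentwise, $(a_1\otimes\cdots\otimes a_k)\cdot(m_1\otimes\cdots\otimes m_k)=a_1m_1\otimes\cdots\otimes a_km_k$. (2) Let $k\ge 1$, let $\mathbb Z_+=\{0,1,2,\dots\}$, let $A_1,\dots,A_k$ be copies of the convolution algebra $\ell^1(\mathbb Z_+)$, and let $\mathfrak A_k=\ell^1(\mathbb Z_+^k)$ be the convolution algebra. There is an isometric algebra isomorphism $\Phi:A_1\widehat\otimes\cdots\widehat\otimes A_k\to\mathfrak A_k$ with $\Phi(f_1\otimes\cdots\otimes f_k)(n_1,\dots,n_k)=\prod_i f_i(n_i)$. The space $H_1(\mathfrak A_k,\mathfrak A_k)$ is a symmetric, unit-linked Banach $\mathfrak A_k$-bimodule, and, when $\mathfrak A_k$ is identified with $A_1\widehat\otimes\cdots\widehat\otimes A_k$ through $\Phi$, there is an isomorphism of Banach $\mathfrak A_k$-modules $$H_1(\mathfrak A_k,\mathfrak A_k)\;\cong\;\bigoplus_{i=1}^k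 A_1\widehat\otimes\cdots\widehat\otimes H_1(A_i,A_i)\widehat\otimes\cdots\widehat\otimes A_k .$$ In particular, the underlying Banach space of $H_1(\mathfrak A_k,\mathfrak A_k)$ is isomorphic to $\ell^1$. -/

import Mathlib

universe u v

open scoped TensorProduct
noncomputable section
namespace BanachHH

section ProjTensor

variable {ι : Type*} [Fintype ι]

/-- The projective tensor product of a finite family of (semi)normed complex spaces: the
completion of the algebraic tensor product for the projective tensor norm. -/
def ProjTensor (E : ι → Type*) [∀ i, SeminormedAddCommGroup (E i)]
    [∀ i, NormedSpace ℂ (E i)] : Type _ :=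
  UniformSpace.Completion (⨂[ℂ] i, E i)

section

variable {E : ι → Type*} [∀ i, SeminormedAddCommGroup (E i)] [∀ i, NormedSpace ℂ (E i)]

instance : NormedAddCommGroup (ProjTensor E) :=
  inferInstanceAs (NormedAddCommGroup (UniformSpace.Completion (⨂[ℂ] i, E i)))

instance : NormedSpace ℂ (ProjTensor E) :=
  inferInstanceAs (NormedSpace ℂ (UniformSpace.Completion (⨂[ℂ] i, E i)))

instance : CompleteSpace (ProjTensor E) :=
  inferInstanceAs (CompleteSpace (UniformSpace.Completion (⨂[ℂ] i, E i)))

/-- The canonical (norm-preserving) map from the algebraic tensor product. -/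
def ProjTensor.of : (⨂[ℂ] i, E i) →ₗᵢ[ℂ] ProjTensor E :=
  UniformSpace.Completion.toComplₗᵢ

/-- The elementary tensor `⊗ᵢ mᵢ`. -/
def elem (m : ∀ i, E i) : ProjTensor E := ProjTensor.of (PiTensorProduct.tprod ℂ m)

theorem ProjTensor.induction_of {p : ProjTensor E → Prop} (x : ProjTensor E)
    (closed : IsClosed {x | p x}) (of : ∀ t, p (ProjTensor.of t)) : p x :=
  UniformSpace.Completion.induction_on x closed of

@[elab_as_elim]
theorem ProjTensor.induction {p : ProjTensor E → Prop} (x : ProjTensor E)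
    (closed : IsClosed {x | p x}) (add : ∀ x y, p x → p y → p (x + y))
    (smul_elem : ∀ (c : ℂ) (m : ∀ i, E i), p (c • elem m)) : p x := by
  refine ProjTensor.induction_of x closed fun t => ?_
  induction t using PiTensorProduct.induction_on with
  | smul_tprod c m => simpa [elem] using smul_elem c m
  | add x y hx hy => simpa using add _ _ hx hy

/-- Extension of a bounded linear map from the algebraic tensor product to its completion. -/
def ProjTensor.extend {F : Type*} [SeminormedAddCommGroup F] [NormedSpace ℂ F]
    [T0Space F] [CompleteSpace F] (f : (⨂[ℂ] i, E i) →L[ℂ] F) : ProjTensor E →L[ℂ] F :=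
  f.fromCompletion

@[simp]
theorem ProjTensor.extend_of {F : Type*} [SeminormedAddCommGroup F] [NormedSpace ℂ F]
    [T0Space F] [CompleteSpace F] (f : (⨂[ℂ] i, E i) →L[ℂ] F) (t : ⨂[ℂ] i, E i) :
    ProjTensor.extend f (ProjTensor.of t) = f t :=
  ContinuousLinearMap.fromCompletion_apply_coe f t

/-- The bounded linear map on the projective tensor product induced by a bounded multilinear
map. -/
def ProjTensor.lift {F : Type*} [NormedAddCommGroup F] [NormedSpace ℂ F]
    [CompleteSpace F] (f : ContinuousMultilinearMap ℂ E F) : ProjTensor E →L[ℂ] F :=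
  ProjTensor.extend (PiTensorProduct.liftIsometry ℂ E F f)

@[simp]
theorem ProjTensor.lift_elem {F : Type*} [NormedAddCommGroup F] [NormedSpace ℂ F]
    [CompleteSpace F] (f : ContinuousMultilinearMap ℂ E F) (m : ∀ i, E i) :
    ProjTensor.lift f (elem m) = f m := by
  simp [ProjTensor.lift, elem]

end

/-- Componentwise action of the algebraic tensor product of the algebras `A i` on the algebraic
tensor product of modules `M i`. -/
def actAlg (A M : ι → Type*) [∀ i, SeminormedCommRing (A i)] [∀ i, NormedAlgebra ℂ (A i)]
    [∀ i, SeminormedAddCommGroup (M i)] [∀ i, NormedSpace ℂ (M i)] [∀ i, Module (A i) (M i)]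
    [∀ i, IsBoundedSMul (A i) (M i)] [∀ i, IsScalarTower ℂ (A i) (M i)] :
    (⨂[ℂ] i, A i) →L[ℂ] (⨂[ℂ] i, M i) →L[ℂ] (⨂[ℂ] i, M i) :=
  PiTensorProduct.liftIsometry ℂ A _
    ((PiTensorProduct.mapLMultilinear ℂ M M).compContinuousLinearMap
      fun i => ContinuousLinearMap.lsmul ℂ (A i))

theorem actAlg_tprod (A M : ι → Type*) [∀ i, SeminormedCommRing (A i)]
    [∀ i, NormedAlgebra ℂ (A i)]
    [∀ i, SeminormedAddCommGroup (M i)] [∀ i, NormedSpace ℂ (M i)] [∀ i, Module (A i) (M i)]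
    [∀ i, IsBoundedSMul (A i) (M i)] [∀ i, IsScalarTower ℂ (A i) (M i)]
    (a : ∀ i, A i) (m : ∀ i, M i) :
    actAlg A M (PiTensorProduct.tprod ℂ a) (PiTensorProduct.tprod ℂ m)
      = PiTensorProduct.tprod ℂ (fun i => a i • m i) := by
  simp only [actAlg, PiTensorProduct.liftIsometry_apply_apply, PiTensorProduct.lift.tprod]
  exact PiTensorProduct.map_tprod _ _

section Algebra

variable (A : ι → Type*) [∀ i, SeminormedCommRing (A i)] [∀ i, NormedAlgebra ℂ (A i)]

theorem actAlg_self (x y : ⨂[ℂ] i, A i) : actAlg A A x y = x * y := by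
  induction x using PiTensorProduct.induction_on with
  | add x x' hx hx' => simp [hx, hx', add_mul]
  | smul_tprod c a =>
    induction y using PiTensorProduct.induction_on with
    | add y y' hy hy' => rw [map_add, hy, hy', mul_add]
    | smul_tprod d b =>
      rw [map_smul, map_smul, smul_apply, actAlg_tprod,
        PiTensorProduct.smul_tprod_mul_smul_tprod, mul_comm, mul_smul]
      rfl

theorem tensor_norm_mul_le (x y : ⨂[ℂ] i, A i) : ‖x * y‖ ≤ ‖x‖ * ‖y‖ := by
  rw [← actAlg_self]
  refine (ContinuousLinearMap.le_opNorm _ _).trans ?_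
  gcongr
  refine (ContinuousLinearMap.le_opNorm _ _).trans ?_
  refine mul_le_of_le_one_left (norm_nonneg _) ?_
  rw [actAlg, LinearIsometryEquiv.norm_map]
  refine (ContinuousMultilinearMap.norm_compContinuousLinearMap_le _ _).trans ?_
  refine mul_le_one₀ PiTensorProduct.opNorm_mapLMultilinear_le
    (Finset.prod_nonneg fun _ _ => norm_nonneg _)
    (Finset.prod_le_one (fun _ _ => norm_nonneg _) fun i _ => ?_)
  exact LinearMap.mkContinuous₂_norm_le _ zero_le_one _

/-- The projective tensor norm is submultiplicative, so the algebraic tensor product of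
commutative normed algebras is a commutative (semi)normed algebra; its completion inherits this
structure. -/
instance tensorSeminormedCommRing : SeminormedCommRing (⨂[ℂ] i, A i) where
  __ := (inferInstance : SeminormedAddCommGroup (⨂[ℂ] i, A i))
  __ := (inferInstance : CommRing (⨂[ℂ] i, A i))
  norm_mul_le := tensor_norm_mul_le A

instance tensorNormedAlgebra : NormedAlgebra ℂ (⨂[ℂ] i, A i) where
  __ := (inferInstance : Algebra ℂ (⨂[ℂ] i, A i))
  norm_smul_le := norm_smul_le

/-- The ring structure of the completed tensor product. -/
abbrev ProjTensor.commRing : CommRing (ProjTensor A) :=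
  inferInstanceAs (CommRing (UniformSpace.Completion (⨂[ℂ] i, A i)))

/-- `⊗̂ᵢ Aᵢ` is a commutative Banach algebra with componentwise multiplication of elementary
tensors. -/
instance : NormedCommRing (ProjTensor A) where
  __ := (inferInstance : NormedAddCommGroup (ProjTensor A))
  __ := ProjTensor.commRing A
  norm_mul_le := norm_mul_le (α := UniformSpace.Completion (⨂[ℂ] i, A i))

/-- The algebra structure of the completed tensor product. -/
abbrev ProjTensor.algebra : Algebra ℂ (ProjTensor A) :=
  inferInstanceAs (Algebra ℂ (UniformSpace.Completion (⨂[ℂ] i, A i)))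

instance : NormedAlgebra ℂ (ProjTensor A) where
  __ := (inferInstance : NormedSpace ℂ (ProjTensor A))
  __ := ProjTensor.algebra A


theorem elem_mul_elem (a b : ∀ i, A i) :
    (elem a : ProjTensor A) * elem b = elem fun i => a i * b i := by
  refine (UniformSpace.Completion.coe_mul (α := ⨂[ℂ] i, A i) _ _).symm.trans ?_
  rw [PiTensorProduct.tprod_mul_tprod]
  rfl

theorem one_eq_elem : (1 : ProjTensor A) = elem fun _ => 1 := rfl

end Algebra

section Action

variable (A M : ι → Type*) [∀ i, SeminormedCommRing (A i)] [∀ i, NormedAlgebra ℂ (A i)]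
  [∀ i, SeminormedAddCommGroup (M i)] [∀ i, NormedSpace ℂ (M i)] [∀ i, Module (A i) (M i)]
  [∀ i, IsBoundedSMul (A i) (M i)] [∀ i, IsScalarTower ℂ (A i) (M i)]

/-- Componentwise action on the completed tensor product, the bounded bilinear map with
`(⊗ aᵢ) · (⊗ mᵢ) = ⊗ (aᵢ · mᵢ)`. -/
def act : ProjTensor A →L[ℂ] ProjTensor M →L[ℂ] ProjTensor M :=
  let f : ProjTensor A →L[ℂ] (⨂[ℂ] i, M i) →L[ℂ] ProjTensor M :=
    ProjTensor.extend (F := (⨂[ℂ] i, M i) →L[ℂ] ProjTensor M)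
      (ContinuousLinearMap.compL ℂ (⨂[ℂ] i, M i) (⨂[ℂ] i, M i) (ProjTensor M)
        ProjTensor.of.toContinuousLinearMap ∘L actAlg A M)
  let g : ProjTensor M →L[ℂ] ProjTensor A →L[ℂ] ProjTensor M := ProjTensor.extend f.flip
  g.flip

@[simp]
theorem act_elem (a : ∀ i, A i) (m : ∀ i, M i) :
    act A M (elem a) (elem m) = elem fun i => a i • m i := by
  simp [act, elem, actAlg_tprod]

/-- The componentwise module structure of `⊗̂ᵢ Mᵢ` over the Banach algebra `⊗̂ᵢ Aᵢ`. -/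
@[reducible]
def actModule : Module (ProjTensor A) (ProjTensor M) where
  smul x z := act A M x z
  one_smul z := by
    change act A M 1 z = z
    induction z using ProjTensor.induction with
    | closed => exact isClosed_eq (by fun_prop) (by fun_prop)
    | add x y hx hy => rw [map_add, hx, hy]
    | smul_elem c m => simp [one_eq_elem]
  mul_smul x y z := by
    change act A M (x * y) z = act A M x (act A M y z)
    induction z using ProjTensor.induction with
    | closed => exact isClosed_eq (by fun_prop) (by fun_prop)
    | add z z' hz hz' => simp only [map_add, hz, hz']
    | smul_elem c m =>
    induction x using ProjTensor.induction with
    | closed => exact isClosed_eq (by fun_prop) (by fun_prop)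
    | add z z' hz hz' => simp only [add_mul, map_add, add_apply, hz, hz']
    | smul_elem d a =>
    induction y using ProjTensor.induction with
    | closed => exact isClosed_eq (by fun_prop) (by fun_prop)
    | add z z' hz hz' => simp only [mul_add, map_add, add_apply, hz, hz']
    | smul_elem e b =>
      rw [smul_mul_assoc, mul_smul_comm, elem_mul_elem]
      simp only [map_smul, smul_apply, act_elem, mul_smul]
      module
  smul_zero x := map_zero (act A M x)
  zero_smul z := by change act A M 0 z = 0; simp
  smul_add x y z := map_add (act A M x) y z
  add_smul x y z := by change act A M (x + y) z = act A M x z + act A M y z; simp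

end Action
end ProjTensor

section Hochschild

variable (B : Type u) [NormedCommRing B] [NormedAlgebra ℂ B]

/-- The `n`-chains `C_n(B, B) = B ⊗̂ B^{⊗̂ n}`, where slot `0` is the coefficient module. -/
def Chain (n : ℕ) : Type u := ProjTensor fun _ : Fin (n + 1) => B

namespace Chain

variable (n : ℕ)

instance : NormedCommRing (Chain B n) :=
  inferInstanceAs (NormedCommRing (ProjTensor fun _ : Fin (n + 1) => B))
instance : NormedAlgebra ℂ (Chain B n) :=
  inferInstanceAs (NormedAlgebra ℂ (ProjTensor fun _ : Fin (n + 1) => B))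
instance : CompleteSpace (Chain B n) :=
  inferInstanceAs (CompleteSpace (ProjTensor fun _ : Fin (n + 1) => B))

/-- The canonical (norm-preserving) map from the algebraic tensor product. -/
def of : (⨂[ℂ] _ : Fin (n + 1), B) →ₗᵢ[ℂ] Chain B n :=
  ProjTensor.of (E := fun _ : Fin (n + 1) => B)

variable {B n} in
/-- The elementary chain `x ⊗ a₁ ⊗ ⋯ ⊗ aₙ`. -/
def tensor (m : Fin (n + 1) → B) : Chain B n := elem m

variable {B n} in
@[elab_as_elim]
theorem induction {p : Chain B n → Prop} (x : Chain B n)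
    (closed : IsClosed {x | p x}) (add : ∀ x y, p x → p y → p (x + y))
    (smul_tensor : ∀ (c : ℂ) (m : Fin (n + 1) → B), p (c • tensor m)) : p x :=
  ProjTensor.induction (E := fun _ : Fin (n + 1) => B) x closed add smul_tensor

theorem tensor_mul (a b : Fin (n + 1) → B) : tensor a * tensor b = tensor (a * b) :=
  elem_mul_elem (fun _ : Fin (n + 1) => B) a b

/-- `b ↦ 1 ⊗ ⋯ ⊗ b ⊗ ⋯ ⊗ 1` with `b` in slot `j`. -/
def slot (j : Fin (n + 1)) : B →L[ℂ] Chain B n :=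
  (of B n).toContinuousLinearMap ∘L
    (PiTensorProduct.tprodL ℂ (E := fun _ : Fin (n + 1) => B)).toContinuousLinearMap (fun _ => 1) j

theorem slot_apply (j : Fin (n + 1)) (b : B) :
    slot B n j b = tensor (Function.update 1 j b) := by
  simp only [slot, tensor, elem]
  rfl

/-- Slot `0` as a ring homomorphism. -/
def slotZero : B →+* Chain B n where
  toFun b := slot B n 0 b
  map_zero' := map_zero _
  map_add' := map_add _
  map_one' := by rw [slot_apply, show (1 : B) = (1 : Fin (n + 1) → B) 0 from rfl,
    Function.update_eq_self]; rfl
  map_mul' a b := by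
    simp only [slot_apply, tensor_mul]
    rw [← Function.update_mul, one_mul]

/-- The left action of `B` on chains through the coefficient slot,
`c · (x ⊗ a₁ ⊗ ⋯ ⊗ aₙ) = c x ⊗ a₁ ⊗ ⋯ ⊗ aₙ`; see `smul_tensor`. -/
instance : Module B (Chain B n) := Module.compHom _ (slotZero B n)

/-- The right action of `B` on chains through the coefficient slot,
`(x ⊗ a₁ ⊗ ⋯ ⊗ aₙ) · c = x c ⊗ a₁ ⊗ ⋯ ⊗ aₙ`; see `op_smul_tensor`. -/
instance : Module Bᵐᵒᵖ (Chain B n) where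
  smul c x := x * slot B n 0 c.unop
  one_smul x := by
    change x * slotZero B n 1 = x
    simp
  mul_smul c d x := by
    change x * slotZero B n (d.unop * c.unop) = x * slotZero B n d.unop * slotZero B n c.unop
    rw [map_mul, mul_assoc]
  smul_zero c := zero_mul _
  smul_add c x y := add_mul _ _ _
  add_smul c d x := by
    change x * slotZero B n (c.unop + d.unop) = _
    rw [map_add, mul_add]; rfl
  zero_smul x := by
    change x * slotZero B n 0 = 0
    simp

theorem smul_def (c : B) (x : Chain B n) : c • x = slot B n 0 c * x := rfl

theorem op_smul_def (c : B) (x : Chain B n) :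
    MulOpposite.op c • x = x * slot B n 0 c := rfl

theorem smul_tensor (c : B) (m : Fin (n + 1) → B) :
    c • tensor m = tensor (Function.update m 0 (c * m 0)) := by
  rw [smul_def, slot_apply, tensor_mul]
  congr 1
  ext j
  by_cases h : j = 0
  · subst h; simp
  · simp [h]

theorem op_smul_tensor (c : B) (m : Fin (n + 1) → B) :
    MulOpposite.op c • tensor m = tensor (Function.update m 0 (m 0 * c)) := by
  rw [op_smul_def, mul_comm, ← smul_def, smul_tensor, mul_comm]

instance : IsScalarTower ℂ B (Chain B n) where
  smul_assoc c b x := by simp [smul_def]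

instance : IsScalarTower Bᵐᵒᵖ B (Chain B n) where
  smul_assoc c b x := by
    change slotZero B n (b * c.unop) * x = (slotZero B n b * x) * slotZero B n c.unop
    rw [map_mul]; ring

instance : IsBoundedSMul B (Chain B n) := by
  refine .of_norm_smul_le fun c x => ?_
  have key : ∀ t : (⨂[ℂ] _ : Fin (n + 1), B),
      c • of B n t = of B n (PiTensorProduct.mapL (Function.update
          (fun _ => ContinuousLinearMap.id ℂ B) 0 (ContinuousLinearMap.mul ℂ B c)) t) := by
    intro t
    induction t using PiTensorProduct.induction_on with
    | add x y hx hy =>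
      rw [map_add, map_add, map_add, ← hx, ← hy]
      exact smul_add (A := Chain B n) c _ _
    | smul_tprod d m =>
      rw [map_smul, map_smul, map_smul]
      refine (smul_comm c d (tensor m)).trans ?_
      refine congrArg (fun z : Chain B n => d • z) ?_
      refine (smul_tensor B n c m).trans ?_
      rw [PiTensorProduct.mapL_apply, PiTensorProduct.map_tprod]
      refine congrArg (fun m' : Fin (n + 1) → B => of B n (PiTensorProduct.tprod ℂ m')) ?_
      ext j
      by_cases h : j = 0
      · subst h; simp
      · simp [h]
  refine ProjTensor.induction_of (E := fun _ : Fin (n + 1) => B)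
    (p := fun x : Chain B n => ‖c • x‖ ≤ ‖c‖ * ‖x‖) x ?_ fun t => ?_
  · exact isClosed_le (f := fun x : Chain B n => ‖c • x‖) (g := fun x : Chain B n => ‖c‖ * ‖x‖)
      (by simp only [smul_def]; fun_prop) (by fun_prop)
  · refine (congrArg norm (key t)).trans_le ?_
    refine ((of B n).norm_map _).trans_le ?_
    refine (ContinuousLinearMap.le_opNorm _ _).trans ?_
    refine mul_le_mul ?_ ((of B n).norm_map t).ge (norm_nonneg _) (norm_nonneg _)
    refine PiTensorProduct.opNorm_mapL _ |>.trans ?_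
    rw [Fin.prod_univ_succ]
    refine (mul_le_of_le_one_right (norm_nonneg _) (Finset.prod_le_one
      (fun _ _ => norm_nonneg _) fun i _ => ?_)).trans ?_
    · simpa using ContinuousLinearMap.norm_id_le
    · simp

variable {B n} in
/-- The bounded linear map on chains induced by a bounded multilinear map. -/
def lift {F : Type*} [NormedAddCommGroup F] [NormedSpace ℂ F] [CompleteSpace F]
    (f : ContinuousMultilinearMap ℂ (fun _ : Fin (n + 1) => B) F) : Chain B n →L[ℂ] F :=
  ProjTensor.lift f

@[simp]
theorem lift_tensor {F : Type*} [NormedAddCommGroup F] [NormedSpace ℂ F] [CompleteSpace F]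
    (f : ContinuousMultilinearMap ℂ (fun _ : Fin (n + 1) => B) F) (m : Fin (n + 1) → B) :
    lift f (tensor m) = f m :=
  ProjTensor.lift_elem f m

end Chain

/-- The boundary map `C_1(B, B) → B`, `x ⊗ a ↦ x a - a x`, as a bounded linear map. -/
def boundary₀L [CompleteSpace B] : Chain B 1 →L[ℂ] B :=
  Chain.lift
    ((ContinuousMultilinearMap.mkPiAlgebraFin ℂ 2 B) -
      (ContinuousMultilinearMap.mkPiAlgebraFin ℂ 2 B).domDomCongr (Equiv.swap 0 1))

theorem boundary₀L_tensor [CompleteSpace B] (x a : B) :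
    boundary₀L B (Chain.tensor ![x, a]) = x * a - a * x := by
  simp [boundary₀L, ContinuousMultilinearMap.mkPiAlgebraFin_apply, List.ofFn_succ]

/-- The boundary map `C_2(B, B) → C_1(B, B)`,
`x ⊗ a ⊗ b ↦ x a ⊗ b - x ⊗ a b + b x ⊗ a`, as a bounded linear map. -/
def boundary₁L : Chain B 2 →L[ℂ] Chain B 1 :=
  Chain.lift
    (((ContinuousMultilinearMap.mkPiAlgebra ℂ (Fin 3) (Chain B 1)).compContinuousLinearMap
        ![Chain.slot B 1 0, Chain.slot B 1 0, Chain.slot B 1 1]) -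
      ((ContinuousMultilinearMap.mkPiAlgebra ℂ (Fin 3) (Chain B 1)).compContinuousLinearMap
        ![Chain.slot B 1 0, Chain.slot B 1 1, Chain.slot B 1 1]) +
      ((ContinuousMultilinearMap.mkPiAlgebra ℂ (Fin 3) (Chain B 1)).compContinuousLinearMap
        ![Chain.slot B 1 0, Chain.slot B 1 1, Chain.slot B 1 0]))

theorem Chain.tensor_two (x a : B) :
    Chain.tensor ![x, a] = Chain.slot B 1 0 x * Chain.slot B 1 1 a := by
  rw [Chain.slot_apply, Chain.slot_apply, Chain.tensor_mul]
  congr 1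
  ext j
  fin_cases j <;> simp

theorem boundary₁L_tensor (x a b : B) :
    boundary₁L B (Chain.tensor ![x, a, b]) =
      Chain.tensor ![x * a, b] - Chain.tensor ![x, a * b] + Chain.tensor ![b * x, a] := by
  have h0 : ∀ u v : B, Chain.slot B 1 0 (u * v) = Chain.slot B 1 0 u * Chain.slot B 1 0 v :=
    map_mul (Chain.slotZero B 1)
  have h1 : ∀ u v : B, Chain.slot B 1 1 (u * v) = Chain.slot B 1 1 u * Chain.slot B 1 1 v := by
    intro u v
    rw [Chain.slot_apply, Chain.slot_apply, Chain.slot_apply, Chain.tensor_mul,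
      ← Function.update_mul, one_mul]
  simp only [boundary₁L, Chain.lift_tensor, Chain.tensor_two, h0, h1]
  simp [Fin.prod_univ_succ]
  ring

/-- The boundary map `C_1(B, B) → C_0(B, B) = B` as a map of `B`-modules. -/
def boundary₀ [CompleteSpace B] : Chain B 1 →ₗ[B] B where
  toFun := boundary₀L B
  map_add' := map_add _
  map_smul' c z := by
    induction z using Chain.induction with
    | closed =>
      exact isClosed_eq ((boundary₀L B).continuous.comp (continuous_const_smul c))
        ((boundary₀L B).continuous.const_smul c)
    | add z z' hz hz' => simp only [smul_add, map_add, hz, hz']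
    | smul_tensor d m =>
      obtain ⟨x, a, rfl⟩ : ∃ x a, m = ![x, a] := ⟨m 0, m 1, by ext j; fin_cases j <;> rfl⟩
      rw [smul_comm, map_smul (boundary₀L B) d, map_smul (boundary₀L B) d, Chain.smul_tensor,
        show Function.update ![x, a] 0 (c * ![x, a] 0) = ![c * x, a] by
          ext j; fin_cases j <;> simp,
        boundary₀L_tensor, boundary₀L_tensor, RingHom.id_apply, smul_comm]
      congr 1
      rw [smul_eq_mul]; ring

/-- The boundary map `C_2(B, B) → C_1(B, B)` as a map of `B`-modules. -/
def boundary₁ : Chain B 2 →ₗ[B] Chain B 1 where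
  toFun := boundary₁L B
  map_add' := map_add _
  map_smul' c z := by
    induction z using Chain.induction with
    | closed =>
      exact isClosed_eq ((boundary₁L B).continuous.comp (continuous_const_smul c))
        ((boundary₁L B).continuous.const_smul c)
    | add z z' hz hz' => simp only [smul_add, map_add, hz, hz']
    | smul_tensor d m =>
      obtain ⟨x, a, b, rfl⟩ : ∃ x a b, m = ![x, a, b] :=
        ⟨m 0, m 1, m 2, by ext j; fin_cases j <;> rfl⟩
      have hu : ∀ u v : B, Function.update ![u, v] 0 (c * ![u, v] 0) = ![c * u, v] := by
        intro u v; ext j; fin_cases j <;> simp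
      rw [smul_comm, map_smul (boundary₁L B) d, map_smul (boundary₁L B) d, Chain.smul_tensor,
        show Function.update ![x, a, b] 0 (c * ![x, a, b] 0) = ![c * x, a, b] by
          ext j; fin_cases j <;> simp,
        boundary₁L_tensor, boundary₁L_tensor, RingHom.id_apply, smul_comm]
      congr 1
      rw [smul_add, smul_sub, Chain.smul_tensor, Chain.smul_tensor, Chain.smul_tensor, hu, hu, hu]
      simp only [mul_assoc, mul_left_comm]

/-- The first Hochschild homology group `H_1(B, B) = ker d₀ / im d₁`. -/
def HH1 [CompleteSpace B] : Type u :=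
  ↥(LinearMap.ker (boundary₀ B)) ⧸
    (LinearMap.range (boundary₁ B)).submoduleOf (LinearMap.ker (boundary₀ B))

namespace HH1

variable [CompleteSpace B]

/-- The quotient seminorm. -/
instance : SeminormedAddCommGroup (HH1 B) :=
  inferInstanceAs (SeminormedAddCommGroup (↥(LinearMap.ker (boundary₀ B)) ⧸
    (LinearMap.range (boundary₁ B)).submoduleOf (LinearMap.ker (boundary₀ B))))

instance : NormedSpace ℂ (HH1 B) :=
  inferInstanceAs (NormedSpace ℂ (↥(LinearMap.ker (boundary₀ B)) ⧸
    (LinearMap.range (boundary₁ B)).submoduleOf (LinearMap.ker (boundary₀ B))))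

/-- The left action of `B`, through the coefficient slot. -/
instance : Module B (HH1 B) :=
  inferInstanceAs (Module B (↥(LinearMap.ker (boundary₀ B)) ⧸
    (LinearMap.range (boundary₁ B)).submoduleOf (LinearMap.ker (boundary₀ B))))

/-- The right action of `B`, through the coefficient slot. -/
instance : Module Bᵐᵒᵖ (HH1 B) :=
  inferInstanceAs (Module Bᵐᵒᵖ (↥(LinearMap.ker (boundary₀ B)) ⧸
    (LinearMap.range (boundary₁ B)).submoduleOf (LinearMap.ker (boundary₀ B))))

instance : IsScalarTower ℂ B (HH1 B) :=
  inferInstanceAs (IsScalarTower ℂ B (↥(LinearMap.ker (boundary₀ B)) ⧸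
    (LinearMap.range (boundary₁ B)).submoduleOf (LinearMap.ker (boundary₀ B))))

instance : IsBoundedSMul B (HH1 B) := by
  have : IsBoundedSMul B (LinearMap.ker (boundary₀ B)) :=
    .of_norm_smul_le fun c x => norm_smul_le c (x : Chain B 1)
  exact inferInstanceAs (IsBoundedSMul B (↥(LinearMap.ker (boundary₀ B)) ⧸
    (LinearMap.range (boundary₁ B)).submoduleOf (LinearMap.ker (boundary₀ B))))

end HH1

/-- A seminormed space is Banach if its seminorm is a norm and it is complete. -/
def IsBanach (E : Type*) [SeminormedAddCommGroup E] : Prop :=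
  (∀ x : E, ‖x‖ = 0 → x = 0) ∧ CompleteSpace E

/-- Either the Banach algebra `B` itself, or (for `true`) the module `H_1(B, B)`. -/
def Factor (B : Type u) [NormedCommRing B] [NormedAlgebra ℂ B] [CompleteSpace B] :
    Bool → Type u
  | true => HH1 B
  | false => B

namespace Factor

variable [CompleteSpace B]

instance : ∀ b, SeminormedAddCommGroup (Factor B b)
  | true => inferInstanceAs (SeminormedAddCommGroup (HH1 B))
  | false => inferInstanceAs (SeminormedAddCommGroup B)

instance : ∀ b, NormedSpace ℂ (Factor B b)
  | true => inferInstanceAs (NormedSpace ℂ (HH1 B))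
  | false => inferInstanceAs (NormedSpace ℂ B)

instance : ∀ b, Module B (Factor B b)
  | true => inferInstanceAs (Module B (HH1 B))
  | false => inferInstanceAs (Module B B)

instance : ∀ b, IsScalarTower ℂ B (Factor B b)
  | true => inferInstanceAs (IsScalarTower ℂ B (HH1 B))
  | false => inferInstanceAs (IsScalarTower ℂ B B)

instance : ∀ b, IsBoundedSMul B (Factor B b)
  | true => inferInstanceAs (IsBoundedSMul B (HH1 B))
  | false => inferInstanceAs (IsBoundedSMul B B)

end Factor

end Hochschild

section Summand

variable {k : ℕ} (A : Fin k → Type u) [∀ i, NormedCommRing (A i)]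
  [∀ i, NormedAlgebra ℂ (A i)] [∀ i, CompleteSpace (A i)]

/-- The summand `A₁ ⊗̂ ⋯ ⊗̂ H_1(Aᵢ, Aᵢ) ⊗̂ ⋯ ⊗̂ Aₖ`, with `H_1(Aᵢ, Aᵢ)` in place `i`. -/
def Summand (i : Fin k) : Type u :=
  ProjTensor fun j => Factor (A j) (decide (j = i))

namespace Summand

variable (i : Fin k)

instance : NormedAddCommGroup (Summand A i) :=
  inferInstanceAs (NormedAddCommGroup (ProjTensor fun j => Factor (A j) (decide (j = i))))

instance : NormedSpace ℂ (Summand A i) :=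
  inferInstanceAs (NormedSpace ℂ (ProjTensor fun j => Factor (A j) (decide (j = i))))

instance : CompleteSpace (Summand A i) :=
  inferInstanceAs (CompleteSpace (ProjTensor fun j => Factor (A j) (decide (j = i))))

/-- The componentwise action `(⊗ aⱼ) · (⊗ mⱼ) = ⊗ (aⱼ · mⱼ)`. -/
instance : Module (ProjTensor A) (Summand A i) :=
  actModule A fun j => Factor (A j) (decide (j = i))

end Summand

end Summand

section EllOne

variable (σ : Type)

theorem ellOne_mul_aux {f g : MvPowerSeries σ ℂ} {a b : (σ →₀ ℕ) → ℝ}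
    (ha : a = fun n => ‖MvPowerSeries.coeff n f‖) (hb : b = fun n => ‖MvPowerSeries.coeff n g‖)
    (hf : Summable a) (hg : Summable b) :
    (Summable fun n => ‖MvPowerSeries.coeff n (f * g)‖) ∧
      ∑' n, ‖MvPowerSeries.coeff n (f * g)‖ ≤ (∑' n, a n) * ∑' n, b n := by
  classical
  have ha0 : 0 ≤ a := fun n => by rw [ha]; exact norm_nonneg _
  have hb0 : 0 ≤ b := fun n => by rw [hb]; exact norm_nonneg _
  have h : Summable fun x : (σ →₀ ℕ) × (σ →₀ ℕ) => a x.1 * b x.2 :=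
    hf.mul_of_nonneg hg ha0 hb0
  have hs := summable_sum_mul_antidiagonal_of_summable_mul h
  have hle : ∀ n, ‖MvPowerSeries.coeff n (f * g)‖ ≤
      ∑ kl ∈ Finset.HasAntidiagonal.antidiagonal n, a kl.1 * b kl.2 := by
    intro n
    rw [MvPowerSeries.coeff_mul, ha, hb]
    exact (norm_sum_le _ _).trans (Finset.sum_le_sum fun _ _ => norm_mul_le _ _)
  have hfg := Summable.of_nonneg_of_le (fun _ => norm_nonneg _) hle hs
  exact ⟨hfg, (hfg.tsum_le_tsum hle hs).trans_eq
    (hf.tsum_mul_tsum_eq_tsum_sum_antidiagonal hg h).symm⟩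

/-- The formal power series in the variables `σ` with absolutely summable coefficients, as a
subalgebra of the algebra of all formal power series (whose product is convolution of the
coefficient families). -/
def ellOneSubalgebra : Subalgebra ℂ (MvPowerSeries σ ℂ) where
  carrier := {f | Summable fun n => ‖MvPowerSeries.coeff n f‖}
  mul_mem' hf hg := (ellOne_mul_aux σ rfl rfl hf hg).1
  add_mem' := by
    intro f g hf hg
    refine Summable.of_nonneg_of_le (fun _ => norm_nonneg _) (fun n => ?_) (hf.add hg)
    simpa using norm_add_le _ _
  algebraMap_mem' c := by
    classical
    refine summable_of_ne_finset_zero (s := {0}) fun n hn => ?_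
    have hn : n ≠ 0 := by simpa using hn
    simp [MvPowerSeries.algebraMap_apply, MvPowerSeries.coeff_C, hn]

/-- The convolution algebra `ℓ¹(ℤ₊^σ)`, where `ℤ₊^σ` is the monoid `σ →₀ ℕ`: absolutely summable
complex families on `σ →₀ ℕ`, multiplied by convolution, with the `ℓ¹` norm. -/
def EllOne : Type := ellOneSubalgebra σ

namespace EllOne

variable {σ}

/-- The value at `n` of an element of `ℓ¹(ℤ₊^σ)`. -/
def coeff (f : EllOne σ) (n : σ →₀ ℕ) : ℂ := MvPowerSeries.coeff n f.1

instance : CommRing (EllOne σ) := inferInstanceAs (CommRing (ellOneSubalgebra σ))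

instance : Algebra ℂ (EllOne σ) := inferInstanceAs (Algebra ℂ (ellOneSubalgebra σ))

variable (σ) in
/-- The underlying space of the convolution algebra is the sequence space `ℓ¹`. -/
def equivLp : EllOne σ ≃ₗ[ℂ] lp (fun _ : σ →₀ ℕ => ℂ) 1 where
  toFun f := ⟨fun n => f.coeff n, memℓp_gen (by simpa using! f.2)⟩
  invFun f := ⟨fun n => f n, by
    simpa using! (lp.memℓp f).summable (by simp)⟩
  map_add' f g := rfl
  map_smul' c f := rfl
  left_inv f := rfl
  right_inv f := rfl

/-- The `ℓ¹` norm, see `norm_eq_tsum`. -/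
instance : NormedAddCommGroup (EllOne σ) :=
  NormedAddCommGroup.induced _ _ (equivLp σ) (equivLp σ).injective

theorem norm_eq_tsum (f : EllOne σ) : ‖f‖ = ∑' n, ‖f.coeff n‖ := by
  change ‖equivLp σ f‖ = _
  rw [lp.norm_eq_tsum_rpow (by simp)]
  simp only [ENNReal.toReal_one, Real.rpow_one, one_div, inv_one]
  rfl

instance : NormedCommRing (EllOne σ) where
  __ := (inferInstance : NormedAddCommGroup (EllOne σ))
  __ := (inferInstance : CommRing (EllOne σ))
  norm_mul_le f g := by
    simp only [norm_eq_tsum]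
    exact (ellOne_mul_aux σ rfl rfl f.2 g.2).2

instance : NormedAlgebra ℂ (EllOne σ) where
  norm_smul_le c f := by
    change ‖equivLp σ (c • f)‖ ≤ ‖c‖ * ‖equivLp σ f‖
    rw [map_smul]
    exact norm_smul_le _ _

instance : CompleteSpace (EllOne σ) :=
  have h : Isometry (equivLp σ) := AddMonoidHomClass.isometry_of_norm (equivLp σ) fun _ => rfl
  (completeSpace_congr (e := (equivLp σ).toEquiv) h.isUniformEmbedding).2 inferInstance

end EllOne

end EllOne

end BanachHH
end

/-! For commutative `B` the map `d₀` vanishes, so `H_1(B, B)` is the cokernel of `d₁`. It is the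
module of differentials of `B`: the class of `x ⊗ a` plays the part of `x da`, and killing `im d₁`
imposes exactly the Leibniz rule. For a product `a = a₁ ⋯ aₖ` of elements of the factors, the
Leibniz rule reads `x da = ∑ᵢ x (∏_{j ≠ i} aⱼ) daᵢ`, and this is the decomposition to be proved.

The `i`-th component (`TensorDecomp.component`) sends `x ⊗ a`, with `x = ⊗ xⱼ` and `a = ⊗ aⱼ`, to
the tensor with entries `xⱼ aⱼ` for `j ≠ i` and the class of `xᵢ ⊗ aᵢ` in place `i`. It kills
boundaries (`component_boundary₁L`). The maps `embed` in the opposite direction satisfy a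
biorthogonality relation with the components (`component_embed_self`, `component_embed_of_ne`),
which gives joint surjectivity.

Injectivity modulo boundaries has two ingredients. The first is algebraic: every 1-chain `z` is
homologous to `∑ᵢ embed i (proj i z)`, by a telescoping form of the Leibniz rule
(`exists_boundary_eq_sub_sum`). The second is analytic: if the `i`-th component of `z` vanishes,
then `embed i (proj i z)` is a boundary (`exists_boundary_eq_embed_proj`). This is exactness of the
projective tensor product with `L¹` spaces. If `H_1(Aᵢ, Aᵢ)` is Banach, then `d₁` has closed range,
and the open mapping theorem lifts boundaries with control of norms. `L¹` spaces have uniformly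
bounded approximations through finite-dimensional `ℓ¹` spaces, and a sum of tensors over an `ℓ¹`
basis is lifted coefficient by coefficient without loss of norm. Successive approximation then
yields an exact lift (`exists_preimage_of_map_eq_zero`).

For `ℓ¹(ℤ₊)` the hypothesis is verified by hand. Formally `tᵐ d(tⁿ) = n / (m + n) • d(tᵐ⁺ⁿ)`, and a
2-chain of norm at most 2 realizes this relation (`boundary₁L_cellHomotopy`), so `H_1` is `ℓ¹` on
the classes of `1 ⊗ tⁿ` with `n ≥ 1`. Since `ℓ¹ ⊗̂ ⋯ ⊗̂ ℓ¹` is `ℓ¹` of the product index set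
(`tensorL1`), the second assertion follows from the same general theorem,
`TensorDecomp.exists_equiv`. -/

noncomputable section
namespace BanachHH

/-! ### Bounded maps on projective tensor products. -/

section Toolkit

variable {ι : Type*} [Fintype ι]
variable {E : ι → Type*} [∀ i, SeminormedAddCommGroup (E i)] [∀ i, NormedSpace ℂ (E i)]
variable {F : ι → Type*} [∀ i, SeminormedAddCommGroup (F i)] [∀ i, NormedSpace ℂ (F i)]
variable {G : Type*} [NormedAddCommGroup G] [NormedSpace ℂ G]

/-- The elementary tensor as a bounded multilinear map. -/
def elemL (E : ι → Type*) [∀ i, SeminormedAddCommGroup (E i)] [∀ i, NormedSpace ℂ (E i)] :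
    ContinuousMultilinearMap ℂ E (ProjTensor E) :=
  (ProjTensor.of (E := E)).toContinuousLinearMap.compContinuousMultilinearMap
    (PiTensorProduct.tprodL ℂ)

@[simp]
theorem elemL_apply (m : ∀ i, E i) : elemL E m = elem m := by
  exact congrArg (fun f : MultilinearMap ℂ E _ => ProjTensor.of (f m))
    (PiTensorProduct.tprodL_coe (𝕜 := ℂ))

theorem norm_elem_le (m : ∀ i, E i) : ‖elem m‖ ≤ ∏ i, ‖m i‖ :=
  (ProjTensor.of.norm_map _).trans_le (PiTensorProduct.projectiveSeminorm_tprod_le m)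

theorem ProjTensor.hom_ext {f g : ProjTensor E →L[ℂ] G}
    (h : ∀ m : ∀ i, E i, f (elem m) = g (elem m)) : f = g := by
  ext x
  induction x using ProjTensor.induction with
  | closed => exact isClosed_eq f.continuous g.continuous
  | add x y hx hy => rw [map_add, map_add, hx, hy]
  | smul_elem c m => rw [map_smul, map_smul, h]

theorem ProjTensor.norm_lift_apply_le [CompleteSpace G] (f : ContinuousMultilinearMap ℂ E G)
    (x : ProjTensor E) : ‖ProjTensor.lift f x‖ ≤ ‖f‖ * ‖x‖ := by
  refine ProjTensor.induction_of (p := fun x => ‖ProjTensor.lift f x‖ ≤ ‖f‖ * ‖x‖) x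
    (isClosed_le (by fun_prop) (by fun_prop)) fun t => ?_
  rw [ProjTensor.lift, ProjTensor.extend_of, ProjTensor.of.norm_map,
    PiTensorProduct.liftIsometry_apply_apply]
  exact PiTensorProduct.norm_eval_le_projectiveSeminorm f t

/-- The bounded linear map of projective tensor products induced by a family of bounded linear
maps. -/
def ProjTensor.map (f : ∀ i, E i →L[ℂ] F i) : ProjTensor E →L[ℂ] ProjTensor F :=
  ProjTensor.lift ((elemL F).compContinuousLinearMap f)

@[simp]
theorem ProjTensor.map_elem (f : ∀ i, E i →L[ℂ] F i) (m : ∀ i, E i) :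
    ProjTensor.map f (elem m) = elem fun i => f i (m i) := by
  simp [ProjTensor.map]

/-- Projective tensor products of isomorphic spaces are isomorphic. -/
def ProjTensor.congr (f : ∀ i, E i ≃L[ℂ] F i) : ProjTensor E ≃L[ℂ] ProjTensor F :=
  ContinuousLinearEquiv.equivOfInverse (ProjTensor.map fun i => (f i : E i →L[ℂ] F i))
    (ProjTensor.map fun i => ((f i).symm : F i →L[ℂ] E i))
    (fun x => DFunLike.congr_fun (f := (ProjTensor.map fun i => ((f i).symm : F i →L[ℂ] E i)) ∘L
        (ProjTensor.map fun i => (f i : E i →L[ℂ] F i))) (g := ContinuousLinearMap.id ℂ _)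
      (ProjTensor.hom_ext fun m => by simp) x)
    (fun x => DFunLike.congr_fun (f := (ProjTensor.map fun i => (f i : E i →L[ℂ] F i)) ∘L
        (ProjTensor.map fun i => ((f i).symm : F i →L[ℂ] E i))) (g := ContinuousLinearMap.id ℂ _)
      (ProjTensor.hom_ext fun m => by simp) x)

/-- The entries may come from spaces that are only seminormed; the completion separates points, so
an entry of seminorm zero is enough. -/
theorem elem_eq_zero {m : ∀ i, E i} (i : ι) (h : ‖m i‖ = 0) : elem m = 0 := by
  refine norm_le_zero_iff.1 ((norm_elem_le m).trans_eq ?_)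
  exact Finset.prod_eq_zero (Finset.mem_univ i) h

end Toolkit

/-- Bounded multilinear maps agree if they agree on tuples from sets that determine bounded linear
maps. -/
theorem continuousMultilinearMap_ext {κ : Type*} [Finite κ] {E : κ → Type*}
    [∀ l, SeminormedAddCommGroup (E l)] [∀ l, NormedSpace ℂ (E l)]
    {G : Type*} [NormedAddCommGroup G] [NormedSpace ℂ G] (S : ∀ l, Set (E l))
    (hS : ∀ l (φ ψ : E l →L[ℂ] G), (∀ x ∈ S l, φ x = ψ x) → φ = ψ)
    {f g : ContinuousMultilinearMap ℂ E G} (h : ∀ m, (∀ l, m l ∈ S l) → f m = g m) : f = g := by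
  classical
  have := Fintype.ofFinite κ
  have key : ∀ (s : Finset κ) (m : ∀ l, E l), (∀ l, l ∉ s → m l ∈ S l) → f m = g m := by
    intro s
    induction s using Finset.induction_on with
    | empty => exact fun m hm => h m fun l => hm l (Finset.notMem_empty l)
    | insert l s hl ih =>
      intro m hm
      have h1 : f.toContinuousLinearMap m l = g.toContinuousLinearMap m l := by
        refine hS l _ _ fun a ha => ih _ fun l' hl' => ?_
        by_cases hll : l' = l
        · subst hll
          rwa [Function.update_self]
        · rw [Function.update_of_ne hll]
          exact hm l' (by simp [hll, hl'])
      have h2 := DFunLike.congr_fun h1 (m l)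
      change f (Function.update m l (m l)) = g (Function.update m l (m l)) at h2
      rwa [Function.update_eq_self] at h2
  ext m
  exact key Finset.univ m fun l hl => absurd (Finset.mem_univ l) hl

/-! ### Successive approximation and lifting of elementary tensors. -/

section Iteration

variable {W Y Z : Type*} [NormedAddCommGroup W] [NormedSpace ℂ W] [CompleteSpace W]
  [NormedAddCommGroup Y] [NormedSpace ℂ Y] [NormedAddCommGroup Z] [NormedSpace ℂ Z]

/-- Successive approximation: if every element `K z` with `p z` is, up to `K z'` with `p z'` and
`‖z'‖ ≤ ‖z‖ / 2`, the image of an element of norm at most `C * ‖z‖`, then it is an image. -/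
theorem exists_preimage_of_approx (d : W →L[ℂ] Y) (K : Z →L[ℂ] Y) (p : Z → Prop) (C : ℝ)
    (h : ∀ z, p z → ∃ w z', p z' ∧ ‖w‖ ≤ C * ‖z‖ ∧ ‖z'‖ ≤ ‖z‖ / 2 ∧ d w = K z - K z')
    (z : Z) (hz : p z) : ∃ w, d w = K z := by
  classical
  choose! w s hp hw hs hd using h
  have hiter : ∀ n, p (s^[n] z) ∧ ‖s^[n] z‖ ≤ (1 / 2) ^ n * ‖z‖ := by
    intro n
    induction n with
    | zero => simpa using hz
    | succ n ih =>
      rw [Function.iterate_succ_apply']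
      refine ⟨hp _ ih.1, (hs _ ih.1).trans ?_⟩
      rw [pow_succ]
      linarith [ih.2]
  have hsum : Summable fun n => w (s^[n] z) := by
    refine Summable.of_norm_bounded (g := fun n => |C| * ‖z‖ * (1 / 2 : ℝ) ^ n)
      (summable_geometric_two.mul_left _) fun n => ?_
    refine (hw _ (hiter n).1).trans ?_
    calc C * ‖s^[n] z‖ ≤ |C| * ((1 / 2) ^ n * ‖z‖) :=
          mul_le_mul (le_abs_self C) (hiter n).2 (norm_nonneg _) (abs_nonneg _)
      _ = |C| * ‖z‖ * (1 / 2 : ℝ) ^ n := by ring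
  have hlim : Filter.Tendsto (fun n => s^[n] z) Filter.atTop (nhds 0) := by
    refine squeeze_zero_norm (fun n => (hiter n).2) ?_
    simpa using (tendsto_pow_atTop_nhds_zero_of_lt_one (r := (1 / 2 : ℝ)) (by norm_num)
      (by norm_num)).mul_const ‖z‖
  refine ⟨∑' n, w (s^[n] z), ?_⟩
  have h1 := (hsum.hasSum.mapL d).tendsto_sum_nat
  have h2 : ∀ n, ∑ i ∈ Finset.range n, d (w (s^[i] z)) = K z - K (s^[n] z) := by
    intro n
    induction n with
    | zero => simp
    | succ n ih =>
      rw [Finset.sum_range_succ, ih, hd _ (hiter n).1, Function.iterate_succ_apply']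
      abel
  simp only [h2] at h1
  refine tendsto_nhds_unique h1 ?_
  simpa using (tendsto_const_nhds (x := K z)).sub ((K.continuous.tendsto 0).comp hlim)

end Iteration

section Surjectivity

variable {ι : Type*} [Fintype ι]
variable {E : ι → Type*} [∀ i, SeminormedAddCommGroup (E i)] [∀ i, NormedSpace ℂ (E i)]
variable {W : Type*} [NormedAddCommGroup W] [NormedSpace ℂ W] [CompleteSpace W]

/-- The projective norm is an infimum of sums `∑ ‖c‖ ∏ ‖mᵢ‖` over finite representations, so lifts
of elementary tensors add up to lifts of algebraic tensors with nearly the same constant. Density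
and successive approximation pass to the completion. -/
theorem ProjTensor.surjective_of_elem (T : W →L[ℂ] ProjTensor E) (C : ℝ) (hC : 0 ≤ C)
    (h : ∀ m : ∀ i, E i, ∃ w, T w = elem m ∧ ‖w‖ ≤ C * ∏ i, ‖m i‖) :
    Function.Surjective T := by
  have key : ∀ p : List (ℂ × ∀ i, E i), ∃ w,
      T w = ProjTensor.of ((p.map fun x => x.1 • ⨂ₜ[ℂ] i, x.2 i).sum) ∧
      ‖w‖ ≤ C * (p.map fun x => ‖x.1‖ * ∏ i, ‖x.2 i‖).sum := by
    intro p
    induction p with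
    | nil => exact ⟨0, by simp, by simp⟩
    | cons x p ih =>
      obtain ⟨w, hw, hwn⟩ := ih
      obtain ⟨w', hw', hwn'⟩ := h x.2
      refine ⟨x.1 • w' + w, ?_, ?_⟩
      · rw [map_add, map_smul, hw, hw', List.map_cons, List.sum_cons, map_add, map_smul]
        rfl
      · rw [List.map_cons, List.sum_cons]
        refine (norm_add_le _ _).trans ?_
        rw [norm_smul]
        nlinarith [mul_le_mul_of_nonneg_left hwn' (norm_nonneg x.1)]
  intro z
  refine exists_preimage_of_approx T (ContinuousLinearMap.id ℂ (ProjTensor E))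
    (fun _ => True) (2 * C) (fun z _ => ?_) z trivial
  rcases eq_or_ne z 0 with rfl | hz
  · exact ⟨0, 0, trivial, by simp, by simp, by simp⟩
  have hz' : 0 < ‖z‖ := norm_pos_iff.2 hz
  obtain ⟨t, ht⟩ : ∃ t, dist z (ProjTensor.of (E := E) t) < ‖z‖ / 2 :=
    -- An algebraic tensor `t` within `‖z‖ / 2` of `z` has norm below `2 * ‖z‖`; this is the source
    -- of the constant `2 * C`.
    (UniformSpace.Completion.denseRange_coe (α := ⨂[ℂ] i, E i)).exists_dist_lt z (half_pos hz')
  rw [dist_eq_norm] at ht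
  have htn : ‖t‖ < 2 * ‖z‖ := by
    have := norm_sub_norm_le (ProjTensor.of (E := E) t) z
    rw [ProjTensor.of.norm_map, norm_sub_rev] at this
    linarith
  rw [PiTensorProduct.norm_def] at htn
  obtain ⟨⟨p, hp⟩, hpn⟩ := exists_lt_of_ciInf_lt htn
  obtain ⟨w, hw, hwn⟩ := key p.toList
  rw [(PiTensorProduct.mem_lifts_iff t p).1 hp] at hw
  refine ⟨w, z - ProjTensor.of t, trivial, hwn.trans ?_, ht.le, ?_⟩
  · rw [mul_comm 2, mul_assoc]
    exact mul_le_mul_of_nonneg_left hpn.le hC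
  · simp [hw]

end Surjectivity

/-! ### Uniform approximation through finite-dimensional `ℓ¹` spaces. -/

section Approximation

/-- Bounded approximation of the identity on finite sets by finite rank operators that factor
through a finite-dimensional `ℓ¹` space, with a uniform bound on the factorization. -/
def HasL1Approx (W : Type*) [SeminormedAddCommGroup W] [NormedSpace ℂ W] : Prop :=
  ∃ C : ℝ, ∀ (S : Finset W) (ε : ℝ), 0 < ε →
    ∃ (N : ℕ) (l : Fin N → W →L[ℂ] ℂ) (s : Fin N → W),
      (∀ n, ‖s n‖ ≤ 1) ∧ (∀ w, ∑ n, ‖l n w‖ ≤ C * ‖w‖) ∧ ∀ w ∈ S, ‖w - ∑ n, l n w • s n‖ ≤ ε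

theorem HasL1Approx.of_equiv {W W' : Type*} [SeminormedAddCommGroup W] [NormedSpace ℂ W]
    [SeminormedAddCommGroup W'] [NormedSpace ℂ W'] (h : HasL1Approx W) (e : W ≃L[ℂ] W') :
    HasL1Approx W' := by
  classical
  obtain ⟨C, h⟩ := h
  set M : ℝ := ‖(e : W →L[ℂ] W')‖ + 1 with hM
  have hM0 : 0 < M := by positivity
  have hMe : ∀ w, ‖e w‖ ≤ M * ‖w‖ := fun w =>
    ((e : W →L[ℂ] W').le_opNorm w).trans
      (mul_le_mul_of_nonneg_right (by rw [hM]; linarith) (norm_nonneg _))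
  refine ⟨M * (|C| * ‖(e.symm : W' →L[ℂ] W)‖), fun S ε hε => ?_⟩
  obtain ⟨N, l, s, hs, hl, happ⟩ := h (S.image e.symm) (ε / M) (by positivity)
  -- The factor `M` is moved from the vectors to the functionals, so that the vectors stay in the
  -- unit ball while the finite-rank operator is just the conjugate by `e`. The `+ 1` in `M` keeps
  -- it nonzero.
  refine ⟨N, fun n => (M : ℂ) • (l n ∘L (e.symm : W' →L[ℂ] W)), fun n => (M : ℂ)⁻¹ • e (s n),
    fun n => ?_, fun w => ?_, fun w hw => ?_⟩
  · rw [norm_smul, norm_inv, Complex.norm_of_nonneg hM0.le, inv_mul_le_iff₀ hM0, mul_one]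
    exact (hMe _).trans (mul_le_of_le_one_right hM0.le (hs n))
  · have : ∀ n, ‖((M : ℂ) • (l n ∘L (e.symm : W' →L[ℂ] W))) w‖ = M * ‖l n (e.symm w)‖ := by
      intro n
      simp [abs_of_pos hM0]
    simp only [this]
    rw [← Finset.mul_sum, mul_assoc]
    refine mul_le_mul_of_nonneg_left ((hl _).trans ?_) hM0.le
    rw [mul_assoc]
    exact mul_le_mul (le_abs_self C) ((e.symm : W' →L[ℂ] W).le_opNorm w) (norm_nonneg _)
      (abs_nonneg _)
  · have h1 := happ (e.symm w) (Finset.mem_image_of_mem _ hw)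
    have hMc : (M : ℂ) ≠ 0 := by exact_mod_cast hM0.ne'
    have h2 : w - ∑ n, ((M : ℂ) • (l n ∘L (e.symm : W' →L[ℂ] W))) w • ((M : ℂ)⁻¹ • e (s n))
        = e (e.symm w - ∑ n, l n (e.symm w) • s n) := by
      rw [map_sub, map_sum, e.apply_symm_apply]
      congr 1
      refine Finset.sum_congr rfl fun n _ => ?_
      rw [map_smul, smul_smul, smul_apply, ContinuousLinearMap.comp_apply, smul_eq_mul,
        mul_right_comm, mul_inv_cancel₀ hMc, one_mul]
      rfl
    rw [h2]
    refine (hMe _).trans ((mul_le_mul_of_nonneg_left h1 hM0.le).trans_eq ?_)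
    field_simp

end Approximation

/-! ### Slices of a tensor in all places but one. -/

section Contraction

variable {ι : Type*} [Fintype ι] [dec : DecidableEq ι]
variable {E : ι → Type*} [∀ i, SeminormedAddCommGroup (E i)] [∀ i, NormedSpace ℂ (E i)]
variable {F : ι → Type*} [∀ i, SeminormedAddCommGroup (F i)] [∀ i, NormedSpace ℂ (F i)]
variable {G : Type*} [NormedAddCommGroup G] [NormedSpace ℂ G]

/-- The bounded multilinear map `m ↦ (∏_{j ≠ i} l j (m j)) • T (m i)`. -/
def contract (i : ι) (l : ∀ j, E j →L[ℂ] ℂ) (T : E i →L[ℂ] G) :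
    ContinuousMultilinearMap ℂ E G where
  toFun m := (∏ j ∈ Finset.univ.erase i, l j (m j)) • T (m i)
  map_update_add' := by
    intro hdec m j x y
    obtain rfl : hdec = dec := Subsingleton.elim _ _
    have hu : ∀ z, (fun a => l a (Function.update m j z a)) =
        Function.update (fun a => l a (m a)) j (l j z) := fun z => by
      ext a; exact Function.apply_update (fun a => l a) m j z a
    by_cases h : j = i
    · subst h
      have hp : ∀ z, ∏ a ∈ Finset.univ.erase j, l a (Function.update m j z a) =
          ∏ a ∈ Finset.univ.erase j, l a (m a) := fun z =>
        Finset.prod_congr rfl fun a ha => by rw [Function.update_of_ne (Finset.ne_of_mem_erase ha)]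
      simp only [hp, Function.update_self, map_add, smul_add]
    · have hp : ∀ z, ∏ a ∈ Finset.univ.erase i, l a (Function.update m j z a) =
          l j z * ∏ a ∈ (Finset.univ.erase i) \ {j}, l a (m a) := fun z => by
        rw [← Finset.prod_update_of_mem (Finset.mem_erase.2 ⟨h, Finset.mem_univ _⟩)]
        exact Finset.prod_congr rfl fun a _ => congrFun (hu z) a
      simp only [hp, Function.update_of_ne (Ne.symm h), map_add, add_mul, add_smul]
  map_update_smul' := by
    intro hdec m j c x
    obtain rfl : hdec = dec := Subsingleton.elim _ _
    have hu : ∀ z, (fun a => l a (Function.update m j z a)) =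
        Function.update (fun a => l a (m a)) j (l j z) := fun z => by
      ext a; exact Function.apply_update (fun a => l a) m j z a
    by_cases h : j = i
    · subst h
      have hp : ∀ z, ∏ a ∈ Finset.univ.erase j, l a (Function.update m j z a) =
          ∏ a ∈ Finset.univ.erase j, l a (m a) := fun z =>
        Finset.prod_congr rfl fun a ha => by rw [Function.update_of_ne (Finset.ne_of_mem_erase ha)]
      simp only [hp, Function.update_self, map_smul]
      rw [smul_comm]
    · have hp : ∀ z, ∏ a ∈ Finset.univ.erase i, l a (Function.update m j z a) =
          l j z * ∏ a ∈ (Finset.univ.erase i) \ {j}, l a (m a) := fun z => by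
        rw [← Finset.prod_update_of_mem (Finset.mem_erase.2 ⟨h, Finset.mem_univ _⟩)]
        exact Finset.prod_congr rfl fun a _ => congrFun (hu z) a
      simp only [hp, Function.update_of_ne (Ne.symm h), map_smul, smul_eq_mul, mul_assoc, mul_smul]
  cont := by fun_prop

theorem contract_apply (i : ι) (l : ∀ j, E j →L[ℂ] ℂ) (T : E i →L[ℂ] G) (m : ∀ j, E j) :
    contract i l T m = (∏ j ∈ Finset.univ.erase i, l j (m j)) • T (m i) := rfl

variable (i : ι)

section System

variable {V : ι → Type*} [∀ i, NormedAddCommGroup (V i)] [∀ i, NormedSpace ℂ (V i)]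
variable {N : ι → ℕ} (l : ∀ j, Fin (N j) → V j →L[ℂ] ℂ) (s : ∀ j, Fin (N j) → V j)

/-- Coefficients in `V i` of a tensor, for functionals in the places other than `i`. -/
def coeffAt [CompleteSpace (V i)] (n : ∀ j, Fin (N j)) : ProjTensor V →L[ℂ] V i :=
  ProjTensor.lift (contract i (fun j => l j (n j)) (ContinuousLinearMap.id ℂ (V i)))

/-- Tensor with the fixed vectors `s j (n j)` in the places other than `i`. -/
def insertAt (n : ∀ j, Fin (N j)) : V i →L[ℂ] ProjTensor V :=
  (elemL V).toContinuousLinearMap (fun j => s j (n j)) i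

theorem insertAt_apply (n : ∀ j, Fin (N j)) (x : V i) :
    insertAt i s n x = elem (Function.update (fun j => s j (n j)) i x) :=
  elemL_apply _

/-- Multilinearity: expanding the finite-rank approximations in every place `j ≠ i` gives a sum over
multi-indices, whose scalar factors are collected in place `i`. The index `n i` only labels copies
of the entry in place `i`. -/
theorem insertAt_coeffAt_elem [CompleteSpace (V i)] (m : ∀ j, V j) :
    ∑ n, insertAt i s n (coeffAt i l n (elem m)) =
      elem fun j => ∑ n, if j = i then m j else l j n (m j) • s j n := by
  conv_rhs => rw [← elemL_apply, ContinuousMultilinearMap.map_sum]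
  refine Finset.sum_congr rfl fun n _ => ?_
  rw [insertAt_apply, coeffAt, ProjTensor.lift_elem, contract_apply, ← elemL_apply,
    ContinuousMultilinearMap.map_update_smul]
  have : (fun j => if j = i then m j else l j (n j) (m j) • s j (n j)) =
      fun j => (if j = i then (1 : ℂ) else l j (n j) (m j)) •
        Function.update (fun j => s j (n j)) i (m i) j := by
    ext j
    by_cases h : j = i
    · subst h; simp
    · simp [h]
  rw [this, ContinuousMultilinearMap.map_smul_univ]
  congr 1
  rw [← Finset.mul_prod_erase _ _ (Finset.mem_univ i), if_pos rfl, one_mul]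
  exact Finset.prod_congr rfl fun j hj => by rw [if_neg (Finset.ne_of_mem_erase hj)]

omit [∀ i, NormedSpace ℂ (V i)] in
theorem norm_insertAt_tuple_le (hs : ∀ j n, ‖s j n‖ ≤ 1) (n : ∀ j, Fin (N j)) (x : V i) :
    ∏ j, ‖Function.update (fun j => s j (n j)) i x j‖ ≤ ‖x‖ := by
  rw [← Finset.mul_prod_erase _ _ (Finset.mem_univ i), Function.update_self]
  refine mul_le_of_le_one_right (norm_nonneg _) (Finset.prod_le_one (fun _ _ => norm_nonneg _)
    fun j hj => ?_)
  rw [Function.update_of_ne (Finset.ne_of_mem_erase hj)]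
  exact hs _ _

/-- All coefficients are bundled into one multilinear map with values in an `ℓ¹` sum. On tuples its
norm is a product of sums, bounded factor by factor, and the projective norm transfers the bound to
all tensors. Bounding the coefficients one by one would cost a factor that grows with the number of
indices. -/
theorem sum_norm_coeffAt_le [CompleteSpace (V i)] {C : ι → ℝ} (hC : ∀ j, 0 ≤ C j)
    (hl : ∀ j (x : V j), ∑ n, (if j = i then ‖x‖ else ‖l j n x‖) ≤ C j * ‖x‖)
    (v : ProjTensor V) : ∑ n, ‖coeffAt i l n v‖ ≤ (∏ j, C j) * ‖v‖ := by
  let f : MultilinearMap ℂ V (PiLp 1 fun _ : ∀ j, Fin (N j) => V i) :=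
    (WithLp.linearEquiv 1 ℂ ((∀ j, Fin (N j)) → V i)).symm.toLinearMap.compMultilinearMap
      (MultilinearMap.pi fun n =>
        (contract i (fun j => l j (n j)) (ContinuousLinearMap.id ℂ (V i))).toMultilinearMap)
  have hf : ∀ m, ‖f m‖ ≤ (∏ j, C j) * ∏ j, ‖m j‖ := by
    intro m
    have h1 : ‖f m‖ = ∑ n : ∀ j, Fin (N j),
        ‖contract i (fun j => l j (n j)) (ContinuousLinearMap.id ℂ (V i)) m‖ :=
      PiLp.norm_eq_of_L1 _
    have h2 : ∀ n : ∀ j, Fin (N j),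
        ‖contract i (fun j => l j (n j)) (ContinuousLinearMap.id ℂ (V i)) m‖ =
          ∏ j, if j = i then ‖m j‖ else ‖l j (n j) (m j)‖ := by
      intro n
      rw [contract_apply, norm_smul, norm_prod, ← Finset.mul_prod_erase _ _ (Finset.mem_univ i),
        if_pos rfl, mul_comm]
      congr 1
      exact Finset.prod_congr rfl fun j hj => by rw [if_neg (Finset.ne_of_mem_erase hj)]
    rw [h1]
    simp only [h2]
    rw [← Fintype.piFinset_univ,
      ← Finset.prod_univ_sum (fun j => (Finset.univ : Finset (Fin (N j))))
        (fun j n => if j = i then ‖m j‖ else ‖l j n (m j)‖), ← Finset.prod_mul_distrib]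
    refine Finset.prod_le_prod (fun j _ => Finset.sum_nonneg fun n _ => ?_) fun j _ => hl j (m j)
    split_ifs <;> exact norm_nonneg _
  let g : ContinuousMultilinearMap ℂ V (PiLp 1 fun _ : ∀ j, Fin (N j) => V i) :=
    f.mkContinuous _ hf
  have hg : ∀ n, (PiLp.proj 1 (fun _ : ∀ j, Fin (N j) => V i) n : _ →L[ℂ] V i) ∘L
      ProjTensor.lift g = coeffAt i l n := by
    intro n
    refine ProjTensor.hom_ext fun m => ?_
    rw [ContinuousLinearMap.comp_apply, ProjTensor.lift_elem, coeffAt, ProjTensor.lift_elem]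
    rfl
  have h1 : ∑ n, ‖coeffAt i l n v‖ = ‖ProjTensor.lift g v‖ := by
    rw [PiLp.norm_eq_of_L1]
    refine Finset.sum_congr rfl fun n _ => ?_
    rw [← hg n]
    rfl
  rw [h1]
  refine (ProjTensor.norm_lift_apply_le g v).trans ?_
  gcongr
  exact MultilinearMap.mkContinuous_norm_le _ (Finset.prod_nonneg fun j _ => hC j) _

end System
end Contraction

/-! ### Exactness of tensoring with `L¹`-like spaces. -/

section Exactness

variable {ι : Type*} [Fintype ι] [DecidableEq ι]
variable {V : ι → Type*} [∀ i, NormedAddCommGroup (V i)] [∀ i, NormedSpace ℂ (V i)]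
variable {Q : ι → Type*} [∀ i, SeminormedAddCommGroup (Q i)] [∀ i, NormedSpace ℂ (Q i)]

omit [Fintype ι] in
-- The exceptional place `i` gets a dummy index set with one element, so that all places can be
-- indexed uniformly; no approximation property is needed there.
theorem exists_approx_system (i : ι) (hV : ∀ j, j ≠ i → HasL1Approx (V j)) (j : ι) :
    ∃ C : ℝ, 0 ≤ C ∧ ∀ (S : Finset (V j)) (ε : ℝ), 0 < ε →
      ∃ (N : ℕ) (l : Fin N → V j →L[ℂ] ℂ) (s : Fin N → V j),
        (∀ n, ‖s n‖ ≤ 1) ∧ (∀ x : V j, ∑ n, (if j = i then ‖x‖ else ‖l n x‖) ≤ C * ‖x‖) ∧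
        ∀ x ∈ S, ‖x - ∑ n, (if j = i then x else l n x • s n)‖ ≤ ε := by
  by_cases h : j = i
  · refine ⟨1, zero_le_one, fun S ε hε => ⟨1, 0, 0, by simp, by simp [h], ?_⟩⟩
    intro x _
    simpa [h] using hε.le
  · obtain ⟨C, hC⟩ := hV j h
    refine ⟨|C|, abs_nonneg C, fun S ε hε => ?_⟩
    obtain ⟨N, l, s, hs, hl, happ⟩ := hC S ε hε
    refine ⟨N, l, s, hs, fun x => ?_, fun x hx => ?_⟩
    · simp only [if_neg h]
      exact (hl x).trans (mul_le_mul_of_nonneg_right (le_abs_self C) (norm_nonneg _))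
    · simp only [if_neg h]
      exact happ x hx

/-- Approximation of a tensor by finite sums of tensors with prescribed entries in the places
other than `i`. -/
theorem exists_insertAt_approx (i : ι) [CompleteSpace (V i)]
    (hV : ∀ j, j ≠ i → HasL1Approx (V j)) :
    ∃ C : ℝ, ∀ (v : ProjTensor V) (ε : ℝ), 0 < ε →
      ∃ (N : ι → ℕ) (l : ∀ j, Fin (N j) → V j →L[ℂ] ℂ) (s : ∀ j, Fin (N j) → V j),
        (∀ j n, ‖s j n‖ ≤ 1) ∧ ∑ n, ‖coeffAt i l n v‖ ≤ C * ‖v‖ ∧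
        ‖v - ∑ n, insertAt i s n (coeffAt i l n v)‖ ≤ ε := by
  classical
  choose C hC0 h using exists_approx_system i hV
  choose! N l s hs hl happ using h
  -- The approximations form a net indexed by the finite sets on which they are accurate and by the
  -- precision `1 / (n + 1)`.
  let I := (∀ j, Finset (V j)) × ℕ
  have hpos : ∀ n : ℕ, (0 : ℝ) < 1 / (n + 1) := fun n => Nat.one_div_pos_of_nat
  let N' : I → ι → ℕ := fun α j => N j (α.1 j) (1 / (α.2 + 1))
  let l' : ∀ α : I, ∀ j, Fin (N' α j) → V j →L[ℂ] ℂ := fun α j => l j (α.1 j) (1 / (α.2 + 1))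
  let s' : ∀ α : I, ∀ j, Fin (N' α j) → V j := fun α j => s j (α.1 j) (1 / (α.2 + 1))
  have hs' : ∀ α j n, ‖s' α j n‖ ≤ 1 := fun α j => hs j _ _ (hpos _)
  have hl' : ∀ α j (x : V j), ∑ n, (if j = i then ‖x‖ else ‖l' α j n x‖) ≤ C j * ‖x‖ :=
    fun α j => hl j _ _ (hpos _)
  set c : ℝ := ∏ j, C j with hc
  have hc0 : 0 ≤ c := Finset.prod_nonneg fun j _ => hC0 j
  have hsum : ∀ α v, ∑ n, ‖coeffAt i (l' α) n v‖ ≤ c * ‖v‖ := fun α v =>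
    sum_norm_coeffAt_le i (l' α) hC0 (hl' α) v
  let R : I → ProjTensor V →L[ℂ] ProjTensor V := fun α =>
    ∑ n, insertAt i (s' α) n ∘L coeffAt i (l' α) n
  have hR : ∀ α v, R α v = ∑ n, insertAt i (s' α) n (coeffAt i (l' α) n v) := fun α v => by
    simp [R]
  have hRn : ∀ α v, ‖R α v‖ ≤ c * ‖v‖ := by
    intro α v
    rw [hR]
    refine (norm_sum_le _ _).trans (le_trans (Finset.sum_le_sum fun n _ => ?_) (hsum α v))
    rw [insertAt_apply]
    exact (norm_elem_le _).trans (norm_insertAt_tuple_le i (s' α) (hs' α) n _)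
  -- Strong convergence to the identity on algebraic tensors follows from convergence in each entry
  -- and continuity of the elementary tensor map; the uniform bound `c` extends it to the
  -- completion.
  have hlim : ∀ t : ⨂[ℂ] j, V j,
      Filter.Tendsto (fun α => R α (ProjTensor.of t)) Filter.atTop (nhds (ProjTensor.of t)) := by
    intro t
    induction t using PiTensorProduct.induction_on with
    | add x y hx hy => simpa only [map_add] using hx.add hy
    | smul_tprod r m =>
      simp only [map_smul]
      refine Filter.Tendsto.const_smul ?_ r
      change Filter.Tendsto (fun α => R α (elem m)) Filter.atTop (nhds (elem m))
      simp only [hR, insertAt_coeffAt_elem]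
      simp only [← elemL_apply]
      refine ((elemL V).cont.tendsto m).comp (tendsto_pi_nhds.2 fun j => ?_)
      rw [Metric.tendsto_atTop]
      intro ε hε
      obtain ⟨n, hn⟩ := exists_nat_one_div_lt hε
      refine ⟨(fun j => {m j}, n), fun α hα => ?_⟩
      rw [dist_eq_norm, norm_sub_rev]
      refine ((happ j (α.1 j) _ (hpos α.2) (m j) (hα.1 j (Finset.mem_singleton_self _))).trans
        ?_).trans_lt hn
      exact one_div_le_one_div_of_le (by positivity) (by exact_mod_cast Nat.succ_le_succ hα.2)
  refine ⟨c, fun v ε hε => ?_⟩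
  obtain ⟨t, ht⟩ : ∃ t, dist v (ProjTensor.of (E := V) t) < ε / (2 * (1 + c)) :=
    (UniformSpace.Completion.denseRange_coe (α := ⨂[ℂ] i, V i)).exists_dist_lt v (by positivity)
  obtain ⟨α, hα⟩ := (Metric.tendsto_atTop.1 (hlim t) (ε / 2) (half_pos hε))
  have hα := hα α le_rfl
  rw [dist_eq_norm] at ht hα
  refine ⟨N' α, l' α, s' α, hs' α, hsum α v, ?_⟩
  rw [← hR]
  have h1 : v - R α v = (v - ProjTensor.of t) - R α (v - ProjTensor.of t)
      - (R α (ProjTensor.of t) - ProjTensor.of t) := by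
    rw [map_sub]; abel
  rw [h1]
  have h2 := hRn α (v - ProjTensor.of t)
  have h3 : (1 + c) * ‖v - ProjTensor.of t‖ ≤ ε / 2 := by
    refine (mul_le_mul_of_nonneg_left ht.le (by positivity)).trans_eq ?_
    field_simp
  have h4 := norm_sub_le ((v - ProjTensor.of t) - R α (v - ProjTensor.of t))
    (R α (ProjTensor.of t) - ProjTensor.of t)
  have h5 := norm_sub_le (v - ProjTensor.of t) (R α (v - ProjTensor.of t))
  linarith

variable {W Y : Type*} [NormedAddCommGroup W] [NormedSpace ℂ W] [CompleteSpace W]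
  [NormedAddCommGroup Y] [NormedSpace ℂ Y]

/-- Exactness of the tensor product with `L¹`-like spaces: if `K` sends the elementary tensors
whose `i`-th entry is killed by `q i` to images under `d`, with control of norms, then it does so
for all tensors that are killed by `⨂ q j`. -/
theorem exists_preimage_of_map_eq_zero (i : ι) [CompleteSpace (V i)]
    (hV : ∀ j, j ≠ i → HasL1Approx (V j)) (q : ∀ j, V j →L[ℂ] Q j)
    (hq : ∀ j, j ≠ i → ∃ r : Q j →L[ℂ] V j, ∀ x, r (q j x) = x)
    (d : W →L[ℂ] Y) (K : ProjTensor V →L[ℂ] Y) (C : ℝ) (hC : 0 ≤ C)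
    (hK : ∀ m : ∀ j, V j, ‖q i (m i)‖ = 0 → ∃ w, d w = K (elem m) ∧ ‖w‖ ≤ C * ∏ j, ‖m j‖)
    (v : ProjTensor V) (hv : ProjTensor.map q v = 0) : ∃ w, d w = K v := by
  obtain ⟨c, hc⟩ := exists_insertAt_approx i hV
  have hr : ∀ j, ∃ r : Q j →L[ℂ] V j, j ≠ i → ∀ x, r (q j x) = x := fun j => by
    by_cases h : j = i
    · exact ⟨0, fun h' => absurd h h'⟩
    · obtain ⟨r, hr⟩ := hq j h
      exact ⟨r, fun _ => hr⟩
  choose r hr using hr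
  refine exists_preimage_of_approx d K (fun v => ProjTensor.map q v = 0) (C * c)
    (fun v hv => ?_) v hv
  rcases eq_or_ne v 0 with rfl | hv0
  · exact ⟨0, 0, map_zero _, by simp, by simp, by simp⟩
  obtain ⟨N, l, s, hs, hsum, happ⟩ := hc v (‖v‖ / 2) (half_pos (norm_pos_iff.2 hv0))
  -- The left inverses `r j` let the coefficient functionals factor through `⨂ q j`, so `q i` of a
  -- coefficient of `v` depends only on the image of `v`, which is zero. The completion is the
  -- target because `Q i` need be neither separated nor complete.
  have hzero : ∀ n, ‖q i (coeffAt i l n v)‖ = 0 := by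
    intro n
    let ψ : ProjTensor Q →L[ℂ] UniformSpace.Completion (Q i) :=
      ProjTensor.lift (contract i (fun j => l j (n j) ∘L r j) UniformSpace.Completion.toComplL)
    have hψ : ψ ∘L ProjTensor.map q =
        UniformSpace.Completion.toComplL (𝕜 := ℂ) ∘L q i ∘L coeffAt i l n := by
      refine ProjTensor.hom_ext fun m => ?_
      simp only [ContinuousLinearMap.comp_apply, ProjTensor.map_elem, ψ, ProjTensor.lift_elem,
        contract_apply, coeffAt, map_smul, ContinuousLinearMap.id_apply]
      congr 1
      exact Finset.prod_congr rfl fun j hj => by rw [hr j (Finset.ne_of_mem_erase hj)]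
    have h1 := DFunLike.congr_fun hψ v
    rw [ContinuousLinearMap.comp_apply, hv, map_zero] at h1
    rw [← UniformSpace.Completion.norm_coe]
    exact norm_eq_zero.2 h1.symm
  have hex : ∀ n, ∃ w, d w = K (insertAt i s n (coeffAt i l n v)) ∧
      ‖w‖ ≤ C * ‖coeffAt i l n v‖ := by
    intro n
    obtain ⟨w, hw, hwn⟩ := hK (Function.update (fun j => s j (n j)) i (coeffAt i l n v))
      (by rw [Function.update_self]; exact hzero n)
    refine ⟨w, by rw [hw, insertAt_apply], hwn.trans ?_⟩
    exact mul_le_mul_of_nonneg_left (norm_insertAt_tuple_le i s hs n _) hC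
  choose w hw hwn using hex
  -- The remainder is again killed by `⨂ q j`, because every slice has its `i`-th entry killed by `q
  -- i`; hence the approximation can be repeated.
  refine ⟨∑ n, w n, v - ∑ n, insertAt i s n (coeffAt i l n v), ?_, ?_, happ, ?_⟩
  · rw [map_sub, hv, zero_sub, neg_eq_zero, map_sum]
    refine Finset.sum_eq_zero fun n _ => ?_
    rw [insertAt_apply, ProjTensor.map_elem]
    exact elem_eq_zero i (by rw [Function.update_self]; exact hzero n)
  · refine (norm_sum_le _ _).trans ((Finset.sum_le_sum fun n _ => hwn n).trans ?_)
    rw [← Finset.mul_sum, mul_assoc]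
    exact mul_le_mul_of_nonneg_left hsum hC
  · rw [map_sub, sub_sub_cancel, map_sum, map_sum]
    exact Finset.sum_congr rfl fun n _ => hw n

end Exactness

/-! ### Tensor products as coproducts of commutative Banach algebras. -/

section AlgHoms

variable {ι : Type*} [Fintype ι]
variable {A : ι → Type*} [∀ i, SeminormedCommRing (A i)] [∀ i, NormedAlgebra ℂ (A i)]
variable {C : Type*} [NormedCommRing C] [NormedAlgebra ℂ C]

/-- A family of bounded homomorphisms into a commutative Banach algebra induces a bounded
homomorphism on the projective tensor product. -/
def ProjTensor.liftAlg [CompleteSpace C] (f : ∀ i, A i →A[ℂ] C) : ProjTensor A →A[ℂ] C where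
  toAlgHom := AlgHom.ofLinearMap
    (ProjTensor.lift ((ContinuousMultilinearMap.mkPiAlgebra ℂ ι C).compContinuousLinearMap
      fun i => (f i).toContinuousLinearMap)).toLinearMap
    (by
      change ProjTensor.lift _ (1 : ProjTensor A) = 1
      rw [one_eq_elem, ProjTensor.lift_elem]
      simp)
    (by
      intro x y
      change ProjTensor.lift _ (x * y) = ProjTensor.lift _ x * ProjTensor.lift _ y
      induction x using ProjTensor.induction with
      | closed => exact isClosed_eq (by fun_prop) (by fun_prop)
      | add z z' hz hz' => simp only [add_mul, map_add, hz, hz']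
      | smul_elem c a =>
      induction y using ProjTensor.induction with
      | closed => exact isClosed_eq (by fun_prop) (by fun_prop)
      | add z z' hz hz' => simp only [mul_add, map_add, hz, hz']
      | smul_elem d b =>
        simp only [smul_mul_assoc, mul_smul_comm, map_smul, elem_mul_elem, ProjTensor.lift_elem]
        simp [Finset.prod_mul_distrib])
  cont := (ProjTensor.lift _).continuous

@[simp]
theorem ProjTensor.liftAlg_elem [CompleteSpace C] (f : ∀ i, A i →A[ℂ] C) (a : ∀ i, A i) :
    ProjTensor.liftAlg f (elem a) = ∏ i, f i (a i) :=
  (ProjTensor.lift_elem _ _).trans (by simp)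

variable [DecidableEq ι]

variable (A) in
/-- The inclusion of a factor into the projective tensor product. -/
def ProjTensor.single (i : ι) : A i →A[ℂ] ProjTensor A where
  toAlgHom := AlgHom.ofLinearMap ((elemL A).toContinuousLinearMap 1 i).toLinearMap
    (by
      change elemL A (Function.update 1 i 1) = 1
      rw [elemL_apply, one_eq_elem]
      exact congrArg elem (Function.update_eq_self i (1 : ∀ i, A i)))
    (by
      intro a b
      change elemL A (Function.update 1 i (a * b)) =
        elemL A (Function.update 1 i a) * elemL A (Function.update 1 i b)
      simp only [elemL_apply, elem_mul_elem]
      congr 1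
      ext j
      by_cases h : j = i
      · subst h; simp
      · simp [h])
  cont := ((elemL A).toContinuousLinearMap 1 i).continuous

theorem ProjTensor.single_apply (i : ι) (a : A i) :
    ProjTensor.single A i a = elem (Pi.mulSingle i a) :=
  elemL_apply _

/-- Elementary tensors depend multiplicatively on the tuple, and a tuple is the product of its
one-entry tuples. Bounded homomorphisms are therefore determined on the factors. -/
theorem elem_eq_prod (a : ∀ i, A i) : elem a = ∏ i, ProjTensor.single A i (a i) := by
  let φ : (∀ i, A i) →* ProjTensor A :=
    { toFun := elem
      map_one' := (one_eq_elem A).symm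
      map_mul' := fun a b => (elem_mul_elem A a b).symm }
  have h := congrArg φ (Finset.univ_prod_mulSingle a)
  rw [map_prod] at h
  rw [show elem a = φ a from rfl, ← h]
  exact Finset.prod_congr rfl fun i _ => (ProjTensor.single_apply i (a i)).symm

@[simp]
theorem ProjTensor.liftAlg_single [CompleteSpace C] (f : ∀ i, A i →A[ℂ] C) (i : ι) (a : A i) :
    ProjTensor.liftAlg f (ProjTensor.single A i a) = f i a := by
  rw [ProjTensor.single_apply, ProjTensor.liftAlg_elem]
  rw [Finset.prod_eq_single i]
  · simp
  · intro j _ h; simp [h]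
  · simp

theorem ProjTensor.algHom_ext {f g : ProjTensor A →A[ℂ] C}
    (h : ∀ i a, f (ProjTensor.single A i a) = g (ProjTensor.single A i a)) : f = g := by
  have h1 : f.toContinuousLinearMap = g.toContinuousLinearMap := by
    refine ProjTensor.hom_ext fun m => ?_
    change f (elem m) = g (elem m)
    rw [elem_eq_prod, map_prod, map_prod]
    exact Finset.prod_congr rfl fun i _ => h i _
  ext x
  exact DFunLike.congr_fun h1 x

/-- Tensor product of bounded homomorphisms. -/
def ProjTensor.mapAlg {A' : ι → Type*} [∀ i, SeminormedCommRing (A' i)]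
    [∀ i, NormedAlgebra ℂ (A' i)] (f : ∀ i, A i →A[ℂ] A' i) : ProjTensor A →A[ℂ] ProjTensor A' :=
  ProjTensor.liftAlg fun i => (ProjTensor.single A' i).comp (f i)

@[simp]
theorem ProjTensor.mapAlg_elem {A' : ι → Type*} [∀ i, SeminormedCommRing (A' i)]
    [∀ i, NormedAlgebra ℂ (A' i)] (f : ∀ i, A i →A[ℂ] A' i) (a : ∀ i, A i) :
    ProjTensor.mapAlg f (elem a) = elem fun i => f i (a i) := by
  rw [ProjTensor.mapAlg, ProjTensor.liftAlg_elem, elem_eq_prod]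
  rfl

@[simp]
theorem ProjTensor.mapAlg_single {A' : ι → Type*} [∀ i, SeminormedCommRing (A' i)]
    [∀ i, NormedAlgebra ℂ (A' i)] (f : ∀ i, A i →A[ℂ] A' i) (i : ι) (a : A i) :
    ProjTensor.mapAlg f (ProjTensor.single A i a) = ProjTensor.single A' i (f i a) := by
  rw [ProjTensor.mapAlg, ProjTensor.liftAlg_single]
  rfl

end AlgHoms

/-! ### Chains as commutative Banach algebras, and the faces of the boundary. -/

section ChainAlg

variable {B : Type*} [NormedCommRing B] [NormedAlgebra ℂ B] {n : ℕ}
variable {C : Type*} [NormedCommRing C] [NormedAlgebra ℂ C]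

variable (B n) in
/-- Inclusion of `B` into chains at slot `j`. -/
def Chain.slotAlg (j : Fin (n + 1)) : B →A[ℂ] Chain B n :=
  ProjTensor.single (fun _ : Fin (n + 1) => B) j

theorem Chain.slotAlg_eq (j : Fin (n + 1)) (b : B) : Chain.slotAlg B n j b = Chain.slot B n j b := by
  rw [Chain.slot_apply]
  exact ProjTensor.single_apply (A := fun _ : Fin (n + 1) => B) j b

theorem Chain.smul_eq (b : B) (z : Chain B n) : b • z = Chain.slotAlg B n 0 b * z := by
  rw [Chain.smul_def, Chain.slotAlg_eq]

/-- Bounded homomorphisms on chains are given by their restrictions to the slots. -/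
def Chain.liftAlg [CompleteSpace C] (f : Fin (n + 1) → B →A[ℂ] C) : Chain B n →A[ℂ] C :=
  ProjTensor.liftAlg (A := fun _ : Fin (n + 1) => B) f

@[simp]
theorem Chain.liftAlg_slotAlg [CompleteSpace C] (f : Fin (n + 1) → B →A[ℂ] C) (j : Fin (n + 1))
    (b : B) : Chain.liftAlg f (Chain.slotAlg B n j b) = f j b :=
  ProjTensor.liftAlg_single (A := fun _ : Fin (n + 1) => B) f j b

@[simp]
theorem Chain.liftAlg_tensor [CompleteSpace C] (f : Fin (n + 1) → B →A[ℂ] C)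
    (b : Fin (n + 1) → B) : Chain.liftAlg f (Chain.tensor b) = ∏ j, f j (b j) :=
  ProjTensor.liftAlg_elem (A := fun _ : Fin (n + 1) => B) f b

theorem Chain.algHom_ext {f g : Chain B n →A[ℂ] C}
    (h : ∀ j b, f (Chain.slotAlg B n j b) = g (Chain.slotAlg B n j b)) : f = g :=
  ProjTensor.algHom_ext (A := fun _ : Fin (n + 1) => B) h

theorem Chain.tensor_eq_prod (b : Fin (n + 1) → B) :
    Chain.tensor b = ∏ j, Chain.slotAlg B n j (b j) :=
  elem_eq_prod (A := fun _ : Fin (n + 1) => B) b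

theorem Chain.hom_ext {F : Type*} [NormedAddCommGroup F] [NormedSpace ℂ F]
    {f g : Chain B n →L[ℂ] F} (h : ∀ m, f (Chain.tensor m) = g (Chain.tensor m)) : f = g :=
  ProjTensor.hom_ext (E := fun _ : Fin (n + 1) => B) h

theorem Chain.norm_tensor_le (m : Fin (n + 1) → B) : ‖Chain.tensor m‖ ≤ ∏ j, ‖m j‖ :=
  norm_elem_le (E := fun _ : Fin (n + 1) => B) m

variable (B) in
/-- The homomorphism `x ⊗ a ⊗ b ↦ x a ⊗ b`. -/
def face₀ : Chain B 2 →A[ℂ] Chain B 1 :=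
  Chain.liftAlg ![Chain.slotAlg B 1 0, Chain.slotAlg B 1 0, Chain.slotAlg B 1 1]

variable (B) in
/-- The homomorphism `x ⊗ a ⊗ b ↦ x ⊗ a b`. -/
def face₁ : Chain B 2 →A[ℂ] Chain B 1 :=
  Chain.liftAlg ![Chain.slotAlg B 1 0, Chain.slotAlg B 1 1, Chain.slotAlg B 1 1]

variable (B) in
/-- The homomorphism `x ⊗ a ⊗ b ↦ b x ⊗ a`. -/
def face₂ : Chain B 2 →A[ℂ] Chain B 1 :=
  Chain.liftAlg ![Chain.slotAlg B 1 0, Chain.slotAlg B 1 1, Chain.slotAlg B 1 0]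

/-- Commutativity of `B` makes each face a homomorphism of algebras. Identities involving the
boundary thereby reduce to identities of homomorphisms, which are checked on the slots. -/
theorem boundary₁L_eq (z : Chain B 2) : boundary₁L B z = face₀ B z - face₁ B z + face₂ B z := by
  have h : boundary₁L B = (face₀ B).toContinuousLinearMap - (face₁ B).toContinuousLinearMap +
      (face₂ B).toContinuousLinearMap := by
    refine Chain.hom_ext fun m => ?_
    obtain ⟨x, a, b, rfl⟩ : ∃ x a b, m = ![x, a, b] :=
      ⟨m 0, m 1, m 2, by ext j; fin_cases j <;> rfl⟩
    rw [boundary₁L_tensor]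
    simp [face₀, face₁, face₂, Fin.prod_univ_succ, Chain.tensor_eq_prod]
    ring
  rw [h]
  rfl

/-- Functoriality of chains. -/
def Chain.map [CompleteSpace C] (n : ℕ) (f : B →A[ℂ] C) : Chain B n →A[ℂ] Chain C n :=
  Chain.liftAlg fun j => (Chain.slotAlg C n j).comp f

@[simp]
theorem Chain.map_slotAlg [CompleteSpace C] (f : B →A[ℂ] C) (j : Fin (n + 1)) (b : B) :
    Chain.map n f (Chain.slotAlg B n j b) = Chain.slotAlg C n j (f b) := by
  rw [Chain.map, Chain.liftAlg_slotAlg]; rfl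

theorem boundary₁L_map [CompleteSpace C] (f : B →A[ℂ] C) (z : Chain B 2) :
    boundary₁L C (Chain.map 2 f z) = Chain.map 1 f (boundary₁L B z) := by
  have h0 : (face₀ C).comp (Chain.map 2 f) = (Chain.map 1 f).comp (face₀ B) :=
    Chain.algHom_ext fun j b => by fin_cases j <;> simp [face₀]
  have h1 : (face₁ C).comp (Chain.map 2 f) = (Chain.map 1 f).comp (face₁ B) :=
    Chain.algHom_ext fun j b => by fin_cases j <;> simp [face₁]
  have h2 : (face₂ C).comp (Chain.map 2 f) = (Chain.map 1 f).comp (face₂ B) :=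
    Chain.algHom_ext fun j b => by fin_cases j <;> simp [face₂]
  have h0 := DFunLike.congr_fun h0 z
  have h1 := DFunLike.congr_fun h1 z
  have h2 := DFunLike.congr_fun h2 z
  simp only [ContinuousAlgHom.comp_apply] at h0 h1 h2
  rw [boundary₁L_eq, boundary₁L_eq, map_add, map_sub, h0, h1, h2]

theorem boundary₁L_smul (b : B) (z : Chain B 2) :
    boundary₁L B (b • z) = b • boundary₁L B z :=
  (boundary₁ B).map_smul b z

end ChainAlg

/-! ### `H_1` as a cokernel, and the role of completeness. -/

section Quotient

variable {B : Type u} [NormedCommRing B] [NormedAlgebra ℂ B] [CompleteSpace B]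

/-- By commutativity every 1-chain is a cycle. -/
theorem boundary₀_eq_zero (z : Chain B 1) : boundary₀ B z = 0 := by
  have h : boundary₀L B = 0 := by
    refine Chain.hom_ext fun m => ?_
    obtain ⟨x, a, rfl⟩ : ∃ x a, m = ![x, a] := ⟨m 0, m 1, by ext j; fin_cases j <;> rfl⟩
    rw [boundary₀L_tensor, mul_comm, sub_self]
    rfl
  exact DFunLike.congr_fun h z

namespace HH1

variable (B) in
/-- The class of a chain in `H_1(B, B)`, as a linear map. -/
def mkₗ : Chain B 1 →ₗ[B] HH1 B :=
  ((LinearMap.range (boundary₁ B)).submoduleOf (LinearMap.ker (boundary₀ B))).mkQ ∘ₗ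
    LinearMap.codRestrict _ LinearMap.id fun z => LinearMap.mem_ker.2 (boundary₀_eq_zero z)

theorem mkₗ_surjective : Function.Surjective (mkₗ B) := by
  intro x
  obtain ⟨z, rfl⟩ := Submodule.mkQ_surjective _ x
  exact ⟨z, rfl⟩

theorem mkₗ_eq_zero_iff (z : Chain B 1) : mkₗ B z = 0 ↔ ∃ w, boundary₁L B w = z :=
  Submodule.Quotient.mk_eq_zero _

theorem norm_mkₗ_le (z : Chain B 1) : ‖mkₗ B z‖ ≤ ‖z‖ :=
  Submodule.Quotient.norm_mk_le
    ((LinearMap.range (boundary₁ B)).submoduleOf (LinearMap.ker (boundary₀ B)))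
    (⟨z, boundary₀_eq_zero z⟩ : LinearMap.ker (boundary₀ B))

theorem exists_mkₗ_eq_norm_lt (x : HH1 B) {ε : ℝ} (hε : 0 < ε) :
    ∃ z, mkₗ B z = x ∧ ‖z‖ < ‖x‖ + ε := by
  obtain ⟨z, hz, hzn⟩ := Submodule.Quotient.norm_mk_lt (S :=
    (LinearMap.range (boundary₁ B)).submoduleOf (LinearMap.ker (boundary₀ B))) x hε
  exact ⟨z, hz, hzn⟩

theorem smul_mkₗ (c : ℂ) (z : Chain B 1) : mkₗ B (c • z) = c • mkₗ B z := by
  rw [← algebraMap_smul B c z, map_smul, algebraMap_smul]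

variable (B) in
/-- The class of a chain in `H_1(B, B)`, as a bounded linear map. -/
def mkL : Chain B 1 →L[ℂ] HH1 B :=
  LinearMap.mkContinuous
    { toFun := mkₗ B
      map_add' := map_add _
      map_smul' := smul_mkₗ } 1 fun z => (one_mul ‖z‖).symm ▸ norm_mkₗ_le z

theorem mkL_apply (z : Chain B 1) : mkL B z = mkₗ B z := rfl

theorem op_smul_eq_smul (b : B) (x : HH1 B) : MulOpposite.op b • x = b • x := by
  obtain ⟨z, rfl⟩ := mkₗ_surjective x
  refine Eq.trans ?_ ((mkₗ B).map_smul b z)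
  change mkₗ B (MulOpposite.op b • z) = mkₗ B (b • z)
  rw [Chain.op_smul_def, Chain.smul_def, mul_comm]

/-- A quotient of a complete space is complete for the quotient seminorm, whether or not the
subspace is closed. Being Banach thus only asks that the seminorm separate points, that is, that the
boundaries be closed. -/
theorem completeSpace : CompleteSpace (HH1 B) := by
  have h : IsClosed ((LinearMap.ker (boundary₀ B) : Submodule B (Chain B 1)) : Set (Chain B 1)) := by
    convert isClosed_univ
    ext z
    simpa using boundary₀_eq_zero z
  have : CompleteSpace (LinearMap.ker (boundary₀ B)) := h.completeSpace_coe
  exact inferInstanceAs (CompleteSpace (↥(LinearMap.ker (boundary₀ B)) ⧸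
    (LinearMap.range (boundary₁ B)).submoduleOf (LinearMap.ker (boundary₀ B))))

/-- If `H_1(B, B)` is Banach, boundaries have preimages with control of norms. -/
theorem exists_boundary_preimage (h : IsBanach (HH1 B)) :
    ∃ C, 0 ≤ C ∧ ∀ z : Chain B 1, ‖mkL B z‖ = 0 → ∃ w, boundary₁L B w = z ∧ ‖w‖ ≤ C * ‖z‖ := by
  have hr : ∀ z, z ∈ LinearMap.range (boundary₁L B).toLinearMap ↔ ‖mkL B z‖ = 0 := fun z =>
    ⟨fun hz => by rw [mkL_apply, (mkₗ_eq_zero_iff z).2 hz, norm_zero],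
      fun hz => (mkₗ_eq_zero_iff z).1 (h.1 _ hz)⟩
  -- Separation of `H_1` makes the range the zero set of a continuous seminorm, so it is complete
  -- and the open mapping theorem applies to the corestricted boundary.
  have hcl : IsClosed (LinearMap.range (boundary₁L B).toLinearMap : Set (Chain B 1)) := by
    convert isClosed_singleton (x := (0 : ℝ)) |>.preimage (mkL B).continuous.norm using 1
    ext z
    exact hr z
  have : CompleteSpace (LinearMap.range (boundary₁L B).toLinearMap) := hcl.completeSpace_coe
  obtain ⟨C, hC, hCw⟩ := ContinuousLinearMap.exists_preimage_norm_le
    ((boundary₁L B).codRestrict (LinearMap.range (boundary₁L B).toLinearMap)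
      fun x => ⟨x, rfl⟩) (by rintro ⟨_, w, rfl⟩; exact ⟨w, rfl⟩)
  refine ⟨C, hC.le, fun z hz => ?_⟩
  obtain ⟨w, hw, hwn⟩ := hCw ⟨z, (hr z).2 hz⟩
  exact ⟨w, congrArg Subtype.val hw, hwn⟩

variable {E : Type*} [NormedAddCommGroup E] [NormedSpace ℂ E] [CompleteSpace E]

/-- A bounded linear surjection from 1-chains onto a Banach space whose kernel is the space of
boundaries identifies `H_1(B, B)` with that space. -/
theorem isBanach_and_exists_equiv (D : Chain B 1 →L[ℂ] E) (hD : Function.Surjective D)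
    (hDb : ∀ w, D (boundary₁L B w) = 0) (hker : ∀ z, D z = 0 → ∃ w, boundary₁L B w = z) :
    IsBanach (HH1 B) ∧ ∃ e : HH1 B ≃L[ℂ] E, ∀ z, e (mkL B z) = D z := by
  have hinj : ∀ z, D z = 0 ↔ mkL B z = 0 := fun z =>
    ⟨fun h => (mkₗ_eq_zero_iff z).2 (hker z h), fun h => by
      obtain ⟨w, rfl⟩ := (mkₗ_eq_zero_iff z).1 h
      exact hDb w⟩
  have hlift : ∀ x : HH1 B, ∃ z, mkL B z = x := mkₗ_surjective
  choose σ hσ using hlift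
  have hDσ : ∀ z, D (σ (mkL B z)) = D z := fun z => by
    rw [← sub_eq_zero, ← map_sub, hinj, map_sub, hσ, sub_self]
  let g : HH1 B →ₗ[ℂ] E :=
    { toFun := fun x => D (σ x)
      map_add' := fun x y => by
        rw [← map_add, ← sub_eq_zero, ← map_sub, hinj, map_sub, map_add, hσ, hσ, hσ, sub_self]
      map_smul' := fun c x => by
        rw [RingHom.id_apply, ← map_smul, ← sub_eq_zero, ← map_sub, hinj, map_sub, map_smul, hσ,
          hσ, sub_self] }
  have hg : ∀ z, g (mkL B z) = D z := hDσ
  have hgb : ∀ x, ‖g x‖ ≤ ‖D‖ * ‖x‖ := by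
    intro x
    refine le_of_forall_pos_le_add fun ε hε => ?_
    -- The slack is chosen so that `‖D‖` times it is at most `ε`, also when `‖D‖ = 0`.
    obtain ⟨z, rfl, hz⟩ := exists_mkₗ_eq_norm_lt x (ε := ε / (‖D‖ + 1)) (by positivity)
    rw [← mkL_apply] at hz ⊢
    rw [hg]
    refine (D.le_opNorm z).trans ((mul_le_mul_of_nonneg_left hz.le (norm_nonneg D)).trans ?_)
    rw [mul_add]
    gcongr
    rw [mul_div_assoc', div_le_iff₀ (by positivity)]
    nlinarith [norm_nonneg D]
  -- The open mapping theorem for `D` bounds the inverse; it is not applied to `g`, whose domain is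
  -- not yet known to be a normed space.
  obtain ⟨C, hC, hCz⟩ := D.exists_preimage_norm_le hD
  choose τ hτ hτn using hCz
  have hgτ : ∀ y, g (mkL B (τ y)) = y := fun y => by rw [hg, hτ]
  have hτg : ∀ x, mkL B (τ (g x)) = x := fun x => by
    obtain ⟨z, rfl⟩ := mkₗ_surjective x
    rw [← mkL_apply, ← sub_eq_zero, ← map_sub, ← hinj, map_sub, hτ, hg, sub_self]
  refine ⟨⟨fun x hx => ?_, completeSpace⟩, ?_⟩
  · rw [← hτg x]
    have : g x = 0 := norm_le_zero_iff.1 ((hgb x).trans_eq (by rw [hx, mul_zero]))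
    rw [← hinj, hτ, this]
  · let e : HH1 B ≃ₗ[ℂ] E :=
      { g with
        invFun := fun y => mkL B (τ y)
        left_inv := hτg
        right_inv := hgτ }
    refine ⟨e.toContinuousLinearEquivOfBounds ‖D‖ C hgb fun y => ?_, hg⟩
    exact (norm_mkₗ_le _).trans (hτn y)

end HH1

end Quotient

/-! ### The factors of the component maps. -/

/-- Either the Banach algebra `B` itself, or (for `true`) the algebra of 1-chains. -/
def ChainFactor (B : Type*) [NormedCommRing B] [NormedAlgebra ℂ B] : Bool → Type _
  | true => Chain B 1
  | false => B

namespace ChainFactor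

variable {B : Type*} [NormedCommRing B] [NormedAlgebra ℂ B]

instance : ∀ b, NormedCommRing (ChainFactor B b)
  | true => inferInstanceAs (NormedCommRing (Chain B 1))
  | false => inferInstanceAs (NormedCommRing B)

instance : ∀ b, NormedAlgebra ℂ (ChainFactor B b)
  | true => inferInstanceAs (NormedAlgebra ℂ (Chain B 1))
  | false => inferInstanceAs (NormedAlgebra ℂ B)

variable [CompleteSpace B]

instance : ∀ b, CompleteSpace (ChainFactor B b)
  | true => inferInstanceAs (CompleteSpace (Chain B 1))
  | false => inferInstanceAs (CompleteSpace B)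

variable {C : Type*} [NormedCommRing C] [NormedAlgebra ℂ C] [CompleteSpace C]

/-- Inclusion of the coefficient slot. -/
def left : ∀ b, B →A[ℂ] ChainFactor B b
  | true => Chain.slotAlg B 1 0
  | false => ContinuousAlgHom.id ℂ B

/-- Inclusion of the last slot. -/
def right : ∀ b, B →A[ℂ] ChainFactor B b
  | true => Chain.slotAlg B 1 1
  | false => ContinuousAlgHom.id ℂ B

/-- The map to 1-chains of `C` induced by a homomorphism to `C`, using the coefficient slot for
elements of `B`. -/
def toChain (f : B →A[ℂ] C) : ∀ b, ChainFactor B b →A[ℂ] Chain C 1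
  | true => Chain.map 1 f
  | false => (Chain.slotAlg C 1 0).comp f

variable (B) in
/-- The multiplication on 1-chains. -/
def mult : Chain B 1 →A[ℂ] B := Chain.liftAlg fun _ => ContinuousAlgHom.id ℂ B

theorem mult_slotAlg (j : Fin 2) (b : B) : mult B (Chain.slotAlg B 1 j b) = b :=
  Chain.liftAlg_slotAlg (fun _ => ContinuousAlgHom.id ℂ B) j b

/-- Comparison maps: the inclusion of the coefficient slot, the multiplication, or an identity. -/
def trans : ∀ b b', ChainFactor B b →A[ℂ] ChainFactor B b'
  | false, b' => left (B := B) b'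
  | true, true => ContinuousAlgHom.id ℂ (Chain B 1)
  | true, false => mult B

theorem trans_self : ∀ (b) (m : ChainFactor B b), trans b b m = m
  | true, _ => rfl
  | false, _ => rfl

omit [CompleteSpace B] in
theorem toChain_left (f : B →A[ℂ] C) : ∀ b x, toChain f b (left b x) = Chain.slotAlg C 1 0 (f x)
  | true, x => Chain.map_slotAlg f 0 x
  | false, _ => rfl

omit [CompleteSpace B] in
theorem toChain_right (f : B →A[ℂ] C) :
    ∀ b x, toChain f b (right b x) = Chain.slotAlg C 1 (if b then 1 else 0) (f x)
  | true, x => Chain.map_slotAlg f 1 x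
  | false, _ => rfl

theorem trans_slotAlg_zero : ∀ (b) (x : B), trans true b (Chain.slotAlg B 1 0 x) = left b x
  | true, _ => rfl
  | false, x => mult_slotAlg 0 x

theorem trans_slotAlg_one : ∀ (b) (x : B), trans true b (Chain.slotAlg B 1 1 x) = right b x
  | true, _ => rfl
  | false, x => mult_slotAlg 1 x

/-- If a homomorphism `g` on 1-chains of `C` is compatible with `s` on both slots, then it
turns `toChain` into the comparison maps. -/
theorem comp_toChain {R : Type*} [NormedCommRing R] [NormedAlgebra ℂ R] (f : B →A[ℂ] C) (b' : Bool)
    (s : ChainFactor B b' →A[ℂ] R) (g : Chain C 1 →A[ℂ] R)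
    (h0 : ∀ x, g (Chain.slotAlg C 1 0 (f x)) = s (left b' x))
    (h1 : ∀ x, g (Chain.slotAlg C 1 1 (f x)) = s (right b' x)) :
    ∀ b m, g (toChain f b m) = s (trans b b' m)
  | true, m => by
    have h : g.comp (toChain f true) = s.comp (trans true b') := by
      refine Chain.algHom_ext fun j x => ?_
      fin_cases j
      · refine Eq.trans ?_ ((h0 x).trans (congrArg s (trans_slotAlg_zero b' x).symm))
        exact congrArg g (Chain.map_slotAlg f 0 x)
      · refine Eq.trans ?_ ((h1 x).trans (congrArg s (trans_slotAlg_one b' x).symm))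
        exact congrArg g (Chain.map_slotAlg f 1 x)
    exact DFunLike.congr_fun h m
  | false, m => h0 m

section Quotient

variable {B : Type u} [NormedCommRing B] [NormedAlgebra ℂ B] [CompleteSpace B]

/-- The quotient map to the factors of the summands. -/
def quot : ∀ b, ChainFactor B b →L[ℂ] Factor B b
  | true => HH1.mkL B
  | false => ContinuousLinearMap.id ℂ B

theorem quot_left_mul : ∀ (b) (a : B) (m : ChainFactor B b), quot b (left b a * m) = a • quot b m
  | true, a, m => by
    exact (congrArg (HH1.mkL B) (Chain.smul_eq a m).symm).trans ((HH1.mkₗ B).map_smul a m)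
  | false, _, _ => rfl

/-- The chain `a ⊗ 1` is the boundary of `a ⊗ 1 ⊗ 1`, all of whose faces equal it; in the language
of differentials, `d1 = 0`. -/
theorem quot_left (a : B) : quot true (left true a) = 0 := by
  refine (HH1.mkₗ_eq_zero_iff _).2 ⟨Chain.slotAlg B 2 0 a, ?_⟩
  rw [boundary₁L_eq]
  simp [face₀, face₁, face₂]
  rfl

theorem quot_left_eq_right (b : Bool) (hb : b = false) (x a c : B) :
    quot b (left b x * left b a * right b c) = quot b (left b x * right b a * right b c) := by
  subst hb; rfl

theorem quot_right_eq_left (b : Bool) (hb : b = false) (x a c : B) :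
    quot b (left b x * left b a * right b c) = quot b (left b x * right b a * left b c) := by
  subst hb; rfl

theorem quot_boundary (b : Bool) (hb : b = true) (x a c : B) :
    quot b (left b x * left b a * right b c) - quot b (left b x * right b a * right b c) +
    quot b (left b x * right b a * left b c) = 0 := by
  subst hb
  rw [← map_sub, ← map_add]
  refine (HH1.mkₗ_eq_zero_iff _).2
    ⟨Chain.slotAlg B 2 0 x * Chain.slotAlg B 2 1 a * Chain.slotAlg B 2 2 c, ?_⟩
  rw [boundary₁L_eq]
  simp [face₀, face₁, face₂]
  rfl

theorem exists_quot_eq (h : IsBanach (HH1 B)) :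
    ∀ b (x : Factor B b), ∃ m, quot b m = x ∧ ‖m‖ ≤ 2 * ‖x‖
  | true, x => by
    -- For a class of seminorm zero the bound `2 * ‖x‖` leaves no slack; here separation of `H_1` is
    -- used, which makes the class zero.
    by_cases hx : ‖x‖ = 0
    · refine ⟨0, ?_, by rw [norm_zero]; positivity⟩
      rw [map_zero]
      exact (h.1 x hx).symm
    · obtain ⟨z, hz, hzn⟩ := HH1.exists_mkₗ_eq_norm_lt (x : HH1 B)
        (lt_of_le_of_ne (norm_nonneg x) (Ne.symm hx))
      exact ⟨z, hz, hzn.le.trans_eq (two_mul _).symm⟩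
  | false, x => ⟨x, rfl, by
      change ‖(x : B)‖ ≤ 2 * ‖(x : B)‖
      linarith [norm_nonneg (x : B)]⟩

end Quotient

end ChainFactor

/-- The three tuples differ only in place `i`, so linearity in that single entry suffices. -/
theorem elem_sub_add_elem_eq_zero {ι : Type*} [Fintype ι] {E : ι → Type*}
    [∀ i, SeminormedAddCommGroup (E i)] [∀ i, NormedSpace ℂ (E i)] (i : ι) (u v w : ∀ j, E j)
    (huv : ∀ j, j ≠ i → u j = v j) (huw : ∀ j, j ≠ i → u j = w j) (h : u i - v i + w i = 0) :
    elem u - elem v + elem w = 0 := by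
  classical
  have hv : v = Function.update u i (v i) := by
    rw [Function.eq_update_iff]
    exact ⟨rfl, fun j hj => (huv j hj).symm⟩
  have hw : w = Function.update u i (w i) := by
    rw [Function.eq_update_iff]
    exact ⟨rfl, fun j hj => (huw j hj).symm⟩
  have hu : u = Function.update u i (u i) := (Function.update_eq_self i u).symm
  rw [hv, hw]
  nth_rewrite 1 [hu]
  rw [← elemL_apply, ← elemL_apply, ← elemL_apply, ← ContinuousMultilinearMap.map_update_sub,
    ← ContinuousMultilinearMap.map_update_add, h]
  exact (elemL E).map_update_zero u i

/-! ### The components of the isomorphism. -/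

section Core

variable {ι : Type*} [Fintype ι] [DecidableEq ι]
variable {A : ι → Type u} [∀ i, NormedCommRing (A i)]
  [∀ i, NormedAlgebra ℂ (A i)] [∀ i, CompleteSpace (A i)]
variable {B : Type v} [NormedCommRing B] [NormedAlgebra ℂ B] [CompleteSpace B]

/-- The factors of the domain of the `i`-th component of the chain maps. -/
abbrev ChainFamily (A : ι → Type u) [∀ i, NormedCommRing (A i)]
    [∀ i, NormedAlgebra ℂ (A i)] (i : ι) : ι → Type u :=
  fun j => ChainFactor (A j) (decide (j = i))

/-- `quot` on all factors. -/
def quotMap (i : ι) : ProjTensor (ChainFamily A i) →L[ℂ]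
    ProjTensor (fun j => Factor (A j) (decide (j = i))) :=
  ProjTensor.map fun _ => ChainFactor.quot _

theorem quotMap_mul (i : ι) (a : ProjTensor A) (v : ProjTensor (ChainFamily A i)) :
    quotMap i (ProjTensor.mapAlg (fun _ => ChainFactor.left _) a * v) =
      act A (fun j => Factor (A j) (decide (j = i))) a (quotMap i v) := by
  induction a using ProjTensor.induction with
  | closed =>
    refine isClosed_eq ((quotMap i).continuous.comp
      ((ContinuousAlgHom.continuous _).mul continuous_const)) (by fun_prop)
  | add x y hx hy => simp only [map_add, add_mul, add_apply, hx, hy]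
  | smul_elem c a =>
  induction v using ProjTensor.induction with
  | closed => exact isClosed_eq (by fun_prop) (by fun_prop)
  | add x y hx hy => simp only [map_add, mul_add, hx, hy]
  | smul_elem d m =>
    simp only [map_smul, smul_mul_assoc, mul_smul_comm, smul_apply, ProjTensor.mapAlg_elem,
      elem_mul_elem, quotMap, ProjTensor.map_elem, act_elem, ChainFactor.quot_left_mul]

/-- Projective tensor products preserve quotient maps: each entry lifts with constant 2, hence
elementary tensors lift with the product of these constants. -/
theorem quotMap_surjective (h : ∀ j, IsBanach (HH1 (A j))) (i : ι) :
    Function.Surjective (quotMap (A := A) i) := by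
  refine ProjTensor.surjective_of_elem _ (∏ _j : ι, 2) (by positivity) fun m => ?_
  choose v hv hvn using fun j => ChainFactor.exists_quot_eq (h j) (decide (j = i)) (m j)
  refine ⟨elem v, ?_, (norm_elem_le v).trans ?_⟩
  · rw [quotMap, ProjTensor.map_elem, funext hv]
  · rw [← Finset.prod_mul_distrib]
    exact Finset.prod_le_prod (fun _ _ => norm_nonneg _) fun j _ => hvn j

/-- Continuous homomorphisms `A j → B` that identify `B` with `⨂̂ A j`, together with the inverse
identification. -/
structure TensorDecomp (A : ι → Type u) [∀ i, NormedCommRing (A i)]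
    [∀ i, NormedAlgebra ℂ (A i)] [∀ i, CompleteSpace (A i)]
    (B : Type v) [NormedCommRing B] [NormedAlgebra ℂ B] [CompleteSpace B] where
  /-- the identification -/
  toHom : ProjTensor A →A[ℂ] B
  /-- its inverse -/
  inv : B →A[ℂ] ProjTensor A
  inv_toHom : ∀ t, inv (toHom t) = t
  toHom_inv : ∀ b, toHom (inv b) = b

namespace TensorDecomp

variable (T : TensorDecomp A B)

/-- The inclusion of a factor. -/
def incl (j : ι) : A j →A[ℂ] B := T.toHom.comp (ProjTensor.single A j)

theorem inv_incl (j : ι) (x : A j) : T.inv (T.incl j x) = ProjTensor.single A j x :=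
  T.inv_toHom _

theorem chain_algHom_ext {C : Type*} [NormedCommRing C] [NormedAlgebra ℂ C] {n : ℕ}
    {f g : Chain B n →A[ℂ] C}
    (h : ∀ l j x, f (Chain.slotAlg B n l (T.incl j x)) = g (Chain.slotAlg B n l (T.incl j x))) :
    f = g := by
  refine Chain.algHom_ext fun l b => ?_
  have h1 : (f.comp (Chain.slotAlg B n l)).comp T.toHom =
      (g.comp (Chain.slotAlg B n l)).comp T.toHom :=
    ProjTensor.algHom_ext fun j x => h l j x
  have h2 := DFunLike.congr_fun h1 (T.inv b)
  simpa [T.toHom_inv] using h2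

omit [DecidableEq ι] in
-- The boundary and the quotient maps are linear but not multiplicative, so this linear companion to
-- `chain_algHom_ext` needs agreement on tensors of elementary tensors, not merely on the factors.
theorem chain_hom_ext {G : Type*} [NormedAddCommGroup G] [NormedSpace ℂ G] {n : ℕ}
    {f g : Chain B n →L[ℂ] G}
    (h : ∀ x : Fin (n + 1) → ∀ j, A j, f (Chain.tensor fun l => T.toHom (elem (x l))) =
      g (Chain.tensor fun l => T.toHom (elem (x l)))) : f = g := by
  let tens : ContinuousMultilinearMap ℂ (fun _ : Fin (n + 1) => ProjTensor A) (Chain B n) :=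
    ContinuousMultilinearMap.compContinuousLinearMap (elemL (fun _ : Fin (n + 1) => B))
      fun _ => T.toHom.toContinuousLinearMap
  have htens : ∀ m, tens m = Chain.tensor fun l => T.toHom (m l) := fun m => elemL_apply _
  have h1 : f.compContinuousMultilinearMap tens = g.compContinuousMultilinearMap tens := by
    refine continuousMultilinearMap_ext (fun _ => Set.range elem)
      (fun _ φ ψ hφ => ProjTensor.hom_ext fun a => hφ _ ⟨a, rfl⟩) fun m hm => ?_
    choose x hx using hm
    obtain rfl : (fun l => elem (x l)) = m := funext hx
    change f (tens _) = g (tens _)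
    rw [htens]
    exact h x
  refine Chain.hom_ext fun m => ?_
  have h2 := DFunLike.congr_fun h1 fun l => T.inv (m l)
  change f (tens _) = g (tens _) at h2
  simpa [htens, T.toHom_inv] using h2

/-- The homomorphism from 1-chains to the `i`-th tensor product. -/
def proj (i : ι) : Chain B 1 →A[ℂ] ProjTensor (ChainFamily A i) :=
  Chain.liftAlg ![(ProjTensor.mapAlg fun _ => ChainFactor.left _).comp T.inv,
    (ProjTensor.mapAlg fun _ => ChainFactor.right _).comp T.inv]

/-- The homomorphism from the `i`-th tensor product to 1-chains. -/
def embed (i : ι) : ProjTensor (ChainFamily A i) →A[ℂ] Chain B 1 :=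
  ProjTensor.liftAlg fun j => ChainFactor.toChain (T.incl j) (decide (j = i))

theorem proj_slotAlg_zero (i : ι) (b : B) : T.proj i (Chain.slotAlg B 1 0 b) =
    ProjTensor.mapAlg (fun _ => ChainFactor.left _) (T.inv b) := by
  simp [proj]

theorem proj_slotAlg_one (i : ι) (b : B) : T.proj i (Chain.slotAlg B 1 1 b) =
    ProjTensor.mapAlg (fun _ => ChainFactor.right _) (T.inv b) := by
  simp [proj]

/-- Both maps are homomorphisms built factor by factor, so the composite acts separately on each
entry: `trans` is the identity at a place of unchanged type, the multiplication at `i` and the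
inclusion `x ↦ x ⊗ 1` at `l` when `i ≠ l`. -/
theorem proj_embed_elem (i l : ι) (m : ∀ j, ChainFamily A i j) :
    T.proj l (T.embed i (elem m)) = elem fun j => ChainFactor.trans _ _ (m j) := by
  rw [embed, ProjTensor.liftAlg_elem, map_prod, elem_eq_prod]
  refine Finset.prod_congr rfl fun j _ => ?_
  refine ChainFactor.comp_toChain (T.incl j) _ (ProjTensor.single (ChainFamily A l) j) (T.proj l)
    (fun x => ?_) (fun x => ?_) _ _
  · rw [proj_slotAlg_zero, inv_incl, ProjTensor.mapAlg_single]
  · rw [proj_slotAlg_one, inv_incl, ProjTensor.mapAlg_single]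

/-- The components of the isomorphism. -/
def component (i : ι) : Chain B 1 →L[ℂ] ProjTensor fun j => Factor (A j) (decide (j = i)) :=
  quotMap i ∘L (T.proj i).toContinuousLinearMap

theorem component_apply (i : ι) (z : Chain B 1) : T.component i z = quotMap i (T.proj i z) := rfl

theorem component_smul (i : ι) (a : ProjTensor A) (z : Chain B 1) :
    T.component i (T.toHom a • z) =
      act A (fun j => Factor (A j) (decide (j = i))) a (T.component i z) := by
  rw [component_apply, component_apply, Chain.smul_eq, map_mul, proj_slotAlg_zero, T.inv_toHom,
    quotMap_mul]

theorem component_embed_self (i : ι) (v : ProjTensor (ChainFamily A i)) :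
    T.component i (T.embed i v) = quotMap i v := by
  have h : T.component i ∘L (T.embed i).toContinuousLinearMap = quotMap i := by
    refine ProjTensor.hom_ext fun m => ?_
    change quotMap i (T.proj i (T.embed i (elem m))) = _
    rw [proj_embed_elem]
    simp only [ChainFactor.trans_self]
  exact DFunLike.congr_fun h v

/-- The `l`-th entry has the form `x ⊗ 1`, whose class vanishes by `quot_left`. -/
theorem component_embed_of_ne {i l : ι} (hil : l ≠ i) (v : ProjTensor (ChainFamily A i)) :
    T.component l (T.embed i v) = 0 := by
  have h : T.component l ∘L (T.embed i).toContinuousLinearMap = 0 := by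
    refine ProjTensor.hom_ext fun m => ?_
    change quotMap l (T.proj l (T.embed i (elem m))) = _
    rw [proj_embed_elem, quotMap, ProjTensor.map_elem]
    refine elem_eq_zero l ?_
    have key : ∀ b b' (m : ChainFactor (A l) b), b = false → b' = true →
        ChainFactor.quot b' (ChainFactor.trans b b' m) = 0 := by
      rintro _ _ m rfl rfl
      exact ChainFactor.quot_left m
    rw [key _ _ _ (by simpa using hil) (by simp), norm_zero]
  exact DFunLike.congr_fun h v

/-- On elementary 2-chains the three faces have the same entry, the product of all three elements,
in each place `j ≠ i`. In place `i` they are the three faces of a 2-chain of `A i`, so their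
alternating sum is a boundary there. -/
theorem component_boundary₁L (i : ι) (w : Chain B 2) : T.component i (boundary₁L B w) = 0 := by
  have h : T.component i ∘L boundary₁L B = 0 := by
    refine T.chain_hom_ext fun x => ?_
    rw [ContinuousLinearMap.comp_apply, boundary₁L_eq, component_apply, map_add, map_sub, map_add,
      map_sub]
    simp only [face₀, face₁, face₂, Chain.liftAlg_tensor, Fin.prod_univ_succ]
    simp only [map_mul, Finset.univ_eq_empty, Finset.prod_empty, mul_one,
      Matrix.cons_val_zero, Matrix.cons_val_succ, proj_slotAlg_zero, proj_slotAlg_one,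
      T.inv_toHom, ProjTensor.mapAlg_elem, elem_mul_elem, quotMap, ProjTensor.map_elem,
      ← mul_assoc]
    refine elem_sub_add_elem_eq_zero i _ _ _ (fun j hj => ?_) (fun j hj => ?_) ?_
    · exact ChainFactor.quot_left_eq_right _ (by simpa using hj) _ _ _
    · exact ChainFactor.quot_right_eq_left _ (by simpa using hj) _ _ _
    · exact ChainFactor.quot_boundary _ (by simp) _ _ _
  exact DFunLike.congr_fun h w

end TensorDecomp

end Core

theorem norm_prod_smul_le {κ R M : Type*} [NormedCommRing R] [SeminormedAddCommGroup M]
    [Module R M] [IsBoundedSMul R M] (s : Finset κ) (y : κ → R) (x : M) :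
    ‖(∏ j ∈ s, y j) • x‖ ≤ (∏ j ∈ s, ‖y j‖) * ‖x‖ := by
  classical
  induction s using Finset.induction_on with
  | empty => simp
  | insert j s hj ih =>
    rw [Finset.prod_insert hj, Finset.prod_insert hj, mul_smul, mul_assoc]
    exact (norm_smul_le _ _).trans (mul_le_mul_of_nonneg_left ih (norm_nonneg _))

namespace ChainFactor

variable {B : Type u} [NormedCommRing B] [NormedAlgebra ℂ B] [CompleteSpace B]
  {C : Type*} [NormedCommRing C] [NormedAlgebra ℂ C] [CompleteSpace C]

omit [CompleteSpace B] in
theorem exists_toChain_eq_slotAlg (f : B →A[ℂ] C) (b : Bool) (hb : b = false) :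
    ∀ m : ChainFactor B b, ∃ y, toChain f b m = Chain.slotAlg C 1 0 y ∧
      ‖y‖ ≤ ‖f.toContinuousLinearMap‖ * ‖m‖ := by
  subst hb
  exact fun m => ⟨f m, rfl, f.toContinuousLinearMap.le_opNorm m⟩

theorem exists_toChain_eq_boundary (h : IsBanach (HH1 B)) (f : B →A[ℂ] C) (b : Bool)
    (hb : b = true) : ∃ c, 0 ≤ c ∧ ∀ m : ChainFactor B b, ‖quot b m‖ = 0 →
      ∃ w, boundary₁L C w = toChain f b m ∧ ‖w‖ ≤ c * ‖m‖ := by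
  subst hb
  obtain ⟨c, hc, hw⟩ := HH1.exists_boundary_preimage h
  refine ⟨‖(Chain.map 2 f).toContinuousLinearMap‖ * c, by positivity, fun m hm => ?_⟩
  obtain ⟨w, hwm, hwn⟩ := hw m hm
  refine ⟨Chain.map 2 f w, ?_, ?_⟩
  · rw [boundary₁L_map, hwm]
    rfl
  · refine ((Chain.map 2 f).toContinuousLinearMap.le_opNorm w).trans ?_
    rw [mul_assoc]
    exact mul_le_mul_of_nonneg_left hwn (norm_nonneg _)

end ChainFactor

/-! ### The kernel of the components: lifting boundaries and the Leibniz telescope. -/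

namespace TensorDecomp

section

variable {ι : Type*} [Fintype ι] [DecidableEq ι]
variable {A : ι → Type u} [∀ i, NormedCommRing (A i)]
  [∀ i, NormedAlgebra ℂ (A i)] [∀ i, CompleteSpace (A i)]
variable {B : Type v} [NormedCommRing B] [NormedAlgebra ℂ B] [CompleteSpace B]
variable (T : TensorDecomp A B)

/-- The entries in places `j ≠ i` embed into the coefficient slot, where they act as module
multiplications. Since `d₁` is `B`-linear and natural, a controlled preimage of the `i`-th entry in
the 2-chains of `A i` can be transported and multiplied by them. -/
theorem exists_boundary_eq_embed_elem (i : ι) (h : IsBanach (HH1 (A i))) :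
    ∃ c, 0 ≤ c ∧ ∀ m : ∀ j, ChainFamily A i j, ‖ChainFactor.quot _ (m i)‖ = 0 →
      ∃ w, boundary₁L B w = T.embed i (elem m) ∧ ‖w‖ ≤ c * ∏ j, ‖m j‖ := by
  obtain ⟨c, hc, hw⟩ := ChainFactor.exists_toChain_eq_boundary h (T.incl i) (decide (i = i))
    (by simp)
  refine ⟨c * ∏ j ∈ Finset.univ.erase i, ‖(T.incl j).toContinuousLinearMap‖, by positivity,
    fun m hm => ?_⟩
  obtain ⟨w, hwm, hwn⟩ := hw (m i) hm
  have hy : ∀ j, ∃ y, j ≠ i → ChainFactor.toChain (T.incl j) (decide (j = i)) (m j) =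
      Chain.slotAlg B 1 0 y ∧ ‖y‖ ≤ ‖(T.incl j).toContinuousLinearMap‖ * ‖m j‖ := fun j => by
    by_cases hj : j = i
    · exact ⟨0, fun hj' => absurd hj hj'⟩
    · obtain ⟨y, hy⟩ := ChainFactor.exists_toChain_eq_slotAlg (T.incl j) (decide (j = i))
        (by simpa using hj) (m j)
      exact ⟨y, fun _ => hy⟩
  choose y hy using hy
  refine ⟨(∏ j ∈ Finset.univ.erase i, y j) • w, ?_, ?_⟩
  · rw [boundary₁L_smul, hwm, embed, ProjTensor.liftAlg_elem,
      ← Finset.mul_prod_erase _ _ (Finset.mem_univ i), Chain.smul_eq, map_prod, mul_comm]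
    congr 1
    exact Finset.prod_congr rfl fun j hj => (hy j (Finset.ne_of_mem_erase hj)).1.symm
  · refine (norm_prod_smul_le _ _ _).trans ?_
    rw [← Finset.mul_prod_erase Finset.univ (fun j => ‖m j‖) (Finset.mem_univ i),
      mul_mul_mul_comm, ← Finset.prod_mul_distrib, mul_comm]
    refine mul_le_mul hwn (Finset.prod_le_prod (fun _ _ => norm_nonneg _) fun j hj => ?_)
      (Finset.prod_nonneg fun _ _ => norm_nonneg _) (by positivity)
    exact (hy j (Finset.ne_of_mem_erase hj)).2

/-- This is `exists_preimage_of_map_eq_zero` with `d = boundary₁L B` and `K = embed i`: away from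
`i` the quotient map is the identity, hence has a left inverse, and the factor is `L¹`-like. -/
theorem exists_boundary_eq_embed_proj (hA : ∀ j, HasL1Approx (A j)) (i : ι)
    (h : IsBanach (HH1 (A i))) (z : Chain B 1) (hz : T.component i z = 0) :
    ∃ w, boundary₁L B w = T.embed i (T.proj i z) := by
  obtain ⟨c, hc, hw⟩ := T.exists_boundary_eq_embed_elem i h
  refine exists_preimage_of_map_eq_zero (V := ChainFamily A i) i ?_
    (fun _ => ChainFactor.quot _) ?_ (boundary₁L B) (T.embed i).toContinuousLinearMap c hc hw
    (T.proj i z) hz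
  · have key : ∀ j b, b = false → HasL1Approx (ChainFactor (A j) b) := by
      rintro j _ rfl; exact hA j
    exact fun j hj => key j _ (by simpa using hj)
  · have key : ∀ j b, b = false → ∃ r : Factor (A j) b →L[ℂ] ChainFactor (A j) b,
        ∀ x, r (ChainFactor.quot b x) = x := by
      rintro j _ rfl
      exact ⟨ContinuousLinearMap.id ℂ (A j), fun _ => rfl⟩
    exact fun j hj => key j _ (by simpa using hj)

/-- Put the components of the last tensor factor into prescribed slots. -/
def distribute (n : ℕ) (s : ι → Fin (n + 1)) : Chain B 1 →A[ℂ] Chain B n :=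
  Chain.liftAlg ![Chain.slotAlg B n 0,
    (ProjTensor.liftAlg fun j => (Chain.slotAlg B n (s j)).comp (T.incl j)).comp T.inv]

theorem distribute_slotAlg_zero (n : ℕ) (s : ι → Fin (n + 1)) (b : B) :
    T.distribute n s (Chain.slotAlg B 1 0 b) = Chain.slotAlg B n 0 b := by
  simp [distribute]

theorem distribute_slotAlg_one (n : ℕ) (s : ι → Fin (n + 1)) (j : ι) (x : A j) :
    T.distribute n s (Chain.slotAlg B 1 1 (T.incl j x)) =
      Chain.slotAlg B n (s j) (T.incl j x) := by
  simp [distribute, T.inv_incl]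

theorem algHom_ext {C : Type*} [NormedCommRing C] [NormedAlgebra ℂ C]
    {f g : Chain B 1 →A[ℂ] C}
    (h0 : ∀ j x, f (Chain.slotAlg B 1 0 (T.incl j x)) = g (Chain.slotAlg B 1 0 (T.incl j x)))
    (h1 : ∀ j x, f (Chain.slotAlg B 1 1 (T.incl j x)) = g (Chain.slotAlg B 1 1 (T.incl j x))) :
    f = g :=
  T.chain_algHom_ext (Fin.forall_fin_two.2 ⟨h0, h1⟩)

/-- On `x ⊗ a` both sides give `x (∏_{j ≠ i} aⱼ) ⊗ aᵢ`, the `i`-th term of the Leibniz rule. -/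
theorem embed_proj (i : ι) (z : Chain B 1) :
    T.embed i (T.proj i z) = T.distribute 1 (fun j => if j = i then 1 else 0) z := by
  have h : (T.embed i).comp (T.proj i) = T.distribute 1 (fun j => if j = i then 1 else 0) := by
    refine T.algHom_ext (fun j x => ?_) fun j x => ?_
    · rw [distribute_slotAlg_zero, ContinuousAlgHom.comp_apply, proj_slotAlg_zero,
        inv_incl, ProjTensor.mapAlg_single, embed, ProjTensor.liftAlg_single,
        ChainFactor.toChain_left]
    · rw [distribute_slotAlg_one, ContinuousAlgHom.comp_apply, proj_slotAlg_one,
        inv_incl, ProjTensor.mapAlg_single, embed, ProjTensor.liftAlg_single,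
        ChainFactor.toChain_right]
      simp
  exact DFunLike.congr_fun h z

theorem distribute_one (z : Chain B 1) : T.distribute 1 (fun _ => 1) z = z := by
  have h : T.distribute 1 (fun _ => 1) = ContinuousAlgHom.id ℂ (Chain B 1) := by
    refine T.algHom_ext (fun j x => ?_) fun j x => ?_
    · exact T.distribute_slotAlg_zero _ _ _
    · exact T.distribute_slotAlg_one _ _ _ _
  exact DFunLike.congr_fun h z

/-- Moving all of `a` into the coefficient slot turns `x ⊗ a` into `x a ⊗ 1`, a boundary as in
`quot_left`. -/
theorem exists_boundary_eq_distribute_zero (z : Chain B 1) :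
    ∃ w, boundary₁L B w = T.distribute 1 (fun _ => 0) z := by
  have h : T.distribute 1 (fun _ => 0) =
      (Chain.slotAlg B 1 0).comp (ChainFactor.mult B) := by
    refine T.algHom_ext (fun j x => ?_) fun j x => ?_
    · rw [distribute_slotAlg_zero, ContinuousAlgHom.comp_apply, ChainFactor.mult_slotAlg]
    · rw [distribute_slotAlg_one, ContinuousAlgHom.comp_apply, ChainFactor.mult_slotAlg]
  refine ⟨Chain.slotAlg B 2 0 (ChainFactor.mult B z), ?_⟩
  rw [h, boundary₁L_eq]
  simp [face₀, face₁, face₂]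

/-- A face merges slots according to a map `σ` of slots, so it merely composes the distribution with
`σ`; the faces of a distributed chain are read off combinatorially. -/
theorem face_distribute (f : Chain B 2 →A[ℂ] Chain B 1) (σ : Fin 3 → Fin 2)
    (hf : ∀ l b, f (Chain.slotAlg B 2 l b) = Chain.slotAlg B 1 (σ l) b) (hσ : σ 0 = 0)
    (s : ι → Fin 3) (z : Chain B 1) :
    f (T.distribute 2 s z) = T.distribute 1 (fun j => σ (s j)) z := by
  have h : f.comp (T.distribute 2 s) = T.distribute 1 (fun j => σ (s j)) := by
    refine T.algHom_ext (fun j x => ?_) fun j x => ?_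
    · rw [ContinuousAlgHom.comp_apply, distribute_slotAlg_zero, distribute_slotAlg_zero, hf, hσ]
    · rw [ContinuousAlgHom.comp_apply, distribute_slotAlg_one, distribute_slotAlg_one, hf]
  exact DFunLike.congr_fun h z

theorem boundary₁L_distribute (s : ι → Fin 3) (z : Chain B 1) :
    boundary₁L B (T.distribute 2 s z) = T.distribute 1 (fun j => ![0, 0, 1] (s j)) z -
      T.distribute 1 (fun j => ![0, 1, 1] (s j)) z +
      T.distribute 1 (fun j => ![0, 1, 0] (s j)) z := by
  rw [boundary₁L_eq]
  congr 1
  · congr 1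
    · exact T.face_distribute _ _ (fun l b => by fin_cases l <;> simp [face₀]) rfl s z
    · exact T.face_distribute _ _ (fun l b => by fin_cases l <;> simp [face₁]) rfl s z
  · exact T.face_distribute _ _ (fun l b => by fin_cases l <;> simp [face₂]) rfl s z

end

section

variable {k : ℕ} {A : Fin k → Type u} [∀ i, NormedCommRing (A i)]
  [∀ i, NormedAlgebra ℂ (A i)] [∀ i, CompleteSpace (A i)]
variable {B : Type v} [NormedCommRing B] [NormedAlgebra ℂ B] [CompleteSpace B]
variable (T : TensorDecomp A B)

/-- Every 1-chain is homologous to the sum of its components. -/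
theorem exists_boundary_eq_sub_sum (z : Chain B 1) :
    ∃ w, boundary₁L B w = z - ∑ i, T.embed i (T.proj i z) := by
  -- For `z = x ⊗ a` this is `x (∏_{j ≥ n} aⱼ) ⊗ ∏_{j < n} aⱼ`; it interpolates between a boundary
  -- at `n = 0` and `z` at `n = k`.
  let E : ℕ → Chain B 1 := fun n =>
    T.distribute 1 (fun j : Fin k => if j.val < n then 1 else 0) z
  have hstep : ∀ i : Fin k, ∃ w, boundary₁L B w =
      T.embed i (T.proj i z) - (E (i + 1) - E i) := by
    intro i
    -- The 2-chain `x (∏_{j > i} aⱼ) ⊗ (∏_{j < i} aⱼ) ⊗ aᵢ` expresses the Leibniz rule for the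
    -- product of `∏_{j < i} aⱼ` and `aᵢ`: its three faces are the `i`-th Leibniz term, `E (i + 1)`
    -- and `E i`.
    refine ⟨T.distribute 2 (fun j => if j < i then 1 else if j = i then 2 else 0) z, ?_⟩
    have h0 : (fun j : Fin k => (![0, 0, 1] : Fin 3 → Fin 2)
        (if j < i then 1 else if j = i then 2 else 0)) = fun j => if j = i then 1 else 0 := by
      ext j
      rcases lt_trichotomy j i with h | h | h
      · simp [h, h.ne]
      · simp [h]
      · simp [h.ne', h.not_gt]
    have h1 : (fun j : Fin k => (![0, 1, 1] : Fin 3 → Fin 2)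
        (if j < i then 1 else if j = i then 2 else 0)) =
          fun j => if j.val < i.val + 1 then 1 else 0 := by
      ext j
      rcases lt_trichotomy j i with h | h | h
      · simp [h, Nat.lt_succ_of_lt (Fin.lt_def.1 h)]
      · simp [h]
      · have : ¬ j.val < i.val + 1 := by have := Fin.lt_def.1 h; omega
        simp [h.ne', h.not_gt, this]
    have h2 : (fun j : Fin k => (![0, 1, 0] : Fin 3 → Fin 2)
        (if j < i then 1 else if j = i then 2 else 0)) =
          fun j => if j.val < i.val then 1 else 0 := by
      ext j
      rcases lt_trichotomy j i with h | h | h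
      · simp [h]
      · simp [h]
      · simp [h.ne', h.not_gt]
    rw [boundary₁L_distribute, embed_proj, sub_sub_eq_add_sub, add_sub_right_comm, h0, h1, h2]
  choose w hw using hstep
  obtain ⟨w₀, hw₀⟩ := T.exists_boundary_eq_distribute_zero z
  have hEk : E k = z := by
    simp only [E, Fin.is_lt, if_true]
    exact T.distribute_one z
  have hE0 : E 0 = boundary₁L B w₀ := by
    rw [hw₀]
    simp [E]
  have hsum : ∑ i : Fin k, (E (i + 1) - E i) = E k - E 0 := by
    rw [Fin.sum_univ_eq_sum_range (fun n => E (n + 1) - E n) k, Finset.sum_range_sub]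
  refine ⟨w₀ - ∑ i, w i, ?_⟩
  rw [map_sub, map_sum, ← hE0]
  simp only [hw]
  rw [Finset.sum_sub_distrib, hsum, hEk]
  abel

/-- The first Hochschild homology of a projective tensor product of `L¹`-like algebras. -/
theorem exists_equiv (hA : ∀ j, HasL1Approx (A j)) (h : ∀ j, IsBanach (HH1 (A j))) :
    IsBanach (HH1 B) ∧ ∃ e : HH1 B ≃L[ℂ] (∀ i, Summand A i),
      ∀ a x, e (T.toHom a • x) = a • e x := by
  let D : Chain B 1 →L[ℂ] (∀ i, Summand A i) := ContinuousLinearMap.pi fun i => T.component i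
  have hD : Function.Surjective D := by
    intro y
    choose v hv using fun i => quotMap_surjective h i (y i)
    -- By biorthogonality only the `l`-th summand contributes to the `l`-th component.
    refine ⟨∑ i, T.embed i (v i), funext fun l => ?_⟩
    change T.component l (∑ i, T.embed i (v i)) = y l
    rw [map_sum, Finset.sum_eq_single l, component_embed_self, hv]
    · exact fun i _ hi => T.component_embed_of_ne hi.symm (v i)
    · simp
  have hker : ∀ z, D z = 0 → ∃ w, boundary₁L B w = z := by
    intro z hz
    choose w hw using fun i =>
      T.exists_boundary_eq_embed_proj hA i (h i) z (congrFun hz i)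
    obtain ⟨w', hw'⟩ := T.exists_boundary_eq_sub_sum z
    refine ⟨w' + ∑ i, w i, ?_⟩
    rw [map_add, map_sum, hw', Finset.sum_congr rfl fun i _ => hw i, sub_add_cancel]
  obtain ⟨hB, e, he⟩ := HH1.isBanach_and_exists_equiv D hD
    (fun w => funext fun i => T.component_boundary₁L i w) hker
  refine ⟨hB, e, fun a x => ?_⟩
  obtain ⟨z, rfl⟩ := HH1.mkₗ_surjective x
  rw [← map_smul, ← HH1.mkL_apply, ← HH1.mkL_apply, he, he]
  exact funext fun i => T.component_smul i a z

end

end TensorDecomp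

/-! ### The approximation property of `L¹(μ)`. -/

section LOne

open MeasureTheory

theorem HasL1Approx.of_fintype {W : Type*} [SeminormedAddCommGroup W] [NormedSpace ℂ W] (C : ℝ)
    (h : ∀ (S : Finset W) (ε : ℝ), 0 < ε →
      ∃ (κ : Type v) (_ : Fintype κ) (l : κ → W →L[ℂ] ℂ) (s : κ → W),
        (∀ n, ‖s n‖ ≤ 1) ∧ (∀ w, ∑ n, ‖l n w‖ ≤ C * ‖w‖) ∧
        ∀ w ∈ S, ‖w - ∑ n, l n w • s n‖ ≤ ε) : HasL1Approx W := by
  refine ⟨C, fun S ε hε => ?_⟩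
  obtain ⟨κ, _, l, s, hs, hl, happ⟩ := h S ε hε
  let e := Fintype.equivFin κ
  refine ⟨Fintype.card κ, fun n => l (e.symm n), fun n => s (e.symm n), fun n => hs _,
    fun w => ?_, fun w hw => ?_⟩
  · rw [Equiv.sum_comp e.symm fun n => ‖l n w‖]
    exact hl w
  · rw [Equiv.sum_comp e.symm fun n => l n w • s n]
    exact happ w hw

variable {X : Type v} [MeasurableSpace X] {μ : Measure X}

theorem Lp_coeFn_sum {κ : Type*} (s : Finset κ) (f : κ → Lp ℂ 1 μ) :
    ((∑ i ∈ s, f i : Lp ℂ 1 μ) : X → ℂ) =ᵐ[μ] fun x => ∑ i ∈ s, f i x := by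
  classical
  induction s using Finset.induction_on with
  | empty =>
    simp only [Finset.sum_empty]
    exact Lp.coeFn_zero ℂ 1 μ
  | insert i s hi ih =>
    rw [Finset.sum_insert hi]
    filter_upwards [Lp.coeFn_add (f i) (∑ i ∈ s, f i), ih] with x hx hx'
    rw [hx, Pi.add_apply, hx', Finset.sum_insert hi]

theorem Lp_integrable (w : Lp ℂ 1 μ) : Integrable w μ := memLp_one_iff_integrable.1 (Lp.memLp w)

/-- Integration over a set as a bounded functional on `L¹`. -/
def setIntegralL (μ : Measure X) (E : Set X) : Lp ℂ 1 μ →L[ℂ] ℂ :=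
  LinearMap.mkContinuous
    { toFun := fun w => ∫ x in E, w x ∂μ
      map_add' := fun w w' => by
        rw [← integral_add (Lp_integrable w).integrableOn (Lp_integrable w').integrableOn]
        exact integral_congr_ae (ae_restrict_of_ae (Lp.coeFn_add w w'))
      map_smul' := fun c w => by
        rw [RingHom.id_apply, ← integral_smul]
        exact integral_congr_ae (ae_restrict_of_ae (Lp.coeFn_smul c w)) } 1 fun w => by
    rw [one_mul, L1.norm_eq_integral_norm]
    exact (norm_integral_le_integral_norm _).trans
      (setIntegral_le_integral (Lp_integrable w).norm (Filter.Eventually.of_forall fun _ =>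
        norm_nonneg _))

theorem setIntegralL_apply (E : Set X) (w : Lp ℂ 1 μ) :
    setIntegralL μ E w = ∫ x in E, w x ∂μ := rfl

theorem sum_norm_setIntegralL_le {κ : Type*} [Fintype κ] (E : κ → Set X)
    (hE : ∀ n, MeasurableSet (E n)) (hd : Pairwise (Function.onFun Disjoint E)) (w : Lp ℂ 1 μ) :
    ∑ n, ‖setIntegralL μ (E n) w‖ ≤ ‖w‖ := by
  rw [L1.norm_eq_integral_norm]
  calc ∑ n, ‖setIntegralL μ (E n) w‖ ≤ ∑ n, ∫ x in E n, ‖w x‖ ∂μ :=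
        Finset.sum_le_sum fun n _ => norm_integral_le_integral_norm _
    _ = ∫ x in ⋃ n ∈ (Finset.univ : Finset κ), E n, ‖w x‖ ∂μ :=
        (integral_biUnion_finset _ (fun n _ => hE n) (fun n _ m _ h => hd h)
          fun n _ => (Lp_integrable w).norm.integrableOn).symm
    _ ≤ ∫ x, ‖w x‖ ∂μ := setIntegral_le_integral (Lp_integrable w).norm
        (Filter.Eventually.of_forall fun _ => norm_nonneg _)

/-- The approximating operators average over finitely many disjoint sets of finite measure. They are
contractions and fix functions that are constant on each of these sets and zero elsewhere; no
finiteness condition on `μ` is needed. -/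
theorem hasL1Approx_Lp : HasL1Approx (Lp ℂ 1 μ) := by
  classical
  refine HasL1Approx.of_fintype.{v} 1 fun S ε hε => ?_
  -- Treating the finite family `S` as one vector-valued function gives a common system of level
  -- sets for all its members.
  let F : X → S → ℂ := fun x w => w.1 x
  have hF : MemLp F 1 μ := memLp_pi_iff.2 fun w => Lp.memLp w.1
  obtain ⟨g, hg, hgm⟩ := hF.exists_simpleFunc_eLpNorm_sub_lt (by simp)
    (ε := ENNReal.ofReal (ε / 2)) (by simpa using hε)
  let T : Finset (S → ℂ) := g.range.filter (· ≠ 0)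
  let E : T → Set X := fun c => g ⁻¹' {c.1}
  have hE : ∀ c, MeasurableSet (E c) := fun c => g.measurableSet_fiber _
  have hμE : ∀ c, μ (E c) ≠ ⊤ := fun c =>
    (SimpleFunc.measure_preimage_lt_top_of_memLp one_ne_zero (by simp) g hgm c.1
      (Finset.mem_filter.1 c.2).2).ne
  have hd : Pairwise (Function.onFun Disjoint E) := by
    intro c c' hcc
    refine Set.disjoint_left.2 fun x hx hx' => hcc (Subtype.ext ?_)
    exact (Set.mem_singleton_iff.1 hx).symm.trans (Set.mem_singleton_iff.1 hx')
  let χ : T → Lp ℂ 1 μ := fun c => indicatorConstLp 1 (hE c) (hμE c) 1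
  have hχn : ∀ c, ‖χ c‖ = μ.real (E c) := fun c => by
    simp [χ, norm_indicatorConstLp]
  have hχ : ∀ c c', setIntegralL μ (E c) (χ c') = if c = c' then (μ.real (E c) : ℂ) else 0 := by
    intro c c'
    rw [setIntegralL_apply, integral_congr_ae (ae_restrict_of_ae indicatorConstLp_coeFn),
      setIntegral_indicator (hE c')]
    split_ifs with h
    · subst h; simp
    · rw [(hd h).inter_eq]; simp
  let s : T → Lp ℂ 1 μ := fun c => ((μ.real (E c))⁻¹ : ℂ) • χ c
  let P : Lp ℂ 1 μ →ₗ[ℂ] Lp ℂ 1 μ :=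
    ∑ c, (setIntegralL μ (E c)).toLinearMap.smulRight (s c)
  have hP : ∀ w, P w = ∑ c, setIntegralL μ (E c) w • s c := fun w => by simp [P]
  have hs : ∀ c, ‖s c‖ ≤ 1 := fun c => by
    simp only [s]
    rw [norm_smul, hχn, norm_inv, Complex.norm_of_nonneg measureReal_nonneg]
    exact inv_mul_le_one
  have hPn : ∀ w, ‖P w‖ ≤ ‖w‖ := fun w => by
    rw [hP]
    refine (norm_sum_le _ _).trans (le_trans (Finset.sum_le_sum fun c _ => ?_)
      (sum_norm_setIntegralL_le E hE hd w))
    rw [norm_smul]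
    exact mul_le_of_le_one_right (norm_nonneg _) (hs c)
  have hPχ : ∀ c, P (χ c) = χ c := fun c => by
    rw [hP, Finset.sum_eq_single c]
    · rw [hχ, if_pos rfl, smul_smul]
      -- On a null set the normalization is `0⁻¹ = 0`, and the indicator is itself zero in `L¹`.
      by_cases h : μ.real (E c) = 0
      · have : χ c = 0 := norm_eq_zero.1 ((hχn c).trans h)
        rw [this, smul_zero]
      · rw [mul_inv_cancel₀ (by exact_mod_cast h), one_smul]
    · intro c' _ h
      rw [hχ, if_neg h, zero_smul]
    · simp
  refine ⟨T, inferInstance, fun c => setIntegralL μ (E c), s, hs,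
    fun w => (sum_norm_setIntegralL_le E hE hd w).trans_eq (one_mul _).symm, fun w hw => ?_⟩
  let G : Lp ℂ 1 μ := ∑ c : T, c.1 ⟨w, hw⟩ • χ c
  have hPG : P G = G := by
    simp only [G, map_sum, map_smul, hPχ]
  have hGae : (G : X → ℂ) =ᵐ[μ] fun x => g x ⟨w, hw⟩ := by
    have h1 : ∀ᵐ x ∂μ, ∀ c : T, (c.1 ⟨w, hw⟩ • χ c : Lp ℂ 1 μ) x =
        (E c).indicator (fun _ => c.1 ⟨w, hw⟩) x := by
      rw [ae_all_iff]
      intro c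
      filter_upwards [Lp.coeFn_smul (c.1 ⟨w, hw⟩) (χ c),
        indicatorConstLp_coeFn (p := 1) (hs := hE c) (hμs := hμE c) (c := (1 : ℂ))] with x hx hx'
      rw [hx, Pi.smul_apply, hx']
      by_cases hxE : x ∈ E c <;> simp [hxE]
    filter_upwards [Lp_coeFn_sum Finset.univ fun c : T => c.1 ⟨w, hw⟩ • χ c, h1] with x hx hx'
    rw [hx]
    simp only [hx']
    by_cases h0 : g x = 0
    · rw [h0]
      refine Finset.sum_eq_zero fun c _ => Set.indicator_of_notMem (fun hxc => ?_) _
      exact (Finset.mem_filter.1 c.2).2 ((Set.mem_singleton_iff.1 hxc).symm.trans h0)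
    · rw [Finset.sum_eq_single (⟨g x, Finset.mem_filter.2 ⟨g.mem_range_self x, h0⟩⟩ : T)]
      · rw [Set.indicator_of_mem (by simp [E])]
      · intro c _ hc
        refine Set.indicator_of_notMem (fun hxc => hc (Subtype.ext ?_)) _
        exact (Set.mem_singleton_iff.1 hxc).symm
      · simp
  have hwG : ‖w - G‖ ≤ ε / 2 := by
    rw [Lp.norm_def]
    refine ENNReal.toReal_le_of_le_ofReal (half_pos hε).le (le_trans ?_ hg.le)
    refine eLpNorm_mono_ae ?_
    filter_upwards [Lp.coeFn_sub w G, hGae] with x hx hx'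
    rw [hx, Pi.sub_apply, hx']
    exact norm_le_pi_norm (F x - g x) ⟨w, hw⟩
  rw [← hP]
  -- As `P` fixes `G` and is a contraction, the error is at most `2 * ‖w - G‖`; hence the precision
  -- `ε / 2` for the simple function.
  have h1 : w - P w = (w - G) - P (w - G) := by rw [map_sub, hPG]; abel
  rw [h1]
  linarith [norm_sub_le (w - G) (P (w - G)), hPn (w - G)]

end LOne

/-! ### The space `ℓ¹(α)` and its unit vectors. -/

section EllOneSpace

variable {α : Type*}

/-- The space `ℓ¹(α)`. -/
abbrev L1 (α : Type*) : Type _ := lp (fun _ : α => ℂ) 1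

theorem L1.norm_eq (f : L1 α) : ‖f‖ = ∑' n, ‖f n‖ := by
  rw [lp.norm_eq_tsum_rpow (by simp)]
  simp

theorem L1.summable (f : L1 α) : Summable fun n => ‖f n‖ := by
  simpa using (lp.memℓp f).summable (by simp)

variable [DecidableEq α]

/-- The unit vectors of `ℓ¹`. -/
def L1.unit (n : α) : L1 α := lp.single 1 n (1 : ℂ)

theorem L1.unit_apply (n m : α) : L1.unit n m = if m = n then 1 else 0 := by
  simp [L1.unit, lp.single_apply, Pi.single_apply]

theorem L1.norm_unit (n : α) : ‖L1.unit n‖ = 1 := by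
  simp [L1.unit, lp.norm_single]

theorem L1.hasSum_unit (f : L1 α) : HasSum (fun n => f n • L1.unit n) f := by
  convert lp.hasSum_single (by simp) f using 2 with n
  rw [L1.unit, ← lp.single_smul, smul_eq_mul, mul_one]

variable {Y : Type*} [NormedAddCommGroup Y] [NormedSpace ℂ Y]

theorem L1.hom_ext {f g : L1 α →L[ℂ] Y} (h : ∀ n, f (L1.unit n) = g (L1.unit n)) : f = g := by
  ext x
  have h1 := (L1.hasSum_unit x).mapL f
  have h2 := (L1.hasSum_unit x).mapL g
  simp only [map_smul, h] at h1 h2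
  exact h1.unique h2

omit [DecidableEq α] in
theorem L1.summable_smul [CompleteSpace Y] (y : α → Y) (C : ℝ) (hy : ∀ n, ‖y n‖ ≤ C) (f : L1 α) :
    Summable fun n => f n • y n := by
  refine Summable.of_norm_bounded ((L1.summable f).mul_right C) fun n => ?_
  rw [norm_smul]
  exact mul_le_mul_of_nonneg_left (hy n) (norm_nonneg _)

/-- The bounded linear map on `ℓ¹` given by a bounded family. -/
def L1.lift [CompleteSpace Y] (y : α → Y) (C : ℝ) (hy : ∀ n, ‖y n‖ ≤ C) : L1 α →L[ℂ] Y :=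
  LinearMap.mkContinuous
    { toFun := fun f => ∑' n, f n • y n
      map_add' := fun f g => by
        rw [← (L1.summable_smul y C hy f).tsum_add (L1.summable_smul y C hy g)]
        exact tsum_congr fun n => add_smul _ _ _
      map_smul' := fun c f => by
        rw [RingHom.id_apply, ← (L1.summable_smul y C hy f).tsum_const_smul]
        exact tsum_congr fun n => mul_smul _ _ _ } C fun f => by
    refine tsum_of_norm_bounded ((L1.norm_eq f ▸ (L1.summable f).hasSum).mul_left C) fun n => ?_
    rw [norm_smul, mul_comm]
    exact mul_le_mul_of_nonneg_right (hy n) (norm_nonneg _)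

omit [DecidableEq α] in
theorem L1.norm_lift_le [CompleteSpace Y] (y : α → Y) (C : ℝ) (hy : ∀ n, ‖y n‖ ≤ C) (f : L1 α) :
    ‖L1.lift y C hy f‖ ≤ C * ‖f‖ := by
  refine tsum_of_norm_bounded ((L1.norm_eq f ▸ (L1.summable f).hasSum).mul_left C) fun n => ?_
  rw [norm_smul, mul_comm]
  exact mul_le_mul_of_nonneg_right (hy n) (norm_nonneg _)

@[simp]
theorem L1.lift_unit [CompleteSpace Y] (y : α → Y) (C : ℝ) (hy : ∀ n, ‖y n‖ ≤ C) (n : α) :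
    L1.lift y C hy (L1.unit n) = y n := by
  change ∑' m, L1.unit n m • y m = y n
  rw [tsum_eq_single n fun m hm => by rw [L1.unit_apply, if_neg hm, zero_smul], L1.unit_apply,
    if_pos rfl, one_smul]

omit [DecidableEq α] in
-- Truncation to a large finite set of coordinates is a contraction that factors through a
-- finite-dimensional `ℓ¹`.
theorem hasL1Approx_L1 : HasL1Approx (L1 α) := by
  classical
  refine HasL1Approx.of_fintype 1 fun S ε hε => ?_
  have h : ∀ᶠ t : Finset α in Filter.atTop, ∀ w ∈ S, ‖w - ∑ n ∈ t, w n • L1.unit n‖ ≤ ε := by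
    rw [Filter.eventually_all_finset]
    intro w _
    have := Metric.tendsto_nhds.1 (L1.hasSum_unit w) ε hε
    filter_upwards [this] with t ht
    rw [dist_comm, dist_eq_norm] at ht
    exact ht.le
  obtain ⟨t, ht⟩ := h.exists
  refine ⟨t, inferInstance, fun n => lp.evalCLM ℂ (fun _ : α => ℂ) 1 n.1, fun n => L1.unit n.1,
    fun n => (L1.norm_unit n.1).le, fun w => ?_, fun w hw => ?_⟩
  · rw [one_mul, L1.norm_eq]
    refine (Finset.sum_coe_sort t fun n => ‖w n‖).trans_le ?_
    exact (L1.summable w).sum_le_tsum t fun _ _ => norm_nonneg _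
  · refine le_of_eq_of_le ?_ (ht w hw)
    rw [← Finset.sum_coe_sort t fun n => w n • L1.unit n]
    rfl

end EllOneSpace

/-! ### Projective tensor products and finite sums of `ℓ¹` spaces. -/

section EllOneTensor

/-- Mutually inverse contractions form a linear isometric equivalence. -/
def isometryOfContractions {E F : Type*} [SeminormedAddCommGroup E] [NormedSpace ℂ E]
    [SeminormedAddCommGroup F] [NormedSpace ℂ F] (S : E →L[ℂ] F) (T : F →L[ℂ] E)
    (hS : ∀ x, ‖S x‖ ≤ ‖x‖) (hT : ∀ y, ‖T y‖ ≤ ‖y‖) (hTS : ∀ x, T (S x) = x)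
    (hST : ∀ y, S (T y) = y) : E ≃ₗᵢ[ℂ] F where
  toLinearEquiv := LinearEquiv.ofLinearMap S.toLinearMap T.toLinearMap
    (LinearMap.ext hST) (LinearMap.ext hTS)
  norm_map' x := le_antisymm (hS x) (by
    conv_lhs => rw [← hTS x]
    exact hT (S x))

/-- Reindexing of `ℓ¹`. -/
def L1.congr {α β : Type*} [DecidableEq α] [DecidableEq β] (e : α ≃ β) : L1 α ≃ₗᵢ[ℂ] L1 β :=
  isometryOfContractions (L1.lift (fun n => L1.unit (e n)) 1 fun _ => (L1.norm_unit _).le)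
    (L1.lift (fun n => L1.unit (e.symm n)) 1 fun _ => (L1.norm_unit _).le)
    (fun x => (L1.norm_lift_le _ _ _ x).trans_eq (one_mul _))
    (fun x => (L1.norm_lift_le _ _ _ x).trans_eq (one_mul _))
    (fun x => DFunLike.congr_fun (f := L1.lift (fun n => L1.unit (e.symm n)) 1
      (fun _ => (L1.norm_unit _).le) ∘L L1.lift (fun n => L1.unit (e n)) 1
        (fun _ => (L1.norm_unit _).le)) (g := ContinuousLinearMap.id ℂ _)
      (L1.hom_ext fun n => by simp) x)
    (fun x => DFunLike.congr_fun (f := L1.lift (fun n => L1.unit (e n)) 1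
      (fun _ => (L1.norm_unit _).le) ∘L L1.lift (fun n => L1.unit (e.symm n)) 1
        (fun _ => (L1.norm_unit _).le)) (g := ContinuousLinearMap.id ℂ _)
      (L1.hom_ext fun n => by simp) x)

theorem L1.congr_unit {α β : Type*} [DecidableEq α] [DecidableEq β] (e : α ≃ β) (n : α) :
    L1.congr e (L1.unit n) = L1.unit (e n) :=
  L1.lift_unit (fun n => L1.unit (e n)) 1 (fun _ => (L1.norm_unit _).le) n

theorem L1.congr_apply {α β : Type*} [DecidableEq α] [DecidableEq β] (e : α ≃ β) (f : L1 α)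
    (n : α) : L1.congr e f (e n) = f n := by
  have h : lp.evalCLM ℂ (fun _ : β => ℂ) 1 (e n) ∘L
      (L1.congr e).toContinuousLinearEquiv.toContinuousLinearMap =
      lp.evalCLM ℂ (fun _ : α => ℂ) 1 n := by
    refine L1.hom_ext fun m => ?_
    change L1.congr e (L1.unit m) (e n) = L1.unit m n
    rw [L1.congr_unit, L1.unit_apply, L1.unit_apply]
    simp
  exact DFunLike.congr_fun h f

variable {ι : Type*} [Fintype ι] {κ : ι → Type*}

theorem summable_prod_of_summable (f : ∀ j, κ j → ℝ) (h0 : ∀ j n, 0 ≤ f j n)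
    (hf : ∀ j, Summable (f j)) :
    Summable (fun n : ∀ j, κ j => ∏ j, f j (n j)) ∧
      ∑' n : ∀ j, κ j, ∏ j, f j (n j) ≤ ∏ j, ∑' n, f j n := by
  classical
  have hle : ∀ s : Finset (∀ j, κ j), ∑ n ∈ s, ∏ j, f j (n j) ≤ ∏ j, ∑' n, f j n := by
    intro s
    calc ∑ n ∈ s, ∏ j, f j (n j)
        -- A finite set of multi-indices lies in the box spanned by its projections, over which the
        -- sum factors.
        ≤ ∑ n ∈ Fintype.piFinset fun j => s.image fun n => n j, ∏ j, f j (n j) := by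
          refine Finset.sum_le_sum_of_subset_of_nonneg (fun n hn => ?_) fun n _ _ =>
            Finset.prod_nonneg fun j _ => h0 j _
          exact Fintype.mem_piFinset.2 fun j => Finset.mem_image_of_mem _ hn
      _ = ∏ j, ∑ n ∈ s.image fun n => n j, f j n := (Finset.prod_univ_sum _ _).symm
      _ ≤ ∏ j, ∑' n, f j n := Finset.prod_le_prod
          (fun j _ => Finset.sum_nonneg fun n _ => h0 j n)
          fun j _ => (hf j).sum_le_tsum _ fun n _ => h0 j n
  have h0' : ∀ n : ∀ j, κ j, 0 ≤ ∏ j, f j (n j) := fun n => Finset.prod_nonneg fun j _ => h0 j _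
  have hs := summable_of_sum_le h0' hle
  exact ⟨hs, hs.tsum_le_of_sum_le hle⟩

variable {E : ι → Type*} [∀ j, SeminormedAddCommGroup (E j)] [∀ j, NormedSpace ℂ (E j)]
variable (c : ∀ j, E j ≃ₗᵢ[ℂ] L1 (κ j))

theorem prod_coord_summable (m : ∀ j, E j) :
    Summable (fun n : ∀ j, κ j => ‖∏ j, c j (m j) (n j)‖) ∧
      ∑' n : ∀ j, κ j, ‖∏ j, c j (m j) (n j)‖ ≤ ∏ j, ‖m j‖ := by
  have h := summable_prod_of_summable (fun j n => ‖c j (m j) n‖) (fun _ _ => norm_nonneg _)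
    fun j => L1.summable _
  simp only [norm_prod]
  refine ⟨h.1, h.2.trans_eq (Finset.prod_congr rfl fun j _ => ?_)⟩
  rw [← L1.norm_eq, (c j).norm_map]

/-- The bounded multilinear map `m ↦ (n ↦ ∏ j, m j (n j))`. -/
def prodCoord : ContinuousMultilinearMap ℂ E (L1 (∀ j, κ j)) :=
  MultilinearMap.mkContinuous
    { toFun := fun m => ⟨fun n => ∏ j, c j (m j) (n j),
        memℓp_gen (by simpa using (prod_coord_summable c m).1)⟩
      map_update_add' := by
        intro _ m j x y
        ext n
        exact ((MultilinearMap.mkPiAlgebra ℂ ι ℂ).compLinearMap fun j =>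
          (lp.evalₗ (𝕜 := ℂ) (fun _ : κ j => ℂ) 1 (n j)) ∘ₗ
            (c j).toLinearEquiv.toLinearMap).map_update_add m j x y
      map_update_smul' := by
        intro _ m j r x
        ext n
        exact ((MultilinearMap.mkPiAlgebra ℂ ι ℂ).compLinearMap fun j =>
          (lp.evalₗ (𝕜 := ℂ) (fun _ : κ j => ℂ) 1 (n j)) ∘ₗ
            (c j).toLinearEquiv.toLinearMap).map_update_smul m j r x } 1 (by
    intro m
    rw [one_mul, L1.norm_eq]
    exact (prod_coord_summable c m).2)

theorem prodCoord_apply (m : ∀ j, E j) (n : ∀ j, κ j) :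
    prodCoord c m n = ∏ j, c j (m j) (n j) := rfl

variable [∀ j, DecidableEq (κ j)]

theorem prodCoord_unit [DecidableEq (∀ j, κ j)] (n : ∀ j, κ j) :
    prodCoord c (fun j => (c j).symm (L1.unit (n j))) = L1.unit n := by
  ext m
  rw [prodCoord_apply, L1.unit_apply]
  simp only [LinearIsometryEquiv.apply_symm_apply, L1.unit_apply]
  by_cases h : m = n
  · simp [h]
  · rw [if_neg h]
    obtain ⟨j, hj⟩ := Function.ne_iff.1 h
    exact Finset.prod_eq_zero (Finset.mem_univ j) (if_neg hj)

theorem norm_elem_unit_le (n : ∀ j, κ j) :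
    ‖(elem fun j => (c j).symm (L1.unit (n j)) : ProjTensor E)‖ ≤ 1 := by
  refine (norm_elem_le _).trans_eq (Finset.prod_eq_one fun j _ => ?_)
  rw [LinearIsometryEquiv.norm_map, L1.norm_unit]

/-- The bounded linear map with `unit n ↦ ⨂ unit (n j)`. -/
def ofUnits : L1 (∀ j, κ j) →L[ℂ] ProjTensor E :=
  L1.lift (fun n => elem fun j => (c j).symm (L1.unit (n j))) 1 (norm_elem_unit_le c)

theorem ofUnits_unit [DecidableEq (∀ j, κ j)] (n : ∀ j, κ j) :
    ofUnits c (L1.unit n) = elem fun j => (c j).symm (L1.unit (n j)) :=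
  L1.lift_unit _ _ (norm_elem_unit_le c) n

/-- Both sides are bounded and multilinear on tuples, and the unit vectors determine bounded linear
maps on each factor; on tuples of unit vectors the identity is `prodCoord_unit`. -/
theorem ofUnits_lift_prodCoord (x : ProjTensor E) :
    ofUnits c (ProjTensor.lift (prodCoord c) x) = x := by
  classical
  have h : (ofUnits c).compContinuousMultilinearMap (prodCoord c) = elemL E := by
    refine continuousMultilinearMap_ext
      (fun j => Set.range fun n => (c j).symm (L1.unit n)) (fun j φ ψ h => ?_) fun m hm => ?_
    · have h1 : φ ∘L (c j).symm.toContinuousLinearEquiv.toContinuousLinearMap =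
          ψ ∘L (c j).symm.toContinuousLinearEquiv.toContinuousLinearMap :=
        L1.hom_ext fun n => h _ ⟨n, rfl⟩
      ext z
      simpa using DFunLike.congr_fun h1 (c j z)
    · choose n hn using hm
      obtain rfl : (fun j => (c j).symm (L1.unit (n j))) = m := funext hn
      rw [ContinuousLinearMap.compContinuousMultilinearMap_coe, Function.comp_apply,
        prodCoord_unit, ofUnits_unit, elemL_apply]
  have h1 : ofUnits c ∘L ProjTensor.lift (prodCoord c) = ContinuousLinearMap.id ℂ _ := by
    refine ProjTensor.hom_ext fun m => ?_
    rw [ContinuousLinearMap.comp_apply, ProjTensor.lift_elem]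
    exact (DFunLike.congr_fun h m).trans (elemL_apply m)
  exact DFunLike.congr_fun h1 x

theorem lift_prodCoord_ofUnits (y : L1 (∀ j, κ j)) :
    ProjTensor.lift (prodCoord c) (ofUnits c y) = y := by
  classical
  have h1 : ProjTensor.lift (prodCoord c) ∘L ofUnits c = ContinuousLinearMap.id ℂ _ :=
    L1.hom_ext fun n => by
      rw [ContinuousLinearMap.comp_apply, ofUnits_unit, ProjTensor.lift_elem, prodCoord_unit]
      rfl
  exact DFunLike.congr_fun h1 y

/-- The projective tensor product of `ℓ¹` spaces is the `ℓ¹` space of the product. -/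
def tensorL1 : ProjTensor E ≃ₗᵢ[ℂ] L1 (∀ j, κ j) :=
  isometryOfContractions (ProjTensor.lift (prodCoord c)) (ofUnits c)
    (fun x => (ProjTensor.norm_lift_apply_le _ x).trans (mul_le_of_le_one_left (norm_nonneg _)
      (MultilinearMap.mkContinuous_norm_le _ zero_le_one _)))
    (fun x => (L1.norm_lift_le _ _ (norm_elem_unit_le c) x).trans_eq (one_mul _))
    (ofUnits_lift_prodCoord c) (lift_prodCoord_ofUnits c)

theorem tensorL1_elem (m : ∀ j, E j) (n : ∀ j, κ j) :
    tensorL1 c (elem m) n = ∏ j, c j (m j) (n j) :=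
  congrArg (fun f : L1 (∀ j, κ j) => f n) (ProjTensor.lift_elem (prodCoord c) m)

theorem tensorL1_unit [DecidableEq (∀ j, κ j)] (n : ∀ j, κ j) :
    tensorL1 c (elem fun j => (c j).symm (L1.unit (n j))) = L1.unit n :=
  (ProjTensor.lift_elem (prodCoord c) _).trans (prodCoord_unit c n)

/-- A finite power of `ℓ¹(κ)` is isomorphic to `ℓ¹(ι × κ)`. -/
def piL1 (ι κ : Type*) [Fintype ι] [DecidableEq ι] [DecidableEq κ] :
    (ι → L1 κ) ≃L[ℂ] L1 (ι × κ) :=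
  let T : L1 (ι × κ) →L[ℂ] (ι → L1 κ) :=
    L1.lift (fun n => Pi.single n.1 (L1.unit n.2)) 1 fun n => by
      rw [pi_norm_le_iff_of_nonneg zero_le_one]
      intro i
      by_cases h : i = n.1
      · subst h; simp [L1.norm_unit]
      · simp [h]
  let S : (ι → L1 κ) →L[ℂ] L1 (ι × κ) :=
    ∑ i, L1.lift (fun n => L1.unit (i, n)) 1 (fun _ => (L1.norm_unit _).le) ∘L
      ContinuousLinearMap.proj i
  have hT : ∀ n, T (L1.unit n) = Pi.single n.1 (L1.unit n.2) := fun n => L1.lift_unit _ _ _ _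
  have hS : ∀ f, S f = ∑ i, L1.lift (fun n => L1.unit (i, n)) 1
      (fun _ => (L1.norm_unit _).le) (f i) := fun f => by simp [S]
  ContinuousLinearEquiv.equivOfInverse S T
    (fun f => by
      rw [hS, map_sum]
      have h : ∀ i, T ∘L L1.lift (fun n => L1.unit (i, n)) 1 (fun _ => (L1.norm_unit _).le) =
          ContinuousLinearMap.single ℂ (fun _ : ι => L1 κ) i := fun i =>
        L1.hom_ext fun n => by
          rw [ContinuousLinearMap.comp_apply, L1.lift_unit, hT]
          rfl
      refine (Finset.sum_congr rfl fun i _ => DFunLike.congr_fun (h i) (f i)).trans ?_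
      exact Finset.univ_sum_single f)
    (fun y => DFunLike.congr_fun (f := S ∘L T) (g := ContinuousLinearMap.id ℂ _)
      (L1.hom_ext fun n => by
        rw [ContinuousLinearMap.comp_apply, hT, hS, Finset.sum_eq_single n.1]
        · simp
        · intro i _ hi
          rw [Pi.single_eq_of_ne hi, map_zero]
        · simp) y)

end EllOneTensor

/-! ### Monomials in the convolution algebra. -/

namespace EllOne

variable (σ : Type)

/-- `equivLp` as a linear isometry. -/
def isoL1 : EllOne σ ≃ₗᵢ[ℂ] L1 (σ →₀ ℕ) where
  toLinearEquiv := equivLp σ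
  norm_map' _ := rfl

variable {σ}

theorem isoL1_apply (f : EllOne σ) (n : σ →₀ ℕ) : isoL1 σ f n = f.coeff n := rfl

variable [DecidableEq σ]

/-- Monomials. -/
def mon (n : σ →₀ ℕ) : EllOne σ := (isoL1 σ).symm (L1.unit n)

theorem norm_mon (n : σ →₀ ℕ) : ‖mon n‖ = 1 := by
  rw [mon, LinearIsometryEquiv.norm_map, L1.norm_unit]

theorem isoL1_mon (n : σ →₀ ℕ) : isoL1 σ (mon n) = L1.unit n :=
  LinearIsometryEquiv.apply_symm_apply _ _

theorem coeff_mon (n m : σ →₀ ℕ) : (mon n).coeff m = if m = n then 1 else 0 := by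
  rw [← isoL1_apply, isoL1_mon, L1.unit_apply]

theorem val_mon (n : σ →₀ ℕ) : (mon n).1 = MvPowerSeries.monomial n (1 : ℂ) := by
  ext m
  rw [MvPowerSeries.coeff_monomial]
  exact coeff_mon n m

theorem mon_mul_mon (n m : σ →₀ ℕ) : mon n * mon m = mon (n + m) := by
  refine Subtype.ext ?_
  change (mon n).1 * (mon m).1 = (mon (n + m)).1
  rw [val_mon, val_mon, val_mon, MvPowerSeries.monomial_mul_monomial, one_mul]

theorem mon_zero : mon (0 : σ →₀ ℕ) = 1 := by
  refine Subtype.ext ?_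
  change (mon 0).1 = 1
  rw [val_mon, MvPowerSeries.monomial_zero_one]

theorem hom_ext {Y : Type*} [NormedAddCommGroup Y] [NormedSpace ℂ Y] {f g : EllOne σ →L[ℂ] Y}
    (h : ∀ n, f (mon n) = g (mon n)) : f = g := by
  have h1 : f ∘L (isoL1 σ).symm.toContinuousLinearEquiv.toContinuousLinearMap =
      g ∘L (isoL1 σ).symm.toContinuousLinearEquiv.toContinuousLinearMap :=
    L1.hom_ext h
  ext z
  simpa using DFunLike.congr_fun h1 (isoL1 σ z)

end EllOne

theorem hasL1Approx_EllOne (σ : Type) : HasL1Approx (EllOne σ) :=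
  hasL1Approx_L1.of_equiv (EllOne.isoL1 σ).symm.toContinuousLinearEquiv

/-! ### The first Hochschild homology of `ℓ¹(ℤ₊)`. -/

section OneVariable

/-- Powers of the generator. -/
def tpow (n : ℕ) : EllOne Unit := EllOne.mon (Finsupp.single () n)

theorem tpow_mul (m n : ℕ) : tpow m * tpow n = tpow (m + n) := by
  rw [tpow, tpow, tpow, EllOne.mon_mul_mon, Finsupp.single_add]

theorem tpow_eq (n : Unit →₀ ℕ) : EllOne.mon n = tpow (n ()) := by
  rw [tpow]
  congr 1
  ext
  simp

theorem norm_tpow (n : ℕ) : ‖tpow n‖ = 1 := EllOne.norm_mon _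

theorem chain_tpow_ext {Y : Type*} [NormedAddCommGroup Y] [NormedSpace ℂ Y] {n : ℕ}
    {f g : Chain (EllOne Unit) n →L[ℂ] Y}
    (h : ∀ a : Fin (n + 1) → ℕ, f (Chain.tensor fun l => tpow (a l)) =
      g (Chain.tensor fun l => tpow (a l))) : f = g := by
  have h1 : f.compContinuousMultilinearMap (elemL fun _ : Fin (n + 1) => EllOne Unit) =
      g.compContinuousMultilinearMap (elemL fun _ : Fin (n + 1) => EllOne Unit) := by
    refine continuousMultilinearMap_ext (fun _ => Set.range tpow)
      (fun _ φ ψ hφ => EllOne.hom_ext fun n => hφ _ ⟨n (), (tpow_eq n).symm⟩) fun m hm => ?_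
    choose a ha using hm
    obtain rfl : (fun l => tpow (a l)) = m := funext ha
    change f (elemL _ _) = g (elemL _ _)
    rw [elemL_apply]
    exact h a
  refine Chain.hom_ext fun m => ?_
  have h2 := DFunLike.congr_fun h1 m
  change f (elemL _ _) = g (elemL _ _) at h2
  rwa [elemL_apply] at h2

/-- Elementary 1-chains `tᵐ ⊗ tⁿ`. -/
def cell₁ (m n : ℕ) : Chain (EllOne Unit) 1 := Chain.tensor ![tpow m, tpow n]

/-- Elementary 2-chains `tᵐ ⊗ tᵃ ⊗ tᵇ`. -/
def cell₂ (m a b : ℕ) : Chain (EllOne Unit) 2 := Chain.tensor ![tpow m, tpow a, tpow b]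

theorem norm_cell₁_le (m n : ℕ) : ‖cell₁ m n‖ ≤ 1 := by
  refine (Chain.norm_tensor_le _).trans_eq ?_
  simp [Fin.prod_univ_succ, norm_tpow]

theorem norm_cell₂_le (m a b : ℕ) : ‖cell₂ m a b‖ ≤ 1 := by
  refine (Chain.norm_tensor_le _).trans_eq ?_
  simp [Fin.prod_univ_succ, norm_tpow]

theorem boundary₁L_cell₂ (m a b : ℕ) : boundary₁L (EllOne Unit) (cell₂ m a b) =
    cell₁ (m + a) b - cell₁ m (a + b) + cell₁ (b + m) a := by
  rw [cell₂, boundary₁L_tensor, tpow_mul, tpow_mul, tpow_mul]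
  rfl

theorem cell₁_ext {Y : Type*} [NormedAddCommGroup Y] [NormedSpace ℂ Y]
    {f g : Chain (EllOne Unit) 1 →L[ℂ] Y} (h : ∀ m n, f (cell₁ m n) = g (cell₁ m n)) : f = g := by
  refine chain_tpow_ext fun a => ?_
  have : (fun l => tpow (a l)) = ![tpow (a 0), tpow (a 1)] := by ext l; fin_cases l <;> rfl
  rw [this]
  exact h _ _

theorem cell₂_ext {Y : Type*} [NormedAddCommGroup Y] [NormedSpace ℂ Y]
    {f g : Chain (EllOne Unit) 2 →L[ℂ] Y}
    (h : ∀ m a b, f (cell₂ m a b) = g (cell₂ m a b)) : f = g := by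
  refine chain_tpow_ext fun a => ?_
  have : (fun l => tpow (a l)) = ![tpow (a 0), tpow (a 1), tpow (a 2)] := by
    ext l; fin_cases l <;> rfl
  rw [this]
  exact h _ _ _

variable {Y : Type*} [NormedAddCommGroup Y] [NormedSpace ℂ Y] [CompleteSpace Y]

/-- The bounded linear map on 1-chains of `ℓ¹(ℤ₊)` given by a bounded double sequence. -/
def cellLift (y : ℕ → ℕ → Y) (C : ℝ) (hy : ∀ m n, ‖y m n‖ ≤ C) : Chain (EllOne Unit) 1 →L[ℂ] Y :=
  L1.lift (fun n : Fin 2 → Unit →₀ ℕ => y (n 0 ()) (n 1 ())) C (fun _ => hy _ _) ∘L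
    (tensorL1 fun _ : Fin 2 => EllOne.isoL1 Unit).toContinuousLinearEquiv.toContinuousLinearMap

theorem cellLift_cell₁ (y : ℕ → ℕ → Y) (C : ℝ) (hy : ∀ m n, ‖y m n‖ ≤ C) (m n : ℕ) :
    cellLift y C hy (cell₁ m n) = y m n := by
  have h : cell₁ m n = elem fun j : Fin 2 => (EllOne.isoL1 Unit).symm
      (L1.unit (Finsupp.single () (![m, n] j))) := by
    refine congrArg (elem (E := fun _ : Fin 2 => EllOne Unit)) ?_
    ext j
    fin_cases j <;> rfl
  have h1 := congrArg (L1.lift (fun n : Fin 2 → Unit →₀ ℕ => y (n 0 ()) (n 1 ())) C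
    (fun _ => hy _ _)) ((congrArg (tensorL1 fun _ : Fin 2 => EllOne.isoL1 Unit) h).trans
      (tensorL1_unit (fun _ : Fin 2 => EllOne.isoL1 Unit)
        fun j => Finsupp.single () (![m, n] j)))
  refine h1.trans ((L1.lift_unit _ _ _ _).trans ?_)
  simp

/-- A 2-chain whose boundary is `tᵐ ⊗ tⁿ - n / (m + n) • 1 ⊗ tᵐ⁺ⁿ`. -/
def cellHomotopy (m n : ℕ) : Chain (EllOne Unit) 2 :=
  if m + n = 0 then cell₂ 0 0 0 else
    ((m + n : ℕ) : ℂ)⁻¹ • (∑ b ∈ Finset.range m, cell₂ (m - b) n b +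
      ∑ e ∈ Finset.range n, (cell₂ 0 n m - cell₂ (n - e) m e))

/-- The sum contains `m + 2 n` cells and is divided by `m + n`. A bound uniform in `m` and `n` is
what allows the homotopy to extend to all 1-chains. -/
theorem norm_cellHomotopy_le (m n : ℕ) : ‖cellHomotopy m n‖ ≤ 2 := by
  rw [cellHomotopy]
  split_ifs with h
  · exact (norm_cell₂_le _ _ _).trans one_le_two
  · have hpos : (0 : ℝ) < (m + n : ℕ) := by exact_mod_cast Nat.pos_of_ne_zero h
    rw [norm_smul, norm_inv, Complex.norm_natCast, inv_mul_le_iff₀ hpos]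
    have h1 : ‖∑ b ∈ Finset.range m, cell₂ (m - b) n b‖ ≤ m := by
      refine (norm_sum_le_of_le _ fun b _ => norm_cell₂_le _ _ _).trans_eq ?_
      simp
    have h2 : ‖∑ e ∈ Finset.range n, (cell₂ 0 n m - cell₂ (n - e) m e)‖ ≤ n * 2 := by
      refine (norm_sum_le_of_le _ fun e _ => (norm_sub_le _ _).trans
        (add_le_add (norm_cell₂_le _ _ _) (norm_cell₂_le _ _ _))).trans_eq ?_
      simp [one_add_one_eq_two]
    refine (norm_add_le_of_le h1 h2).trans ?_
    push_cast
    nlinarith [Nat.cast_nonneg (α := ℝ) m]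

theorem boundary₁L_cellHomotopy (m n : ℕ) : boundary₁L (EllOne Unit) (cellHomotopy m n) =
    cell₁ m n - ((n : ℂ) / (m + n : ℕ)) • cell₁ 0 (m + n) := by
  rw [cellHomotopy]
  split_ifs with h
  · obtain ⟨rfl, rfl⟩ : m = 0 ∧ n = 0 := by omega
    rw [boundary₁L_cell₂]
    simp
  · have hne : ((m + n : ℕ) : ℂ) ≠ 0 := by exact_mod_cast h
    -- All cells of total degree `m + n`. The unwanted terms are sums of `W` over two decompositions
    -- of the range `m + n`, as `m` then `n` and as `n` then `m`, with opposite signs, so they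
    -- cancel.
    let W : ℕ → Chain (EllOne Unit) 1 := fun b => cell₁ (m + n - b) b
    have h1 : ∑ b ∈ Finset.range m, boundary₁L (EllOne Unit) (cell₂ (m - b) n b) =
        ∑ b ∈ Finset.range m, W b - ∑ b ∈ Finset.range m, W (n + b) + (m : ℂ) • cell₁ m n := by
      have : ∀ b ∈ Finset.range m, boundary₁L (EllOne Unit) (cell₂ (m - b) n b) =
          W b - W (n + b) + cell₁ m n := by
        intro b hb
        have hb := Finset.mem_range.1 hb
        rw [boundary₁L_cell₂]
        simp only [W]
        rw [show m - b + n = m + n - b by omega, show m + n - (n + b) = m - b by omega,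
          show b + (m - b) = m by omega]
      rw [Finset.sum_congr rfl this, Finset.sum_add_distrib, Finset.sum_sub_distrib,
        Finset.sum_const, Finset.card_range, Nat.cast_smul_eq_nsmul]
    have h2 : ∑ e ∈ Finset.range n, boundary₁L (EllOne Unit) (cell₂ 0 n m - cell₂ (n - e) m e) =
        (n : ℂ) • cell₁ m n - (n : ℂ) • cell₁ 0 (m + n) - ∑ e ∈ Finset.range n, W e +
          ∑ e ∈ Finset.range n, W (m + e) := by
      have : ∀ e ∈ Finset.range n, boundary₁L (EllOne Unit) (cell₂ 0 n m - cell₂ (n - e) m e) =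
          cell₁ m n - cell₁ 0 (m + n) - W e + W (m + e) := by
        intro e he
        have he := Finset.mem_range.1 he
        rw [map_sub, boundary₁L_cell₂, boundary₁L_cell₂]
        simp only [W]
        rw [show n - e + m = m + n - e by omega, show m + n - (m + e) = n - e by omega,
          show e + (n - e) = n by omega, show 0 + n = n by omega, show m + 0 = m by omega,
          add_comm n m]
        abel
      rw [Finset.sum_congr rfl this, Finset.sum_add_distrib, Finset.sum_sub_distrib,
        Finset.sum_sub_distrib, Finset.sum_const, Finset.sum_const, Finset.card_range,
        Nat.cast_smul_eq_nsmul, Nat.cast_smul_eq_nsmul]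
    have h3 := Finset.sum_range_add W m n
    have h4 := Finset.sum_range_add W n m
    rw [add_comm n m, h3] at h4
    rw [map_smul, map_add, map_sum, map_sum, h1, h2]
    have h5 : ∑ b ∈ Finset.range m, W b - ∑ b ∈ Finset.range m, W (n + b) + (m : ℂ) • cell₁ m n +
        ((n : ℂ) • cell₁ m n - (n : ℂ) • cell₁ 0 (m + n) - ∑ e ∈ Finset.range n, W e +
          ∑ e ∈ Finset.range n, W (m + e)) =
        ((m + n : ℕ) : ℂ) • cell₁ m n - (n : ℂ) • cell₁ 0 (m + n) := by
      rw [Nat.cast_add, add_smul]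
      linear_combination h4
    rw [h5, smul_sub, smul_smul, smul_smul, inv_mul_cancel₀ hne, one_smul, div_eq_inv_mul]

/-- The coefficients of a class: `tᵐ ⊗ tⁿ` is sent to `n / (m + n)` times the class of
`1 ⊗ tᵐ⁺ⁿ`. -/
def cellCoeff : Chain (EllOne Unit) 1 →L[ℂ] L1 ℕ :=
  -- The basis vector of index `r` stands for the class of `1 ⊗ tʳ⁺¹`, whence the shift. In degree
  -- zero the coefficient is `0 / 0 = 0`, so the truncated subtraction does no harm.
  cellLift (fun m n => ((n : ℂ) / (m + n : ℕ)) • L1.unit (m + n - 1)) 1 fun m n => by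
    rw [norm_smul, L1.norm_unit, mul_one, norm_div, Complex.norm_natCast, Complex.norm_natCast]
    exact div_le_one_of_le₀ (by exact_mod_cast Nat.le_add_left n m) (Nat.cast_nonneg _)

theorem cellCoeff_cell₁ (m n : ℕ) :
    cellCoeff (cell₁ m n) = ((n : ℂ) / (m + n : ℕ)) • L1.unit (m + n - 1) :=
  cellLift_cell₁ _ _ _ _ _

/-- The section of `cellCoeff`. -/
def cellSection : L1 ℕ →L[ℂ] Chain (EllOne Unit) 1 :=
  L1.lift (fun n => cell₁ 0 (n + 1)) 1 fun _ => norm_cell₁_le _ _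

theorem cellSection_unit (n : ℕ) : cellSection (L1.unit n) = cell₁ 0 (n + 1) :=
  L1.lift_unit _ _ _ _

/-- The first Hochschild homology of `ℓ¹(ℤ₊)`. -/
theorem hh1_ellOne_unit :
    IsBanach (HH1 (EllOne Unit)) ∧ Nonempty (HH1 (EllOne Unit) ≃L[ℂ] L1 ℕ) := by
  have hsec : ∀ y, cellCoeff (cellSection y) = y := by
    have h : cellCoeff ∘L cellSection = ContinuousLinearMap.id ℂ (L1 ℕ) := L1.hom_ext fun n => by
      rw [ContinuousLinearMap.comp_apply, cellSection_unit, cellCoeff_cell₁, zero_add,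
        div_self (by exact_mod_cast n.succ_ne_zero), one_smul]
      rfl
    exact DFunLike.congr_fun h
  have hb : ∀ w, cellCoeff (boundary₁L (EllOne Unit) w) = 0 := by
    -- The three faces have the same total degree `m + a + b`, with coefficients proportional to
    -- `b`, `-(a + b)` and `a`.
    have h : cellCoeff ∘L boundary₁L (EllOne Unit) = 0 := cell₂_ext fun m a b => by
      rw [ContinuousLinearMap.comp_apply, boundary₁L_cell₂, map_add, map_sub, cellCoeff_cell₁,
        cellCoeff_cell₁, cellCoeff_cell₁, show m + (a + b) = m + a + b by ring,
        show b + m + a = m + a + b by ring, ← sub_smul, ← add_smul, Nat.cast_add a b]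
      convert zero_smul ℂ _
      · ring
      · rfl
    exact DFunLike.congr_fun h
  -- A bounded contracting homotopy: modulo boundaries, every chain equals its image under
  -- `cellSection ∘L cellCoeff`, so the kernel of `cellCoeff` consists of boundaries.
  have hh : boundary₁L (EllOne Unit) ∘L cellLift cellHomotopy 2 norm_cellHomotopy_le =
      ContinuousLinearMap.id ℂ (Chain (EllOne Unit) 1) - cellSection ∘L cellCoeff :=
        cell₁_ext fun m n => by
    rw [ContinuousLinearMap.comp_apply, cellLift_cell₁, boundary₁L_cellHomotopy]
    change _ = cell₁ m n - cellSection (cellCoeff (cell₁ m n))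
    rw [cellCoeff_cell₁, map_smul, cellSection_unit]
    by_cases h : m + n = 0
    · obtain ⟨rfl, rfl⟩ : m = 0 ∧ n = 0 := by omega
      simp
    · rw [Nat.sub_add_cancel (Nat.pos_of_ne_zero h)]
  obtain ⟨h1, e, _⟩ := HH1.isBanach_and_exists_equiv cellCoeff
    (fun y => ⟨cellSection y, hsec y⟩) hb fun z hz => by
      refine ⟨cellLift cellHomotopy 2 norm_cellHomotopy_le z, ?_⟩
      refine (DFunLike.congr_fun hh z).trans ?_
      change z - cellSection (cellCoeff z) = z
      rw [hz, map_zero, sub_zero]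
  exact ⟨h1, ⟨e⟩⟩

end OneVariable

/-! ### Identification of `ℓ¹(ℤ₊ᵏ)` with a tensor power, and the underlying Banach space. -/

/-- The decomposition given by an isometric isomorphism. -/
def TensorDecomp.ofAlgEquiv {ι : Type*} [Fintype ι] {A : ι → Type u} [∀ i, NormedCommRing (A i)]
    [∀ i, NormedAlgebra ℂ (A i)] [∀ i, CompleteSpace (A i)]
    {B : Type v} [NormedCommRing B] [NormedAlgebra ℂ B] [CompleteSpace B]
    (Φ : ProjTensor A ≃ₐ[ℂ] B) (h : ∀ t, ‖Φ t‖ = ‖t‖) : TensorDecomp A B where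
  toHom := ⟨Φ, AddMonoidHomClass.continuous_of_bound Φ 1 fun t => by rw [h, one_mul]⟩
  inv := ⟨Φ.symm, AddMonoidHomClass.continuous_of_bound Φ.symm 1 fun b => by
    rw [one_mul, ← h, Φ.apply_symm_apply]⟩
  inv_toHom := Φ.symm_apply_apply
  toHom_inv := Φ.apply_symm_apply

/-- Multi-indices on `Fin k`, as families of one-variable multi-indices. -/
def multiIndexEquiv (k : ℕ) : (Fin k → Unit →₀ ℕ) ≃ (Fin k →₀ ℕ) where
  toFun n := Finsupp.equivFunOnFinite.symm fun i => n i ()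
  invFun n i := Finsupp.single () (n i)
  left_inv n := by ext i; simp
  right_inv n := by ext i; simp

/-- The isometry `ℓ¹(ℤ₊) ⊗̂ ⋯ ⊗̂ ℓ¹(ℤ₊) → ℓ¹(ℤ₊ᵏ)`. -/
def ellOneIso (k : ℕ) : ProjTensor (fun _ : Fin k => EllOne Unit) ≃ₗᵢ[ℂ] EllOne (Fin k) :=
  ((tensorL1 fun _ : Fin k => EllOne.isoL1 Unit).trans (L1.congr (multiIndexEquiv k))).trans
    (EllOne.isoL1 (Fin k)).symm

theorem ellOneIso_elem_coeff (k : ℕ) (f : Fin k → EllOne Unit) (n : Fin k →₀ ℕ) :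
    (ellOneIso k (elem f)).coeff n = ∏ i, (f i).coeff (Finsupp.single () (n i)) := by
  rw [← EllOne.isoL1_apply, ellOneIso]
  simp only [LinearIsometryEquiv.trans_apply, LinearIsometryEquiv.apply_symm_apply]
  obtain ⟨m, rfl⟩ := (multiIndexEquiv k).surjective n
  rw [L1.congr_apply, tensorL1_elem]
  refine Finset.prod_congr rfl fun i _ => ?_
  rw [EllOne.isoL1_apply]
  exact congrArg _ (congrFun ((multiIndexEquiv k).symm_apply_apply m) i).symm

theorem ellOneIso_symm_mon (k : ℕ) (n : Fin k →₀ ℕ) :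
    (ellOneIso k).symm (EllOne.mon n) = elem fun i => tpow (n i) := by
  rw [LinearIsometryEquiv.symm_apply_eq]
  refine (EllOne.isoL1 (Fin k)).injective ?_
  rw [EllOne.isoL1_mon, ellOneIso]
  simp only [LinearIsometryEquiv.trans_apply, LinearIsometryEquiv.apply_symm_apply]
  have h : tensorL1 (fun _ : Fin k => EllOne.isoL1 Unit) (elem fun i => tpow (n i)) =
      L1.unit fun i => Finsupp.single () (n i) :=
    tensorL1_unit (fun _ : Fin k => EllOne.isoL1 Unit) fun i => Finsupp.single () (n i)
  rw [h, L1.congr_unit]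
  exact congrArg _ ((multiIndexEquiv k).apply_symm_apply n).symm

/-- Both sides are bounded and bilinear, so it is enough to compare them on monomials, first in `g`
and then in `f`. -/
theorem ellOneIso_symm_mul (k : ℕ) (f g : EllOne (Fin k)) :
    (ellOneIso k).symm (f * g) = (ellOneIso k).symm f * (ellOneIso k).symm g := by
  let Ψ : EllOne (Fin k) →L[ℂ] ProjTensor (fun _ : Fin k => EllOne Unit) :=
    (ellOneIso k).symm.toContinuousLinearEquiv.toContinuousLinearMap
  have h1 : ∀ n, Ψ ∘L ContinuousLinearMap.mul ℂ _ (EllOne.mon n) =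
      ContinuousLinearMap.mul ℂ _ (Ψ (EllOne.mon n)) ∘L Ψ := fun n =>
    EllOne.hom_ext fun m => by
      change (ellOneIso k).symm (EllOne.mon n * EllOne.mon m) =
        (ellOneIso k).symm (EllOne.mon n) * (ellOneIso k).symm (EllOne.mon m)
      rw [EllOne.mon_mul_mon, ellOneIso_symm_mon, ellOneIso_symm_mon, ellOneIso_symm_mon,
        elem_mul_elem]
      simp only [tpow_mul]
      rfl
  have h2 : Ψ ∘L (ContinuousLinearMap.mul ℂ _).flip g =
      (ContinuousLinearMap.mul ℂ _).flip (Ψ g) ∘L Ψ :=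
    EllOne.hom_ext fun n => DFunLike.congr_fun (h1 n) g
  exact DFunLike.congr_fun h2 f

/-- The isometric algebra isomorphism `ℓ¹(ℤ₊) ⊗̂ ⋯ ⊗̂ ℓ¹(ℤ₊) → ℓ¹(ℤ₊ᵏ)`. -/
def ellOneAlgEquiv (k : ℕ) :
    ProjTensor (fun _ : Fin k => EllOne Unit) ≃ₐ[ℂ] EllOne (Fin k) :=
  (AlgEquiv.ofLinearEquiv (ellOneIso k).symm.toLinearEquiv
    (by
      change (ellOneIso k).symm 1 = 1
      rw [← EllOne.mon_zero, ellOneIso_symm_mon, one_eq_elem]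
      refine congrArg elem (funext fun i => ?_)
      rw [Finsupp.coe_zero, Pi.zero_apply, tpow, Finsupp.single_zero, EllOne.mon_zero])
    (ellOneIso_symm_mul k)).symm

theorem nonempty_factor_equiv_L1 :
    ∀ b, Nonempty (Factor (EllOne Unit) b ≃L[ℂ] L1 ℕ)
  | true => hh1_ellOne_unit.2
  | false => ⟨(EllOne.isoL1 Unit).toContinuousLinearEquiv.trans
      (L1.congr (Finsupp.uniqueEquiv ())).toContinuousLinearEquiv⟩

/-- Every factor is `ℓ¹(ℕ)`, so each summand is `ℓ¹(ℕᵏ)` and the direct sum is `ℓ¹` of `k` copies of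
`ℕᵏ`, an index set that is countably infinite because `k ≥ 1`. -/
theorem nonempty_summands_equiv_L1 (k : ℕ) (hk : 1 ≤ k) :
    Nonempty ((∀ i, Summand (fun _ : Fin k => EllOne Unit) i) ≃L[ℂ] L1 ℕ) := by
  have c := fun b => (nonempty_factor_equiv_L1 b).some
  have e : ∀ i, Summand (fun _ : Fin k => EllOne Unit) i ≃L[ℂ] L1 (Fin k → ℕ) := fun i =>
    (ProjTensor.congr fun j => c (decide (j = i))).trans
      (tensorL1 fun _ : Fin k => LinearIsometryEquiv.refl ℂ (L1 ℕ)).toContinuousLinearEquiv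
  have : Nonempty (Fin k) := ⟨⟨0, hk⟩⟩
  obtain ⟨f⟩ := nonempty_equiv_of_countable (α := Fin k × (Fin k → ℕ)) (β := ℕ)
  exact ⟨((ContinuousLinearEquiv.piCongrRight e).trans (piL1 (Fin k) (Fin k → ℕ))).trans
    (L1.congr f).toContinuousLinearEquiv⟩

end BanachHH
end

theorem corollary5p4 :
    -- the general decomposition
    (∀ (k : ℕ) (A : Fin k → Type u) [∀ i, NormedCommRing (A i)] [∀ i, NormedAlgebra ℂ (A i)]
        [∀ i, CompleteSpace (A i)]
        (X : Fin k → Type v) [∀ i, MeasurableSpace (X i)] (μ : ∀ i, MeasureTheory.Measure (X i)),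
        (∀ i, Nonempty (A i ≃L[ℂ] MeasureTheory.Lp ℂ 1 (μ i))) →
        (∀ i, BanachHH.IsBanach (BanachHH.HH1 (A i))) →
        BanachHH.IsBanach (BanachHH.HH1 (BanachHH.ProjTensor A)) ∧
        Nonempty (BanachHH.HH1 (BanachHH.ProjTensor A) ≃L[BanachHH.ProjTensor A]
          (∀ i, BanachHH.Summand A i))) ∧
    -- the convolution algebras `ℓ¹(ℤ₊ᵏ)`
    (∀ k : ℕ, 1 ≤ k →
      BanachHH.IsBanach (BanachHH.HH1 (BanachHH.EllOne (Fin k))) ∧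
      -- the bimodule structure is symmetric and unit-linked
      (∀ (a : BanachHH.EllOne (Fin k)) (x : BanachHH.HH1 (BanachHH.EllOne (Fin k))),
        MulOpposite.op a • x = a • x) ∧
      (∀ x : BanachHH.HH1 (BanachHH.EllOne (Fin k)), (1 : BanachHH.EllOne (Fin k)) • x = x) ∧
      -- the identification `Φ` of `ℓ¹(ℤ₊) ⊗̂ ⋯ ⊗̂ ℓ¹(ℤ₊)` with `ℓ¹(ℤ₊ᵏ)`, and the isomorphism of
      -- modules over it
      (∃ Φ : BanachHH.ProjTensor (fun _ : Fin k => BanachHH.EllOne Unit) ≃ₐ[ℂ]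
            BanachHH.EllOne (Fin k),
        (∀ t, ‖Φ t‖ = ‖t‖) ∧
        (∀ (f : Fin k → BanachHH.EllOne Unit) (n : Fin k →₀ ℕ),
          (Φ (BanachHH.elem f)).coeff n = ∏ i, (f i).coeff (Finsupp.single () (n i))) ∧
        ∃ e : BanachHH.HH1 (BanachHH.EllOne (Fin k)) ≃L[ℂ]
            (∀ i, BanachHH.Summand (fun _ : Fin k => BanachHH.EllOne Unit) i),
          ∀ a x, e (Φ a • x) = a • e x) ∧
      -- the underlying space is `ℓ¹`
      Nonempty (BanachHH.HH1 (BanachHH.EllOne (Fin k)) ≃L[ℂ] lp (fun _ : ℕ => ℂ) 1)) := by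
  refine ⟨?_, ?_⟩
  · intro k A _ _ _ X _ μ hμ hH
    -- The identity serves as the decomposition, so equivariance along it is linearity over the
    -- tensor product itself.
    obtain ⟨hB, e, he⟩ := (BanachHH.TensorDecomp.ofAlgEquiv
      (AlgEquiv.refl (R := ℂ) (A₁ := BanachHH.ProjTensor A)) fun _ => rfl).exists_equiv
      (fun i => (BanachHH.hasL1Approx_Lp (μ := μ i)).of_equiv (hμ i).some.symm) hH
    exact ⟨hB, ⟨{ e with map_smul' := he }⟩⟩
  · intro k hk
    -- Since the general theorem allows any algebra identified with the tensor product, it applies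
    -- to `ℓ¹(ℤ₊ᵏ)` directly, with no transport of `H_1` along `Φ`.
    obtain ⟨hB, e, he⟩ := (BanachHH.TensorDecomp.ofAlgEquiv (BanachHH.ellOneAlgEquiv k)
      (BanachHH.ellOneIso k).norm_map).exists_equiv
      (fun _ => BanachHH.hasL1Approx_EllOne Unit) fun _ => BanachHH.hh1_ellOne_unit.1
    exact ⟨hB, BanachHH.HH1.op_smul_eq_smul, one_smul _,
      ⟨BanachHH.ellOneAlgEquiv k, (BanachHH.ellOneIso k).norm_map,
        BanachHH.ellOneIso_elem_coeff k, e, he⟩,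
      ⟨e.trans (BanachHH.nonempty_summands_equiv_L1 k hk).some⟩⟩
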